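/- Let $n\in\mathbb N$, $b,T>0$, $A\in\mathbb R^{n\times n}$, let $f\in C^2(\mathbb R^n,\mathbb R^n)$ be such that for some $\lambda>0$ one has $\langle (Df(y)+\lambda I)v,v\rangle\ge 0$ for all $y,v\in\mathbb R^n$, and let $\varphi\in H^2(-b,0;\mathbb R^n)$ and $g\in H^1(0,T;\mathbb R^n)$. Then for every delay $\tau\in[0,b]$ the delay differential equation $$\dot x(t)+f(x(t))=A\,x(t-\tau)+g(t)\ \text{ in }(0,T),\qquad x(t)=\varphi(t)\ \text{ in }[-b,0],$$ has a unique solution $x=x[\tau]$, that is, a unique $x\in C([-b,T];\mathbb R^n)$ with $x|_{[0,T]}\in H^1(0,T;\mathbb R^n)$, with $x=\varphi$ on $[-b,0]$, and satisfying the equation almost everywhere in $(0,T)$. Let $L^2_{[0]}(-b,T;\mathbb R^n)=\{w\in L^2(-b,T;\mathbb R^n): w=0 \text{ a.e. in }(-b,0)\}$. The map $\tau\mapsto x[\tau]$ is twice continuously differentiable from $[0,b]$ to $L^2(-b,T;\mathbb R^n)$ (with one-sided derivatives at the end points), and its derivatives lie in $L^2_{[0]}(-b,T;\mathbb R^n)$: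 the derivative $x'[\tau]$ belongs to $L^2_{[0]}(-b,T;\mathbb R^n)$ for all $\tau\in[0,b]$, and $\tau\mapsto x'[\tau]$ is continuously differentiable from $[0,b]$ to $L^2_{[0]}(-b,T;\mathbb R^n)$. -/

import Mathlib

open MeasureTheory Set
open scoped ContDiff

/-- The state space `ℝⁿ` with its Euclidean norm. -/
abbrev StateSpace (n : ℕ) : Type := EuclideanSpace ℝ (Fin n)

/-- `v` is a weak derivative of `u` on the open interval `(α, β)`: both are locally integrable and
`∫ ψ' u = - ∫ ψ v` for every smooth real-valued `ψ` with compact support in `(α, β)`. -/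
def HasWeakDeriv {n : ℕ} (α β : ℝ) (u v : ℝ → StateSpace n) : Prop :=
  LocallyIntegrableOn u (Ioo α β) ∧ LocallyIntegrableOn v (Ioo α β) ∧
    ∀ ψ : ℝ → ℝ, ContDiff ℝ ∞ ψ → HasCompactSupport ψ → tsupport ψ ⊆ Ioo α β →
      ∫ t in Ioo α β, deriv ψ t • u t = -∫ t in Ioo α β, ψ t • v t

/-- `u ∈ L²(α, β; ℝⁿ)`. -/
def MemL2 {n : ℕ} (α β : ℝ) (u : ℝ → StateSpace n) : Prop :=
  MemLp u 2 (volume.restrict (Ioo α β))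

/-- `u ∈ H¹(α, β; ℝⁿ)`: `u` and its weak derivative are in `L²`. -/
def MemH1 {n : ℕ} (α β : ℝ) (u : ℝ → StateSpace n) : Prop :=
  MemL2 α β u ∧ ∃ v, HasWeakDeriv α β u v ∧ MemL2 α β v

/-- `u ∈ H²(α, β; ℝⁿ)`: `u`, its first and its second weak derivative are in `L²`. -/
def MemH2 {n : ℕ} (α β : ℝ) (u : ℝ → StateSpace n) : Prop :=
  MemL2 α β u ∧ ∃ v, HasWeakDeriv α β u v ∧ MemH1 α β v

/-- `x` is a solution of the delay equation `ẋ(t) + f(x(t)) = A x(t - τ) + g(t)` in `(0, T)`,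
`x = φ` in `[-b, 0]`: `x` is continuous on `[-b, T]`, its restriction to `(0, T)` is in `H¹`, and
the differential equation holds almost everywhere, with `ẋ` the weak derivative. As `φ` is an
element of a Sobolev space, `x = φ` is an equality almost everywhere on `(-b, 0)`; since `x` is
continuous this says that `x` is the continuous representative of `φ` on the whole of `[-b, 0]`. -/
structure IsDelaySolution {n : ℕ} (b T : ℝ) (A : Matrix (Fin n) (Fin n) ℝ)
    (f : StateSpace n → StateSpace n) (φ g : ℝ → StateSpace n) (τ : ℝ)
    (x : ℝ → StateSpace n) : Prop where
  continuousOn : ContinuousOn x (Icc (-b) T)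
  memH1 : MemH1 0 T x
  history : ∀ᵐ t ∂volume.restrict (Ioo (-b) 0), x t = φ t
  equation : ∃ v : ℝ → StateSpace n, HasWeakDeriv 0 T x v ∧
    ∀ᵐ t ∂volume.restrict (Ioo 0 T), v t + f (x t) = Matrix.toEuclideanLin A (x (t - τ)) + g t

/-- The Hilbert space `L²(-b, T; ℝⁿ)`. -/
abbrev L2Space (n : ℕ) (b T : ℝ) : Type :=
  Lp (StateSpace n) 2 (volume.restrict (Ioo (-b) T))

/-- The subspace of `L²(-b, T; ℝⁿ)` of the functions that vanish almost everywhere in `(-b, 0)`,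
with the norm of `L²`. -/
def L2Null (n : ℕ) (b T : ℝ) : Submodule ℝ (L2Space n b T) where
  carrier := {w | ∀ᵐ t ∂volume.restrict (Ioo (-b) T), t < 0 → w t = 0}
  zero_mem' := by
    filter_upwards [Lp.coeFn_zero (StateSpace n) 2 (volume.restrict (Ioo (-b) T))] with t ht _
    simpa using ht
  add_mem' := by
    intro u w hu hw
    filter_upwards [hu, hw, Lp.coeFn_add u w] with t h1 h2 h3 h0
    rw [h3, Pi.add_apply, h1 h0, h2 h0, add_zero]
  smul_mem' := by
    intro c w hw
    filter_upwards [hw, Lp.coeFn_smul c w] with t h1 h2 h0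
    rw [h2, Pi.smul_apply, h1 h0, smul_zero]

/-!
The plan is to compute the two derivatives formally, to define the candidates as solutions of their
own delay equations, and to show by Grönwall estimates that the difference quotients converge to
them.

*Integrated form.* With the continuous representatives `P` of `φ` and `G` of `g`, a solution is a
continuous function with `x = P` on `[-b, 0]` and
`x(t) = P(0) + ∫₀ᵗ (G - f(x)) ds + A ∫₀ᵗ x(s - τ) ds` on `[0, T]`
(`IsDelaySolution.exists_isDelayVolterra`, `IsDelayVolterra.isDelaySolution`). The delayed integral
is the integral of `x` from `-τ` to `t - τ`, so the derivative of that term with respect to `τ` is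
`A ∫₀ᵗ x'(s - τ) ds - A (x(t - τ) - P(-τ))`, and no time derivative of `x` is needed for the
equation of `y = x'[τ]`. Differentiating once more gives the equation of `z = x''[τ]`, whose forcing
term contains `A ẋ(t - τ)`. As `ẋ` has a jump at time `0`, the function `z` jumps at `t = τ`. It is
bounded nevertheless, and this is why the second derivative exists in `L²`, though not uniformly
in `t`.

*Truncation.* Monotonicity of `f + λ` gives `⟪f u, u⟫ ≥ -λ ‖u‖² - ‖f 0‖ ‖u‖`
(`le_inner_of_fderiv`), which bounds all solutions a priori, uniformly in the delay
(`IsDelayVolterra.exists_bound_of_inner`). The inequality survives multiplication of `f` by a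
cut-off function, hence one can replace `f` by a map with bounded derivatives (`exists_truncation`)
without changing any solution.

*Difference quotients.* Existence of `x`, `y`, `z` is Banach's fixed point theorem
(`exists_volterra`). The error of a difference quotient solves an equation of the same type
(`IsDelayVolterra.smul_sub_sub`), with forcing terms that are bounded and tend to zero for almost
every time; Grönwall's inequality with variable forcing then gives convergence at every time at
which the forcing converges (`IsDelayVolterra.tendsto_smul_sub`). The same lemma yields continuity
of `z` in the delay. Dominated convergence turns these pointwise limits into limits in `L²`
(`hasDerivWithinAt_Lp_two`).
-/

/-! ### Volterra inequalities and equations -/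

/-- Grönwall's inequality in integral form, with a forcing term that depends on time. -/
theorem le_of_le_add_integral {T C : ℝ} (hC : 0 ≤ C) {m a : ℝ → ℝ}
    (hm : IntervalIntegrable m volume 0 T) (ha : IntervalIntegrable a volume 0 T)
    (hm0 : ∀ t ∈ Icc 0 T, 0 ≤ m t) (ha0 : ∀ t ∈ Icc 0 T, 0 ≤ a t)
    (h : ∀ t ∈ Icc 0 T, m t ≤ a t + C * ∫ s in 0..t, m s) :
    ∀ t ∈ Icc 0 T, m t ≤ a t + C * Real.exp (C * T) * ∫ s in 0..T, a s := by
  intro t ht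
  have hT : 0 ≤ T := ht.1.trans ht.2
  -- `m` is cut off outside `(0, T]`, so that its primitive is continuous on the whole line
  set m' : ℝ → ℝ := (Ioc 0 T).indicator m with hm'
  have hm'i : Integrable m' := by
    rw [hm', integrable_indicator_iff measurableSet_Ioc]
    exact (intervalIntegrable_iff_integrableOn_Ioc_of_le hT).1 hm
  have hm'0 : ∀ s, 0 ≤ m' s := fun s =>
    indicator_nonneg (fun r hr => hm0 r ⟨hr.1.le, hr.2⟩) s
  set M : ℝ → ℝ := fun r => ∫ s in 0..r, m' s with hM
  have hMeq : ∀ r ∈ Icc 0 T, M r = ∫ s in 0..r, m s := by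
    intro r hr
    rw [hM]
    simp only
    rw [intervalIntegral.integral_of_le hr.1, intervalIntegral.integral_of_le hr.1]
    refine setIntegral_congr_fun measurableSet_Ioc fun s hs => ?_
    have hmem : s ∈ Ioc 0 T := ⟨hs.1, hs.2.trans hr.2⟩
    simp only [hm', indicator_of_mem hmem]
  have hMc : Continuous M :=
    intervalIntegral.continuous_primitive (fun _ _ => hm'i.intervalIntegrable) 0
  set W : ℝ → ℝ := fun r => ∫ s in 0..r, M s with hW
  have hWd : ∀ r, HasDerivAt W (M r) r := fun r =>
    intervalIntegral.integral_hasDerivAt_right (hMc.intervalIntegrable _ _)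
      hMc.stronglyMeasurable.stronglyMeasurableAtFilter hMc.continuousAt
  have hM0 : ∀ r, 0 ≤ r → 0 ≤ M r := fun r hr =>
    intervalIntegral.integral_nonneg hr fun s _ => hm'0 s
  have hW0 : ∀ r, 0 ≤ r → 0 ≤ W r := fun r hr =>
    intervalIntegral.integral_nonneg hr fun s hs => hM0 s hs.1
  set α : ℝ := ∫ s in 0..T, a s with hα
  have hsub : ∀ r ∈ Icc 0 T, uIcc 0 r ⊆ uIcc 0 T := by
    intro r hr
    rw [uIcc_of_le hr.1, uIcc_of_le hT]
    exact Icc_subset_Icc_right hr.2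
  have key : ∀ r ∈ Icc 0 T, M r ≤ C * W r + α := by
    intro r hr
    have ha' := ha.mono_set (hsub r hr)
    have hm'' := hm.mono_set (hsub r hr)
    rw [hMeq r hr]
    calc ∫ s in 0..r, m s ≤ ∫ s in 0..r, (a s + C * M s) := by
          refine intervalIntegral.integral_mono_on hr.1 hm''
            (ha'.add ((hMc.intervalIntegrable _ _).const_mul C)) fun s hs => ?_
          have hs' : s ∈ Icc 0 T := ⟨hs.1, hs.2.trans hr.2⟩
          rw [hMeq s hs']
          exact h s hs'
      _ = (∫ s in 0..r, a s) + C * W r := by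
          rw [intervalIntegral.integral_add ha' ((hMc.intervalIntegrable _ _).const_mul C),
            intervalIntegral.integral_const_mul]
      _ ≤ C * W r + α := by
          rw [add_comm]
          gcongr
          have : α = (∫ s in 0..r, a s) + ∫ s in r..T, a s := by
            rw [intervalIntegral.integral_add_adjacent_intervals ha']
            refine ha.mono_set ?_
            rw [uIcc_of_le hr.2, uIcc_of_le hT]
            exact Icc_subset_Icc_left hr.1
          have h2 : 0 ≤ ∫ s in r..T, a s :=
            intervalIntegral.integral_nonneg hr.2 fun s hs => ha0 s ⟨hr.1.trans hs.1, hs.2⟩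
          linarith
  have hα0 : 0 ≤ α := intervalIntegral.integral_nonneg hT fun s hs => ha0 s hs
  have hWb : W t ≤ gronwallBound 0 C α t := by
    have := norm_le_gronwallBound_of_norm_deriv_right_le (f := W) (f' := M) (δ := 0) (K := C)
      (ε := α) (a := 0) (b := T)
      (fun r _ => (hWd r).continuousAt.continuousWithinAt) (fun r _ => (hWd r).hasDerivWithinAt)
      (by simp [hW]) (fun r hr => by
        rw [Real.norm_of_nonneg (hM0 r hr.1), Real.norm_of_nonneg (hW0 r hr.1)]
        exact key r ⟨hr.1, hr.2.le⟩) t ht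
    rwa [Real.norm_of_nonneg (hW0 t ht.1), sub_zero] at this
  have hexp : C * gronwallBound 0 C α t + α = α * Real.exp (C * t) := by
    by_cases hC0 : C = 0
    · simp [hC0]
    · rw [gronwallBound_of_K_ne_0 hC0]
      field_simp
      ring
  have hMt : M t ≤ Real.exp (C * T) * α := by
    calc M t ≤ C * W t + α := key t ht
      _ ≤ C * gronwallBound 0 C α t + α := by gcongr
      _ = α * Real.exp (C * t) := hexp
      _ ≤ α * Real.exp (C * T) := by
          gcongr
          exact ht.2
      _ = _ := mul_comm _ _
  calc m t ≤ a t + C * ∫ s in 0..t, m s := h t ht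
    _ = a t + C * M t := by rw [hMeq t ht]
    _ ≤ a t + C * (Real.exp (C * T) * α) := by gcongr
    _ = _ := by ring

/-- Grönwall's inequality in integral form, with a constant forcing term. -/
theorem le_mul_of_le_add_integral {T C a : ℝ} (hC : 0 ≤ C) (ha : 0 ≤ a) {m : ℝ → ℝ}
    (hm : IntervalIntegrable m volume 0 T) (hm0 : ∀ t ∈ Icc 0 T, 0 ≤ m t)
    (h : ∀ t ∈ Icc 0 T, m t ≤ a + C * ∫ s in 0..t, m s) :
    ∀ t ∈ Icc 0 T, m t ≤ a * (1 + C * Real.exp (C * T) * T) := by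
  intro t ht
  have := le_of_le_add_integral hC hm (a := fun _ => a) intervalIntegrable_const hm0
    (fun _ _ => ha) h t ht
  simp only [intervalIntegral.integral_const, smul_eq_mul, sub_zero] at this
  linarith

/-- Stability of Volterra inequalities: if the forcing terms `a i` are bounded and tend to zero
almost everywhere, then `m i` tends to zero wherever `a i` does. -/
theorem tendsto_zero_of_le_add_integral {ι : Type*} {l : Filter ι} [l.IsCountablyGenerated]
    {T C K : ℝ} (hC : 0 ≤ C) {m a : ι → ℝ → ℝ}
    (hm : ∀ᶠ i in l, IntervalIntegrable (m i) volume 0 T)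
    (hm0 : ∀ᶠ i in l, ∀ t ∈ Icc 0 T, 0 ≤ m i t)
    (ham : ∀ᶠ i in l, AEStronglyMeasurable (a i) (volume.restrict (Ioc 0 T)))
    (ha : ∀ᶠ i in l, ∀ t ∈ Icc 0 T, 0 ≤ a i t ∧ a i t ≤ K)
    (h : ∀ᶠ i in l, ∀ t ∈ Icc 0 T, m i t ≤ a i t + C * ∫ s in 0..t, m i s)
    (hlim : ∀ᵐ t, t ∈ Ioc 0 T → Filter.Tendsto (fun i => a i t) l (nhds 0)) :
    ∀ t ∈ Icc 0 T, Filter.Tendsto (fun i => a i t) l (nhds 0) →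
      Filter.Tendsto (fun i => m i t) l (nhds 0) := by
  intro t ht hat
  have hT : 0 ≤ T := ht.1.trans ht.2
  have hint : Filter.Tendsto (fun i => ∫ s in 0..T, a i s) l (nhds 0) := by
    have := intervalIntegral.tendsto_integral_filter_of_dominated_convergence (μ := volume)
      (a := 0) (b := T) (F := a) (f := fun _ => (0 : ℝ)) (l := l) (fun _ => K)
      (by rw [uIoc_of_le hT]; exact ham)
      (by
        filter_upwards [ha] with i hi
        refine Filter.Eventually.of_forall fun s hs => ?_
        rw [uIoc_of_le hT] at hs
        have := hi s ⟨hs.1.le, hs.2⟩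
        rw [Real.norm_of_nonneg this.1]
        exact this.2)
      intervalIntegrable_const (by rw [uIoc_of_le hT]; exact hlim)
    simpa using this
  refine squeeze_zero' (g := fun i => a i t + C * Real.exp (C * T) * ∫ s in 0..T, a i s)
    ?_ ?_ ?_
  · filter_upwards [hm0] with i hi using hi t ht
  · filter_upwards [hm, hm0, ham, ha, h] with i h1 h2 h3 h4 h5
    refine le_of_le_add_integral hC h1 ?_ h2 (fun s hs => (h4 s hs).1) h5 t ht
    rw [intervalIntegrable_iff_integrableOn_Ioc_of_le hT]
    refine Integrable.mono' (g := fun _ => K) (integrable_const K) h3 ?_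
    refine (ae_restrict_iff' measurableSet_Ioc).2 (Filter.Eventually.of_forall fun s hs => ?_)
    have := h4 s ⟨hs.1.le, hs.2⟩
    rw [Real.norm_of_nonneg this.1]
    exact this.2
  · simpa using hat.add (hint.const_mul (C * Real.exp (C * T)))

/-- Existence for Volterra equations with a causal right-hand side that is Lipschitz continuous.
The causality is part of `hΦ`: only the values at times `r ≤ s` matter at time `s`, which
allows for delays. The proof is Banach's fixed point theorem for the exponentially weighted
norm. -/
theorem exists_volterra {E : Type*} [NormedAddCommGroup E] [NormedSpace ℝ E] [CompleteSpace E]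
    {T C : ℝ} (hT : 0 ≤ T) (hC : 0 ≤ C)
    (Φ : (ℝ → E) → ℝ → E)
    (hint : ∀ u, Continuous u → IntervalIntegrable (Φ u) volume 0 T)
    (hΦ : ∀ u v, Continuous u → Continuous v → ∀ s ∈ Icc 0 T, ∀ M,
      (∀ r ≤ s, ‖u r - v r‖ ≤ M) → ‖Φ u s - Φ v s‖ ≤ C * M) :
    ∃ u, Continuous u ∧ (∀ t ≤ 0, u t = 0) ∧ ∀ t ∈ Icc 0 T, u t = ∫ s in 0..t, Φ u s := by
  set L : ℝ := 2 * C + 1 with hL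
  have hL0 : 0 < L := by positivity
  let ext : C(Icc (0 : ℝ) T, E) → ℝ → E := fun v s =>
    Real.exp (L * (projIcc 0 T hT s : ℝ)) • v (projIcc 0 T hT s)
  have hext : ∀ v, Continuous (ext v) := by
    intro v
    have h1 : Continuous (projIcc (0 : ℝ) T hT) := continuous_projIcc
    fun_prop
  have hcont : ∀ v, Continuous fun t : Icc (0 : ℝ) T =>
      Real.exp (-(L * t)) • ∫ s in (0 : ℝ)..t, Φ (ext v) s := by
    intro v
    have h1 : ContinuousOn (fun t => ∫ s in (0 : ℝ)..t, Φ (ext v) s) (Icc 0 T) := by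
      have := intervalIntegral.continuousOn_primitive_interval (μ := volume)
        (a := 0) (b := T) (f := Φ (ext v)) (by
          rw [uIcc_of_le hT, integrableOn_Icc_iff_integrableOn_Ioc]
          exact (intervalIntegrable_iff_integrableOn_Ioc_of_le hT).1 (hint _ (hext v)))
      rwa [uIcc_of_le hT] at this
    have h2 := continuousOn_iff_continuous_domRestrict.1 h1
    have h3 : Continuous fun t : Icc (0 : ℝ) T => Real.exp (-(L * t)) := by fun_prop
    exact h3.smul h2
  let Γ : C(Icc (0 : ℝ) T, E) → C(Icc (0 : ℝ) T, E) := fun v => ⟨_, hcont v⟩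
  have hΓ : ContractingWith (1 / 2) Γ := by
    refine ⟨by norm_num, LipschitzWith.of_dist_le_mul fun v w => ?_⟩
    rw [ContinuousMap.dist_le (by positivity)]
    intro t
    have hd : ∀ s ∈ Icc 0 T, ∀ r ≤ s, ‖ext v r - ext w r‖ ≤ Real.exp (L * s) * dist v w := by
      intro s hs r hr
      have hp : (projIcc 0 T hT r : ℝ) ≤ s := by
        rw [coe_projIcc]
        exact max_le hs.1 ((min_le_right _ _).trans hr)
      simp only [ext]
      rw [← smul_sub, norm_smul, Real.norm_of_nonneg (Real.exp_pos _).le]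
      gcongr
      rw [← dist_eq_norm]
      exact ContinuousMap.dist_apply_le_dist _
    have htT : ∀ s ∈ Icc 0 (t : ℝ), s ∈ Icc 0 T := fun s hs => ⟨hs.1, hs.2.trans t.2.2⟩
    have hsub : uIcc 0 (t : ℝ) ⊆ uIcc 0 T := by
      rw [uIcc_of_le t.2.1, uIcc_of_le hT]
      exact Icc_subset_Icc_right t.2.2
    have hI : ‖∫ s in (0 : ℝ)..t, (Φ (ext v) s - Φ (ext w) s)‖ ≤
        ∫ s in (0 : ℝ)..t, C * dist v w * Real.exp (L * s) := by
      refine intervalIntegral.norm_integral_le_of_norm_le t.2.1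
        (Filter.Eventually.of_forall fun s hs => ?_)
        (Continuous.intervalIntegrable (by fun_prop) _ _)
      have := hΦ _ _ (hext v) (hext w) s (htT s ⟨hs.1.le, hs.2⟩) _
        (hd s (htT s ⟨hs.1.le, hs.2⟩))
      linarith
    have hE : ∫ s in (0 : ℝ)..t, C * dist v w * Real.exp (L * s) =
        C * dist v w * (L⁻¹ * (Real.exp (L * t) - 1)) := by
      rw [intervalIntegral.integral_const_mul,
        intervalIntegral.integral_comp_mul_left (fun x => Real.exp x) hL0.ne']
      simp
    rw [dist_eq_norm]
    change ‖Real.exp (-(L * t)) • (∫ s in (0 : ℝ)..t, Φ (ext v) s) -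
      Real.exp (-(L * t)) • ∫ s in (0 : ℝ)..t, Φ (ext w) s‖ ≤ _
    rw [← smul_sub, ← intervalIntegral.integral_sub ((hint _ (hext v)).mono_set hsub)
      ((hint _ (hext w)).mono_set hsub), norm_smul, Real.norm_of_nonneg (Real.exp_pos _).le]
    have hCL : C * L⁻¹ ≤ 1 / 2 := by
      rw [← div_eq_mul_inv, div_le_iff₀ hL0]
      linarith
    calc Real.exp (-(L * t)) * ‖∫ s in (0 : ℝ)..t, (Φ (ext v) s - Φ (ext w) s)‖
        ≤ Real.exp (-(L * t)) * (C * dist v w * (L⁻¹ * (Real.exp (L * t) - 1))) := by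
          gcongr
          exact hI.trans hE.le
      _ = C * L⁻¹ * dist v w * (1 - Real.exp (-(L * t))) := by
          rw [Real.exp_neg]
          field_simp
      _ ≤ 1 / 2 * dist v w * 1 := by
          gcongr
          · have : Real.exp (-(L * t)) ≤ 1 := Real.exp_le_one_iff.2 (by
              have := mul_nonneg hL0.le t.2.1
              linarith)
            linarith
          · linarith [Real.exp_pos (-(L * t))]
      _ = _ := by simp
  set v := ContractingWith.fixedPoint Γ hΓ with hv
  have hfix : Γ v = v := hΓ.fixedPoint_isFixedPt
  have heq : ∀ t ∈ Icc 0 T, ext v t = ∫ s in 0..t, Φ (ext v) s := by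
    intro t ht
    have h1 : (Γ v) ⟨t, ht⟩ = v ⟨t, ht⟩ := by rw [hfix]
    simp only [ext, projIcc_of_mem hT ht]
    rw [← h1]
    change Real.exp (L * t) • Real.exp (-(L * t)) • (∫ s in (0 : ℝ)..t, Φ (ext v) s) = _
    rw [smul_smul, ← Real.exp_add, add_neg_cancel, Real.exp_zero, one_smul]
  refine ⟨ext v, hext v, fun t ht => ?_, heq⟩
  have h0 := heq 0 ⟨le_rfl, hT⟩
  simp only [intervalIntegral.integral_same] at h0
  rw [← h0]
  simp only [ext, projIcc_of_le_left hT ht, projIcc_of_le_left hT le_rfl]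

/-! ### Volterra equations with one delay -/

theorem intervalIntegrable_of_norm_le {E : Type*} [NormedAddCommGroup E] {u : ℝ → E}
    (hu : StronglyMeasurable u) {α β K : ℝ} (hαβ : α ≤ β) (h : ∀ t ∈ Icc α β, ‖u t‖ ≤ K) :
    IntervalIntegrable u volume α β := by
  rw [intervalIntegrable_iff_integrableOn_Ioc_of_le hαβ]
  refine Integrable.mono' (g := fun _ => K) (integrable_const K) hu.aestronglyMeasurable ?_
  exact (ae_restrict_iff' measurableSet_Ioc).2
    (Filter.Eventually.of_forall fun s hs => h s ⟨hs.1.le, hs.2⟩)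

section

variable {E : Type*} [NormedAddCommGroup E] [NormedSpace ℝ E]

/-- `u` solves the delay equation `u(t) = F(t) + ∫₀ᵗ N(s) ds + A ∫₀ᵗ u(s - σ) ds` on `[0, T]`, and
is measurable and bounded on `[-b, T]`. The values of `u` on `[-b, 0]` are the history. In the
applications `N` is a nonlinear or linear expression in `u`. -/
structure IsDelayVolterra (b T : ℝ) (A : E →L[ℝ] E) (σ : ℝ) (F N u : ℝ → E) : Prop where
  stronglyMeasurable : StronglyMeasurable u
  intervalIntegrable : IntervalIntegrable N volume 0 T
  bounded : ∃ K, ∀ t ∈ Icc (-b) T, ‖u t‖ ≤ K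
  eq : ∀ t ∈ Icc 0 T, u t = F t + (∫ s in 0..t, N s) + A (∫ s in 0..t, u (s - σ))

theorem sub_mem_Icc_of_mem {b T σ s : ℝ} (hσ : σ ∈ Icc 0 b) (hs : s ∈ Icc 0 T) :
    s - σ ∈ Icc (-b) T :=
  ⟨by linarith [hσ.2, hs.1], by linarith [hσ.1, hs.2]⟩

theorem intervalIntegrable_comp_sub {E : Type*} [NormedAddCommGroup E] {b T σ K : ℝ}
    (hσ : σ ∈ Icc 0 b) {u : ℝ → E}
    (hu : StronglyMeasurable u) (hK : ∀ t ∈ Icc (-b) T, ‖u t‖ ≤ K) {t : ℝ} (ht : t ∈ Icc 0 T) :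
    IntervalIntegrable (fun s => u (s - σ)) volume 0 t :=
  intervalIntegrable_of_norm_le (K := K)
    (hu.comp_measurable (measurable_id.sub_const σ)) ht.1
    fun _ hs => hK _ (sub_mem_Icc_of_mem hσ ⟨hs.1, hs.2.trans ht.2⟩)

/-- A delay costs at most the integral over the history. -/
theorem integral_norm_comp_sub_le {E : Type*} [NormedAddCommGroup E] {b T σ K δ : ℝ}
    (hσ : σ ∈ Icc 0 b) {u : ℝ → E}
    (hu : StronglyMeasurable u) (hK : ∀ t ∈ Icc (-b) T, ‖u t‖ ≤ K) (hδ : 0 ≤ δ)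
    (hhist : ∀ t ∈ Icc (-b) 0, ‖u t‖ ≤ δ) {t : ℝ} (ht : t ∈ Icc 0 T) :
    ∫ s in 0..t, ‖u (s - σ)‖ ≤ b * δ + ∫ s in 0..t, ‖u s‖ := by
  have hint : ∀ α β, -b ≤ α → α ≤ β → β ≤ T →
      IntervalIntegrable (fun s => ‖u s‖) volume α β := fun α β h1 h2 h3 =>
    (intervalIntegrable_of_norm_le hu h2 fun r hr => hK r ⟨h1.trans hr.1, hr.2.trans h3⟩).norm
  have hT := ht.1.trans ht.2
  rw [intervalIntegral.integral_comp_sub_right (fun s => ‖u s‖) σ, zero_sub]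
  have h1 : ∫ s in -σ..t - σ, ‖u s‖ ≤ ∫ s in -σ..t, ‖u s‖ := by
    rw [← intervalIntegral.integral_add_adjacent_intervals (b := t - σ) (c := t)
      (hint _ _ (by linarith [hσ.2]) (by linarith [ht.1]) (by linarith [ht.2, hσ.1]))
      (hint _ _ (by linarith [hσ.2, ht.1]) (by linarith [hσ.1]) ht.2)]
    have : 0 ≤ ∫ s in t - σ..t, ‖u s‖ :=
      intervalIntegral.integral_nonneg (by linarith [hσ.1]) fun s _ => norm_nonneg _
    linarith
  have h2 : ∫ s in -σ..0, ‖u s‖ ≤ σ * δ := by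
    have := intervalIntegral.integral_mono_on (a := -σ) (b := 0) (f := fun s => ‖u s‖)
      (g := fun _ => δ) (μ := volume) (by linarith [hσ.1])
      (hint _ _ (by linarith [hσ.2]) (by linarith [hσ.1]) hT) intervalIntegrable_const
      fun s hs => hhist s ⟨by linarith [hσ.2, hs.1], hs.2⟩
    simpa using this
  rw [← intervalIntegral.integral_add_adjacent_intervals (b := 0) (c := t)
      (hint _ _ (by linarith [hσ.2]) (by linarith [hσ.1]) hT)
      (hint _ _ (by linarith [hσ.1, hσ.2]) ht.1 ht.2)] at h1
  have h3 : σ * δ ≤ b * δ := by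
    gcongr
    exact hσ.2
  linarith

variable {b T : ℝ} {A : E →L[ℝ] E}

theorem IsDelayVolterra.zero (τ : ℝ) :
    IsDelayVolterra b T A τ (fun _ => 0) (fun _ => 0) (fun _ => 0) where
  stronglyMeasurable := stronglyMeasurable_const
  intervalIntegrable := intervalIntegrable_const
  bounded := ⟨0, by simp⟩
  eq := by simp

/-- The basic estimate, with a constant that depends on `b`, `T`, `A` and `C` only. -/
theorem IsDelayVolterra.exists_bound (b T : ℝ) (hb : 0 ≤ b) (hT : 0 ≤ T) (A : E →L[ℝ] E) {C : ℝ}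
    (hC : 0 ≤ C) : ∃ K, 0 ≤ K ∧ ∀ (σ : ℝ) (F N u : ℝ → E) (δ : ℝ), σ ∈ Icc 0 b → 0 ≤ δ →
      IsDelayVolterra b T A σ F N u → (∀ t ∈ Icc (-b) 0, ‖u t‖ ≤ δ) →
      (∀ t ∈ Icc 0 T, ‖F t‖ ≤ δ) → (∀ t ∈ Icc 0 T, ‖N t‖ ≤ C * ‖u t‖ + δ) →
      ∀ t ∈ Icc (-b) T, ‖u t‖ ≤ K * δ := by
  set C' := C + ‖A‖ with hC'
  have hC'0 : 0 ≤ C' := by positivity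
  set κ := (1 + T + ‖A‖ * b) * (1 + C' * Real.exp (C' * T) * T) with hκ
  have hκ0 : 0 ≤ κ := by positivity
  refine ⟨κ + 1, by positivity, fun σ F N u δ hσ hδ hu hhist hF hN t ht => ?_⟩
  obtain ⟨K, hK⟩ := hu.bounded
  rcases le_total t 0 with ht0 | ht0
  · have := hhist t ⟨ht.1, ht0⟩
    nlinarith
  have huint : ∀ r ∈ Icc 0 T, IntervalIntegrable u volume 0 r := fun r hr =>
    intervalIntegrable_of_norm_le hu.stronglyMeasurable hr.1
      fun s hs => hK s ⟨by linarith [hs.1], hs.2.trans hr.2⟩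
  have key : ∀ r ∈ Icc 0 T, ‖u r‖ ≤ (1 + T + ‖A‖ * b) * δ + C' * ∫ s in 0..r, ‖u s‖ := by
    intro r hr
    have h1 : ‖∫ s in 0..r, N s‖ ≤ ∫ s in 0..r, (C * ‖u s‖ + δ) :=
      intervalIntegral.norm_integral_le_of_norm_le hr.1
        (Filter.Eventually.of_forall fun s hs => hN s ⟨hs.1.le, hs.2.trans hr.2⟩)
        (((huint r hr).norm.const_mul C).add intervalIntegrable_const)
    rw [intervalIntegral.integral_add ((huint r hr).norm.const_mul C) intervalIntegrable_const,
      intervalIntegral.integral_const_mul, intervalIntegral.integral_const, sub_zero,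
      smul_eq_mul] at h1
    have h2 : ‖A (∫ s in 0..r, u (s - σ))‖ ≤ ‖A‖ * (b * δ + ∫ s in 0..r, ‖u s‖) := by
      refine (A.le_opNorm _).trans ?_
      gcongr
      exact (intervalIntegral.norm_integral_le_integral_norm hr.1).trans
        (integral_norm_comp_sub_le hσ hu.stronglyMeasurable hK hδ hhist hr)
    have h3 : r * δ ≤ T * δ := by
      gcongr
      exact hr.2
    have h4 := hF r hr
    rw [hu.eq r hr]
    refine (norm_add₃_le).trans ?_
    rw [hC']
    linarith
  have := le_mul_of_le_add_integral hC'0 (by positivity) (huint T ⟨hT, le_rfl⟩).norm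
    (fun s _ => norm_nonneg (u s)) key t ⟨ht0, ht.2⟩
  rw [hκ]
  linarith

/-- Scaled differences of solutions with different delays solve an equation of the same kind.
For `c = (σ - τ)⁻¹` and `v` the candidate for the derivative with respect to the delay this is
the equation of the error of the difference quotient. -/
theorem IsDelayVolterra.smul_sub_sub {σ τ : ℝ} (hσ : σ ∈ Icc 0 b) (hτ : τ ∈ Icc 0 b)
    {F₁ N₁ u₁ F₂ N₂ u₂ G q v : ℝ → E}
    (h₁ : IsDelayVolterra b T A σ F₁ N₁ u₁) (h₂ : IsDelayVolterra b T A τ F₂ N₂ u₂)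
    (hv : IsDelayVolterra b T A τ G q v) (c : ℝ) :
    IsDelayVolterra b T A σ
      (fun t => c • (F₁ t - F₂ t) + A (c • ∫ s in 0..t, (u₂ (s - σ) - u₂ (s - τ))) - G t
        + A (∫ s in 0..t, (v (s - σ) - v (s - τ))))
      (fun t => c • (N₁ t - N₂ t) - q t) (fun t => c • (u₁ t - u₂ t) - v t) where
  stronglyMeasurable :=
    ((h₁.stronglyMeasurable.sub h₂.stronglyMeasurable).const_smul c).sub hv.stronglyMeasurable
  intervalIntegrable :=
    ((h₁.intervalIntegrable.sub h₂.intervalIntegrable).smul c).sub hv.intervalIntegrable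
  bounded := by
    obtain ⟨K₁, hK₁⟩ := h₁.bounded
    obtain ⟨K₂, hK₂⟩ := h₂.bounded
    obtain ⟨K₃, hK₃⟩ := hv.bounded
    refine ⟨|c| * (K₁ + K₂) + K₃, fun t ht => (norm_sub_le _ _).trans ?_⟩
    rw [norm_smul, Real.norm_eq_abs]
    gcongr
    · exact (norm_sub_le _ _).trans (add_le_add (hK₁ t ht) (hK₂ t ht))
    · exact hK₃ t ht
  eq := by
    intro t ht
    have hsub : uIcc 0 t ⊆ uIcc 0 T := by
      rw [uIcc_of_le ht.1, uIcc_of_le (ht.1.trans ht.2)]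
      exact Icc_subset_Icc_right ht.2
    obtain ⟨K₁, hK₁⟩ := h₁.bounded
    obtain ⟨K₂, hK₂⟩ := h₂.bounded
    obtain ⟨K₃, hK₃⟩ := hv.bounded
    have i₁ := intervalIntegrable_comp_sub hσ h₁.stronglyMeasurable hK₁ ht
    have i₂ := intervalIntegrable_comp_sub hσ h₂.stronglyMeasurable hK₂ ht
    have i₂' := intervalIntegrable_comp_sub hτ h₂.stronglyMeasurable hK₂ ht
    have i₃ := intervalIntegrable_comp_sub hσ hv.stronglyMeasurable hK₃ ht
    have i₃' := intervalIntegrable_comp_sub hτ hv.stronglyMeasurable hK₃ ht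
    have j₁ := h₁.intervalIntegrable.mono_set hsub
    have j₂ := h₂.intervalIntegrable.mono_set hsub
    have j₃ := hv.intervalIntegrable.mono_set hsub
    have k₁ : IntervalIntegrable (fun s => c • (N₁ s - N₂ s)) volume 0 t := (j₁.sub j₂).smul c
    have k₂ : IntervalIntegrable (fun s => c • (u₁ (s - σ) - u₂ (s - σ))) volume 0 t :=
      (i₁.sub i₂).smul c
    rw [intervalIntegral.integral_sub k₁ j₃, intervalIntegral.integral_smul,
      intervalIntegral.integral_sub j₁ j₂, intervalIntegral.integral_sub k₂ i₃,
      intervalIntegral.integral_smul, intervalIntegral.integral_sub i₁ i₂,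
      intervalIntegral.integral_sub i₂ i₂', intervalIntegral.integral_sub i₃ i₃',
      h₁.eq t ht, h₂.eq t ht, hv.eq t ht]
    simp only [map_sub, map_smul, smul_sub, smul_add]
    abel

/-- The forcing term inherits the measurability of the solution. -/
theorem IsDelayVolterra.aestronglyMeasurable {σ : ℝ} (hT : 0 ≤ T) (hσ : σ ∈ Icc 0 b)
    {F N u : ℝ → E} (hu : IsDelayVolterra b T A σ F N u) :
    AEStronglyMeasurable F (volume.restrict (Ioc 0 T)) := by
  obtain ⟨K, hK⟩ := hu.bounded
  have hprim : ∀ w : ℝ → E, IntervalIntegrable w volume 0 T →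
      AEStronglyMeasurable (fun t => ∫ s in 0..t, w s) (volume.restrict (Ioc 0 T)) := by
    intro w hw
    have h := intervalIntegral.continuousOn_primitive_interval (μ := volume)
        (a := 0) (b := T) (f := w) (by
          rw [uIcc_of_le hT, integrableOn_Icc_iff_integrableOn_Ioc]
          exact (intervalIntegrable_iff_integrableOn_Ioc_of_le hT).1 hw)
    rw [uIcc_of_le hT] at h
    exact (h.mono Ioc_subset_Icc_self).aestronglyMeasurable measurableSet_Ioc
  have h1 := hprim N hu.intervalIntegrable
  have h2 := A.continuous.comp_aestronglyMeasurable
    (hprim _ (intervalIntegrable_comp_sub hσ hu.stronglyMeasurable hK ⟨hT, le_rfl⟩))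
  refine ((hu.stronglyMeasurable.aestronglyMeasurable.sub h1).sub h2).congr ?_
  refine (ae_restrict_iff' measurableSet_Ioc).2 (Filter.Eventually.of_forall fun t ht => ?_)
  have := hu.eq t ⟨ht.1.le, ht.2⟩
  simp only [Pi.sub_apply]
  rw [this]
  abel

/-- Convergence of solutions with zero history to zero. -/
theorem IsDelayVolterra.tendsto_zero {ι : Type*} {l : Filter ι} [l.IsCountablyGenerated]
    (hb : 0 ≤ b) {C K : ℝ} (hC : 0 ≤ C) {σ : ι → ℝ} {F N u : ι → ℝ → E} {ρ : ι → ℝ → ℝ}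
    (hσ : ∀ᶠ i in l, σ i ∈ Icc 0 b)
    (hu : ∀ᶠ i in l, IsDelayVolterra b T A (σ i) (F i) (N i) (u i))
    (hhist : ∀ᶠ i in l, ∀ t ∈ Icc (-b) 0, u i t = 0)
    (hF : ∀ᶠ i in l, ∀ t ∈ Icc 0 T, ‖F i t‖ ≤ K)
    (hρm : ∀ᶠ i in l, AEStronglyMeasurable (ρ i) (volume.restrict (Ioc 0 T)))
    (hρ : ∀ᶠ i in l, ∀ t ∈ Icc 0 T, 0 ≤ ρ i t ∧ ρ i t ≤ K)
    (hN : ∀ᶠ i in l, ∀ t ∈ Icc 0 T, ‖N i t‖ ≤ C * ‖u i t‖ + ρ i t)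
    (hFlim : ∀ᵐ t, t ∈ Ioc 0 T → Filter.Tendsto (fun i => F i t) l (nhds 0))
    (hρlim : ∀ᵐ t, t ∈ Ioc 0 T → Filter.Tendsto (fun i => ρ i t) l (nhds 0)) :
    ∀ t ∈ Icc 0 T, Filter.Tendsto (fun i => F i t) l (nhds 0) →
      Filter.Tendsto (fun i => u i t) l (nhds 0) := by
  intro t ht hFt
  have hT : 0 ≤ T := ht.1.trans ht.2
  have hT' : T ∈ Icc 0 T := ⟨hT, le_rfl⟩
  have hρi : ∀ᶠ i in l, IntervalIntegrable (ρ i) volume 0 T := by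
    filter_upwards [hρm, hρ] with i h1 h2
    rw [intervalIntegrable_iff_integrableOn_Ioc_of_le hT]
    refine Integrable.mono' (g := fun _ => K) (integrable_const K) h1 ?_
    refine (ae_restrict_iff' measurableSet_Ioc).2 (Filter.Eventually.of_forall fun s hs => ?_)
    have := h2 s ⟨hs.1.le, hs.2⟩
    rw [Real.norm_of_nonneg this.1]
    exact this.2
  have hint : Filter.Tendsto (fun i => ∫ s in 0..T, ρ i s) l (nhds 0) := by
    have := intervalIntegral.tendsto_integral_filter_of_dominated_convergence (μ := volume)
      (a := 0) (b := T) (F := ρ) (f := fun _ => (0 : ℝ)) (l := l) (fun _ => K)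
      (by rw [uIoc_of_le hT]; exact hρm)
      (by
        filter_upwards [hρ] with i hi
        refine Filter.Eventually.of_forall fun s hs => ?_
        rw [uIoc_of_le hT] at hs
        have := hi s ⟨hs.1.le, hs.2⟩
        rw [Real.norm_of_nonneg this.1]
        exact this.2)
      intervalIntegrable_const (by rw [uIoc_of_le hT]; exact hρlim)
    simpa using this
  have huint : ∀ᶠ i in l, ∀ r ∈ Icc 0 T, IntervalIntegrable (u i) volume 0 r := by
    filter_upwards [hu] with i hi r hr
    obtain ⟨K, hK⟩ := hi.bounded
    exact intervalIntegrable_of_norm_le hi.stronglyMeasurable hr.1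
      fun s hs => hK s ⟨by linarith [hs.1], hs.2.trans hr.2⟩
  have hlim : ∀ r, Filter.Tendsto (fun i => F i r) l (nhds 0) →
      Filter.Tendsto (fun i => ‖F i r‖ + ∫ s in 0..T, ρ i s) l (nhds 0) := by
    intro r hr
    simpa using hr.norm.add hint
  rw [tendsto_zero_iff_norm_tendsto_zero]
  refine tendsto_zero_of_le_add_integral (C := C + ‖A‖) (K := K + K * T) (T := T)
    (m := fun i t => ‖u i t‖) (a := fun i t => ‖F i t‖ + ∫ s in 0..T, ρ i s) (by positivity)
    ?_ ?_ ?_ ?_ ?_ ?_ t ht (hlim t hFt)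
  · filter_upwards [huint] with i hi using (hi T hT').norm
  · exact Filter.Eventually.of_forall fun i s _ => norm_nonneg _
  · filter_upwards [hu, hσ] with i hi hi'
    exact (hi.aestronglyMeasurable hT hi').norm.add aestronglyMeasurable_const
  · filter_upwards [hF, hρ, hρi] with i h1 h2 h3 s hs
    have h4 : 0 ≤ ∫ s in 0..T, ρ i s :=
      intervalIntegral.integral_nonneg hT fun r hr => (h2 r hr).1
    have h5 : ∫ s in 0..T, ρ i s ≤ K * T := by
      have := intervalIntegral.integral_mono_on hT h3 intervalIntegrable_const
        fun r hr => (h2 r hr).2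
      simpa [mul_comm] using this
    exact ⟨by positivity, add_le_add (h1 s hs) h5⟩
  · filter_upwards [hu, hσ, hhist, hρ, hρi, hN, huint] with i h1 h2 h3 h4 h5 h6 h7 r hr
    obtain ⟨K, hK⟩ := h1.bounded
    have hρr : IntervalIntegrable (ρ i) volume 0 r := by
      refine h5.mono_set ?_
      rw [uIcc_of_le hr.1, uIcc_of_le hT]
      exact Icc_subset_Icc_right hr.2
    have e1 : ‖∫ s in 0..r, N i s‖ ≤ ∫ s in 0..r, (C * ‖u i s‖ + ρ i s) :=
      intervalIntegral.norm_integral_le_of_norm_le hr.1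
        (Filter.Eventually.of_forall fun s hs => h6 s ⟨hs.1.le, hs.2.trans hr.2⟩)
        (((h7 r hr).norm.const_mul C).add hρr)
    rw [intervalIntegral.integral_add ((h7 r hr).norm.const_mul C) hρr,
      intervalIntegral.integral_const_mul] at e1
    have e2 : ‖A (∫ s in 0..r, u i (s - σ i))‖ ≤ ‖A‖ * ∫ s in 0..r, ‖u i s‖ := by
      refine (A.le_opNorm _).trans ?_
      gcongr
      have := integral_norm_comp_sub_le h2 h1.stronglyMeasurable hK le_rfl
        (fun s hs => by rw [h3 s hs, norm_zero]) hr
      rw [mul_zero, zero_add] at this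
      exact (intervalIntegral.norm_integral_le_integral_norm hr.1).trans this
    have e3 : ∫ s in 0..r, ρ i s ≤ ∫ s in 0..T, ρ i s := by
      have hs2 : IntervalIntegrable (ρ i) volume r T := by
        refine h5.mono_set ?_
        rw [uIcc_of_le hr.2, uIcc_of_le hT]
        exact Icc_subset_Icc_left hr.1
      rw [← intervalIntegral.integral_add_adjacent_intervals hρr hs2]
      have : 0 ≤ ∫ s in r..T, ρ i s :=
        intervalIntegral.integral_nonneg hr.2 fun s hs => (h4 s ⟨hr.1.trans hs.1, hs.2⟩).1
      linarith
    rw [h1.eq r hr]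
    refine (norm_add₃_le).trans ?_
    linarith
  · filter_upwards [hFlim] with s hs hs' using hlim s (hs hs')

end

section

variable {E : Type*} [NormedAddCommGroup E] [NormedSpace ℝ E] {b T : ℝ} {A : E →L[ℝ] E}

/-- Existence for delay Volterra equations with a Lipschitz nonlinearity. The solution is the sum of
a prescribed function `B`, which carries the history and the forcing, and of a continuous
function that vanishes on the history interval. -/
theorem exists_isDelayVolterra [CompleteSpace E] (hT : 0 ≤ T) {C K : ℝ} (hC : 0 ≤ C)
    {σ : ℝ} (hσ : σ ∈ Icc 0 b) {B : ℝ → E} (hBm : StronglyMeasurable B)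
    (hB : ∀ t ∈ Icc (-b) T, ‖B t‖ ≤ K) {N : ℝ → E → E}
    (hNi : ∀ w, Continuous w → IntervalIntegrable (fun s => N s (B s + w s)) volume 0 T)
    (hN : ∀ s ∈ Icc 0 T, ∀ u v, ‖N s u - N s v‖ ≤ C * ‖u - v‖) :
    ∃ w, Continuous w ∧ (∀ t ≤ 0, w t = 0) ∧
      IsDelayVolterra b T A σ B (fun s => N s (B s + w s)) (fun t => B t + w t) := by
  have hbd : ∀ w : ℝ → E, Continuous w → ∃ K', ∀ t ∈ Icc (-b) T, ‖B t + w t‖ ≤ K' := by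
    intro w hw
    obtain ⟨K₁, hK₁⟩ := (isCompact_Icc (a := -b) (b := T)).exists_bound_of_continuousOn
      hw.continuousOn
    exact ⟨K + K₁, fun t ht => (norm_add_le _ _).trans (add_le_add (hB t ht) (hK₁ t ht))⟩
  have hdel : ∀ w : ℝ → E, Continuous w → ∀ t ∈ Icc 0 T,
      IntervalIntegrable (fun s => B (s - σ) + w (s - σ)) volume 0 t := by
    intro w hw t ht
    obtain ⟨K', hK'⟩ := hbd w hw
    exact intervalIntegrable_comp_sub (u := fun t => B t + w t) hσ
      (hBm.add hw.stronglyMeasurable) hK' ht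
  have hAdel : ∀ w : ℝ → E, Continuous w → ∀ t ∈ Icc 0 T,
      IntervalIntegrable (fun s => A (B (s - σ) + w (s - σ))) volume 0 t := by
    intro w hw t ht
    have := hdel w hw t ht
    exact ⟨A.integrable_comp this.1, A.integrable_comp this.2⟩
  obtain ⟨w, hwc, hw0, hw⟩ := exists_volterra hT (add_nonneg hC (norm_nonneg A))
    (fun w s => N s (B s + w s) + A (B (s - σ) + w (s - σ)))
    (fun w hw => (hNi w hw).add (hAdel w hw T ⟨hT, le_rfl⟩))
    (by
      intro u v hu hv s hs M hM
      have e : N s (B s + u s) + A (B (s - σ) + u (s - σ)) -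
          (N s (B s + v s) + A (B (s - σ) + v (s - σ))) =
          (N s (B s + u s) - N s (B s + v s)) + A (u (s - σ) - v (s - σ)) := by
        simp only [map_add, map_sub]
        abel
      rw [e]
      have h1 := hN s hs (B s + u s) (B s + v s)
      rw [add_sub_add_left_eq_sub] at h1
      have h2 : C * ‖u s - v s‖ ≤ C * M := by
        gcongr
        exact hM s le_rfl
      have h3 : ‖A (u (s - σ) - v (s - σ))‖ ≤ ‖A‖ * M := by
        refine (A.le_opNorm _).trans ?_
        gcongr
        exact hM _ (by linarith [hσ.1])
      refine (norm_add_le _ _).trans ?_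
      linarith)
  refine ⟨w, hwc, hw0, hBm.add hwc.stronglyMeasurable, hNi w hwc, hbd w hwc, fun t ht => ?_⟩
  have hsub : uIcc 0 t ⊆ uIcc 0 T := by
    rw [uIcc_of_le ht.1, uIcc_of_le hT]
    exact Icc_subset_Icc_right ht.2
  rw [hw t ht, intervalIntegral.integral_add ((hNi w hwc).mono_set hsub) (hAdel w hwc t ht),
    A.intervalIntegral_comp_comm (hdel w hwc t ht)]
  abel

/-- Two solutions with the same history differ by no more than their data do. Here `δ` also
controls how much a delayed solution changes with the delay. -/
theorem IsDelayVolterra.exists_bound_sub (b T : ℝ) (hb : 0 ≤ b) (hT : 0 ≤ T) (A : E →L[ℝ] E)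
    {C : ℝ} (hC : 0 ≤ C) : ∃ K, 0 ≤ K ∧ ∀ (σ τ : ℝ) (F₁ N₁ u₁ F₂ N₂ u₂ : ℝ → E) (δ : ℝ),
      σ ∈ Icc 0 b → τ ∈ Icc 0 b → 0 ≤ δ →
      IsDelayVolterra b T A σ F₁ N₁ u₁ → IsDelayVolterra b T A τ F₂ N₂ u₂ →
      (∀ t ∈ Icc (-b) 0, u₁ t = u₂ t) → (∀ t ∈ Icc 0 T, ‖F₁ t - F₂ t‖ ≤ δ) →
      (∀ t ∈ Icc 0 T, ‖N₁ t - N₂ t‖ ≤ C * ‖u₁ t - u₂ t‖ + δ) →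
      (∀ t ∈ Icc 0 T, ‖u₂ (t - σ) - u₂ (t - τ)‖ ≤ δ) →
      ∀ t ∈ Icc (-b) T, ‖u₁ t - u₂ t‖ ≤ K * δ := by
  obtain ⟨K, hK0, hK⟩ := IsDelayVolterra.exists_bound b T hb hT A hC
  refine ⟨K * (1 + ‖A‖ * T), by positivity, ?_⟩
  intro σ τ F₁ N₁ u₁ F₂ N₂ u₂ δ hσ hτ hδ h₁ h₂ hhist hF hN hlip t ht
  have hle : δ ≤ (1 + ‖A‖ * T) * δ := by
    have : 0 ≤ ‖A‖ * T * δ := by positivity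
    linarith
  have := hK σ _ _ _ ((1 + ‖A‖ * T) * δ) hσ (by positivity)
    (h₁.smul_sub_sub hσ hτ h₂ (IsDelayVolterra.zero τ) 1)
    (fun s hs => by
      rw [hhist s hs]
      simpa using by positivity)
    (fun s hs => by
      simp only [one_smul, sub_zero, intervalIntegral.integral_zero, map_zero, add_zero]
      have h1 : ‖∫ r in 0..s, (u₂ (r - σ) - u₂ (r - τ))‖ ≤ δ * |s - 0| :=
        intervalIntegral.norm_integral_le_of_norm_le_const fun r hr => by
          rw [uIoc_of_le hs.1] at hr
          exact hlip r ⟨hr.1.le, hr.2.trans hs.2⟩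
      rw [sub_zero, abs_of_nonneg hs.1] at h1
      have h2 : δ * s ≤ δ * T := by
        gcongr
        exact hs.2
      calc _ ≤ ‖F₁ s - F₂ s‖ + ‖A‖ * ‖∫ r in 0..s, (u₂ (r - σ) - u₂ (r - τ))‖ :=
            (norm_add_le _ _).trans (add_le_add le_rfl (A.le_opNorm _))
        _ ≤ δ + ‖A‖ * (δ * T) := by
            gcongr
            · exact hF s hs
            · exact h1.trans h2
        _ = _ := by ring)
    (fun s hs => by
      simp only [one_smul, sub_zero]
      exact (hN s hs).trans (by linarith))
    t ht
  simp only [one_smul, sub_zero] at this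
  linarith

/-- Translations act continuously on the primitives of a bounded function with countably many
discontinuities. -/
theorem tendsto_integral_comp_sub {v : ℝ → E} {K τ t : ℝ} (hv : StronglyMeasurable v)
    (hK : ∀ t ∈ Icc (-b) T, ‖v t‖ ≤ K) {D : Set ℝ} (hD : D.Countable)
    (hc : ∀ r ∈ Ioo (-b) T, r ∉ D → ContinuousAt v r) (hτ : τ ∈ Icc 0 b) (ht : t ∈ Icc 0 T) :
    Filter.Tendsto (fun σ => ∫ s in 0..t, (v (s - σ) - v (s - τ)))
      (nhdsWithin τ (Icc 0 b)) (nhds 0) := by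
  have := intervalIntegral.tendsto_integral_filter_of_dominated_convergence (μ := volume)
    (a := 0) (b := t) (F := fun σ s => v (s - σ) - v (s - τ)) (f := fun _ => (0 : E))
    (l := nhdsWithin τ (Icc 0 b)) (fun _ => K + K)
    (Filter.Eventually.of_forall fun σ =>
      ((hv.comp_measurable (measurable_id.sub_const σ)).sub
        (hv.comp_measurable (measurable_id.sub_const τ))).aestronglyMeasurable)
    (by
      filter_upwards [self_mem_nhdsWithin] with σ hσ
      refine Filter.Eventually.of_forall fun s hs => ?_
      rw [uIoc_of_le ht.1] at hs
      have hs' : s ∈ Icc 0 T := ⟨hs.1.le, hs.2.trans ht.2⟩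
      exact (norm_sub_le _ _).trans (add_le_add (hK _ (sub_mem_Icc_of_mem hσ hs'))
        (hK _ (sub_mem_Icc_of_mem hτ hs'))))
    intervalIntegrable_const
    (by
      have hD' : ((fun r => r + τ) '' (D ∪ {T})).Countable :=
        (hD.union (countable_singleton T)).image _
      filter_upwards [hD'.ae_notMem volume] with s hs hst
      rw [uIoc_of_le ht.1] at hst
      have hsD : s - τ ∉ D ∪ {T} := fun h => hs ⟨s - τ, h, by simp⟩
      have hcs : ContinuousAt v (s - τ) := by
        refine hc _ ⟨by linarith [hτ.2, hst.1], ?_⟩ fun h => hsD (Or.inl h)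
        exact lt_of_le_of_ne (by linarith [hst.2, ht.2, hτ.1]) fun h => hsD (Or.inr h)
      have h1 : Filter.Tendsto (fun σ => s - σ) (nhdsWithin τ (Icc 0 b)) (nhds (s - τ)) :=
        ((continuous_const.sub continuous_id).tendsto τ).mono_left nhdsWithin_le_nhds
      simpa using (hcs.tendsto.comp h1).sub_const (v (s - τ)))
  simpa using this

/-- The derivative of `σ ↦ ∫₀ᵗ u(s - σ) ds` comes from the two ends of the interval, and does not
involve a derivative of `u`. -/
theorem tendsto_slope_integral_comp_sub [CompleteSpace E] {u : ℝ → E} (hu : Continuous u)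
    (τ t : ℝ) :
    Filter.Tendsto (fun σ => (σ - τ)⁻¹ • ∫ s in 0..t, (u (s - σ) - u (s - τ)))
      (nhdsWithin τ {τ}ᶜ) (nhds (-(u (t - τ) - u (-τ)))) := by
  have hd : ∀ r, HasDerivAt (fun r => ∫ s in 0..r, u s) (u r) r := fun r =>
    intervalIntegral.integral_hasDerivAt_right (hu.intervalIntegrable _ _)
      hu.stronglyMeasurable.stronglyMeasurableAtFilter hu.continuousAt
  have h1 : HasDerivAt (fun σ => ∫ s in 0..t - σ, u s) (-u (t - τ)) τ := by
    simpa [Function.comp_def] using (hd (t - τ)).scomp τ ((hasDerivAt_id τ).const_sub t)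
  have h2 : HasDerivAt (fun σ => ∫ s in 0..-σ, u s) (-u (-τ)) τ := by
    simpa [Function.comp_def] using (hd (-τ)).scomp τ (hasDerivAt_id τ).neg
  have h3 := (h1.sub h2).tendsto_slope
  have e : -(u (t - τ) - u (-τ)) = -u (t - τ) - -u (-τ) := by abel
  rw [e]
  refine h3.congr fun σ => ?_
  have hi : ∀ ρ, (∫ s in 0..t, u (s - ρ)) = (∫ s in 0..t - ρ, u s) - ∫ s in 0..-ρ, u s := by
    intro ρ
    rw [intervalIntegral.integral_comp_sub_right u ρ, zero_sub, eq_sub_iff_add_eq,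
      add_comm, intervalIntegral.integral_add_adjacent_intervals] <;>
    exact hu.intervalIntegrable _ _
  rw [slope_def_module, intervalIntegral.integral_sub, hi, hi]
  · simp
  · exact Continuous.intervalIntegrable (by fun_prop) _ _
  · exact Continuous.intervalIntegrable (by fun_prop) _ _

/-- Convergence of scaled differences `c σ • (u σ - u τ)` of solutions with delays `σ → τ`. With
`c σ = (σ - τ)⁻¹` this is differentiability with respect to the delay, with `c σ = 1` and `v = 0`
it is continuity. The function `W` is the contribution of the change of the delay in the
delayed term. -/
theorem IsDelayVolterra.tendsto_smul_sub (hb : 0 ≤ b) {τ : ℝ} (hτ : τ ∈ Icc 0 b)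
    {l : Filter ℝ} [l.IsCountablyGenerated] (hl : l ≤ nhdsWithin τ (Icc 0 b)) {C K : ℝ}
    (hC : 0 ≤ C) {F N u : ℝ → ℝ → E} {G q v W : ℝ → E} {c : ℝ → ℝ} {ρ : ℝ → ℝ → ℝ}
    (hu : ∀ σ ∈ Icc 0 b, IsDelayVolterra b T A σ (F σ) (N σ) (u σ))
    (hhist : ∀ σ ∈ Icc 0 b, ∀ t ∈ Icc (-b) 0, u σ t = u τ t)
    (hv : IsDelayVolterra b T A τ G q v) (hv0 : ∀ t ∈ Icc (-b) 0, v t = 0)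
    {D : Set ℝ} (hD : D.Countable) (hvc : ∀ r ∈ Ioo (-b) T, r ∉ D → ContinuousAt v r)
    (hFK : ∀ᶠ σ in l, ∀ t ∈ Icc 0 T, ‖c σ • (F σ t - F τ t)‖ ≤ K)
    (hWK : ∀ᶠ σ in l, ∀ t ∈ Icc 0 T, ‖c σ • ∫ s in 0..t, (u τ (s - σ) - u τ (s - τ))‖ ≤ K)
    (hGK : ∀ t ∈ Icc 0 T, ‖G t‖ ≤ K)
    (hW : ∀ t ∈ Icc 0 T, Filter.Tendsto
      (fun σ => c σ • ∫ s in 0..t, (u τ (s - σ) - u τ (s - τ))) l (nhds (W t)))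
    (hF : ∀ᵐ t, t ∈ Ioc 0 T →
      Filter.Tendsto (fun σ => c σ • (F σ t - F τ t)) l (nhds (G t - A (W t))))
    (hρm : ∀ᶠ σ in l, AEStronglyMeasurable (ρ σ) (volume.restrict (Ioc 0 T)))
    (hρK : ∀ᶠ σ in l, ∀ t ∈ Icc 0 T, 0 ≤ ρ σ t ∧ ρ σ t ≤ K)
    (hN : ∀ᶠ σ in l, ∀ t ∈ Icc 0 T,
      ‖c σ • (N σ t - N τ t) - q t‖ ≤ C * ‖c σ • (u σ t - u τ t) - v t‖ + ρ σ t)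
    (hρ : ∀ᵐ t, t ∈ Ioc 0 T → Filter.Tendsto (fun σ => ρ σ t) l (nhds 0)) :
    ∀ t ∈ Icc 0 T, Filter.Tendsto (fun σ => c σ • (F σ t - F τ t)) l (nhds (G t - A (W t))) →
      Filter.Tendsto (fun σ => c σ • (u σ t - u τ t)) l (nhds (v t)) := by
  intro t ht hFt
  have hT : 0 ≤ T := ht.1.trans ht.2
  obtain ⟨K₁, hK₁⟩ := hv.bounded
  have hI : ∀ᶠ σ in l, σ ∈ Icc 0 b := hl self_mem_nhdsWithin
  have hshift : ∀ r ∈ Icc 0 T,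
      Filter.Tendsto (fun σ => ∫ s in 0..r, (v (s - σ) - v (s - τ))) l (nhds 0) := fun r hr =>
    (tendsto_integral_comp_sub hv.stronglyMeasurable hK₁ hD hvc hτ hr).mono_left hl
  have hlim : ∀ r ∈ Icc 0 T,
      Filter.Tendsto (fun σ => c σ • (F σ r - F τ r)) l (nhds (G r - A (W r))) →
      Filter.Tendsto (fun σ => c σ • (F σ r - F τ r)
        + A (c σ • ∫ s in 0..r, (u τ (s - σ) - u τ (s - τ))) - G r
        + A (∫ s in 0..r, (v (s - σ) - v (s - τ)))) l (nhds 0) := by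
    intro r hr h
    have h1 := (A.continuous.tendsto _).comp (hW r hr)
    have h2 := (A.continuous.tendsto _).comp (hshift r hr)
    have := ((h.add h1).sub_const (G r)).add h2
    simpa using this
  have key := IsDelayVolterra.tendsto_zero (l := l) (σ := id) (ρ := ρ)
    (K := max K (K + ‖A‖ * K + K + ‖A‖ * ((K₁ + K₁) * T))) hb hC hI
    (hI.mono fun σ hσ => (hu σ hσ).smul_sub_sub hσ hτ (hu τ hτ) hv (c σ))
    (hI.mono fun σ hσ s hs => by simp [hhist σ hσ s hs, hv0 s hs])
    (by
      filter_upwards [hI, hFK, hWK] with σ hσ h1 h2 s hs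
      refine le_trans ?_ (le_max_right _ _)
      refine (norm_add_le _ _).trans (add_le_add ((norm_sub_le _ _).trans (add_le_add
        ((norm_add_le _ _).trans (add_le_add (h1 s hs) ?_)) (hGK s hs))) ?_)
      · refine (A.le_opNorm _).trans ?_
        gcongr
        exact h2 s hs
      · refine (A.le_opNorm _).trans ?_
        gcongr
        have h3 : ‖∫ r in 0..s, (v (r - σ) - v (r - τ))‖ ≤ (K₁ + K₁) * |s - 0| :=
          intervalIntegral.norm_integral_le_of_norm_le_const fun r hr => by
            rw [uIoc_of_le hs.1] at hr
            have hr' : r ∈ Icc 0 T := ⟨hr.1.le, hr.2.trans hs.2⟩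
            exact (norm_sub_le _ _).trans (add_le_add (hK₁ _ (sub_mem_Icc_of_mem hσ hr'))
              (hK₁ _ (sub_mem_Icc_of_mem hτ hr')))
        rw [sub_zero, abs_of_nonneg hs.1] at h3
        have hK₁0 : 0 ≤ K₁ :=
          (norm_nonneg _).trans (hK₁ 0 ⟨by linarith, hT⟩)
        refine h3.trans ?_
        gcongr
        exact hs.2)
    hρm (hρK.mono fun σ h s hs => ⟨(h s hs).1, (h s hs).2.trans (le_max_left _ _)⟩) hN
    (by
      filter_upwards [hF] with r hr hr' using hlim r ⟨hr'.1.le, hr'.2⟩ (hr hr'))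
    hρ t ht (hlim t ht hFt)
  have := key.add_const (v t)
  simpa using this

end

/-! ### Lipschitz dependence on time and on a parameter -/

/-- Lipschitz estimates on `[-b, 0]` and on `[0, T]` can be glued at `0`. -/
theorem norm_sub_le_mul_abs_of_glue {E : Type*} [NormedAddCommGroup E] {u : ℝ → E} {K b T : ℝ}
    (h₁ : ∀ r ∈ Icc (-b) 0, ∀ s ∈ Icc (-b) 0, ‖u r - u s‖ ≤ K * |r - s|)
    (h₂ : ∀ r ∈ Icc 0 T, ∀ s ∈ Icc 0 T, ‖u r - u s‖ ≤ K * |r - s|) :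
    ∀ r ∈ Icc (-b) T, ∀ s ∈ Icc (-b) T, ‖u r - u s‖ ≤ K * |r - s| := by
  have key : ∀ r ∈ Icc (-b) T, ∀ s ∈ Icc (-b) T, r ≤ 0 → 0 ≤ s →
      ‖u r - u s‖ ≤ K * |r - s| := by
    intro r hr s hs hr0 hs0
    have e1 := h₁ r ⟨hr.1, hr0⟩ 0 ⟨hr.1.trans hr0, le_rfl⟩
    have e2 := h₂ 0 ⟨le_rfl, hs0.trans hs.2⟩ s ⟨hs0, hs.2⟩
    rw [sub_zero, abs_of_nonpos hr0] at e1
    rw [zero_sub, abs_neg, abs_of_nonneg hs0] at e2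
    rw [abs_of_nonpos (by linarith)]
    have := norm_sub_le_norm_sub_add_norm_sub (u r) (u 0) (u s)
    linarith
  intro r hr s hs
  rcases le_total r 0 with hr0 | hr0 <;> rcases le_total s 0 with hs0 | hs0
  · exact h₁ r ⟨hr.1, hr0⟩ s ⟨hs.1, hs0⟩
  · exact key r hr s hs hr0 hs0
  · rw [norm_sub_rev, abs_sub_comm]
    exact key s hs r hr hs0 hr0
  · exact h₂ r ⟨hr0, hr.2⟩ s ⟨hs0, hs.2⟩

theorem hasDerivAt_integral_add {E : Type*} [NormedAddCommGroup E] [NormedSpace ℝ E]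
    [CompleteSpace E] {N u : ℝ → E} (hN : Continuous N) (hu : Continuous u) (A : E →L[ℝ] E)
    (σ t : ℝ) :
    HasDerivAt (fun t => (∫ s in 0..t, N s) + A (∫ s in 0..t, u (s - σ)))
      (N t + A (u (t - σ))) t := by
  have hd : ∀ w : ℝ → E, Continuous w → HasDerivAt (fun r => ∫ s in 0..r, w s) (w t) t :=
    fun w hw => intervalIntegral.integral_hasDerivAt_right (hw.intervalIntegrable _ _)
      hw.stronglyMeasurable.stronglyMeasurableAtFilter hw.continuousAt
  exact (hd N hN).add (A.hasFDerivAt.comp_hasDerivAt t (hd (fun s => u (s - σ)) (by fun_prop)))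

/-- A Lipschitz function has bounded difference quotients, also in integrated form. -/
theorem norm_smul_integral_comp_sub_le {E : Type*} [NormedAddCommGroup E]
    [NormedSpace ℝ E] {b T : ℝ} {u : ℝ → E} {K σ τ : ℝ} (hK0 : 0 ≤ K)
    (hK : ∀ r ∈ Icc (-b) T, ∀ s ∈ Icc (-b) T, ‖u r - u s‖ ≤ K * |r - s|)
    (hσ : σ ∈ Icc 0 b) (hτ : τ ∈ Icc 0 b) {t : ℝ} (ht : t ∈ Icc 0 T) :
    ‖(σ - τ)⁻¹ • ∫ s in 0..t, (u (s - σ) - u (s - τ))‖ ≤ K * T := by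
  have h1 : ‖∫ s in 0..t, (u (s - σ) - u (s - τ))‖ ≤ K * |σ - τ| * |t - 0| :=
    intervalIntegral.norm_integral_le_of_norm_le_const fun s hs => by
      rw [uIoc_of_le ht.1] at hs
      have hs' : s ∈ Icc 0 T := ⟨hs.1.le, hs.2.trans ht.2⟩
      have := hK _ (sub_mem_Icc_of_mem hσ hs') _ (sub_mem_Icc_of_mem hτ hs')
      rwa [sub_sub_sub_cancel_left, abs_sub_comm] at this
  rw [sub_zero, abs_of_nonneg ht.1] at h1
  rw [norm_smul, norm_inv, Real.norm_eq_abs]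
  calc |σ - τ|⁻¹ * ‖∫ s in 0..t, (u (s - σ) - u (s - τ))‖
      ≤ |σ - τ|⁻¹ * (K * |σ - τ| * t) := by gcongr
    _ = (|σ - τ|⁻¹ * |σ - τ|) * (K * t) := by ring
    _ ≤ 1 * (K * T) := by
        gcongr
        · exact mul_nonneg hK0 ht.1
        · exact inv_mul_le_one
        · exact ht.2
    _ = _ := one_mul _

theorem norm_inv_smul_le {E : Type*} [NormedAddCommGroup E] [NormedSpace ℝ E] {a : E}
    {K σ τ : ℝ} (hK0 : 0 ≤ K)
    (h : ‖a‖ ≤ K * |σ - τ|) : ‖(σ - τ)⁻¹ • a‖ ≤ K := by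
  rw [norm_smul, norm_inv, Real.norm_eq_abs]
  calc |σ - τ|⁻¹ * ‖a‖ ≤ |σ - τ|⁻¹ * (K * |σ - τ|) := by gcongr
    _ = (|σ - τ|⁻¹ * |σ - τ|) * K := by ring
    _ ≤ 1 * K := by
        gcongr
        exact inv_mul_le_one
    _ = _ := one_mul _

theorem tendsto_of_norm_sub_le {E : Type*} [NormedAddCommGroup E] {u : ℝ → E} {I : Set ℝ}
    {K τ : ℝ} (h : ∀ σ ∈ I, ‖u σ - u τ‖ ≤ K * |σ - τ|) :
    Filter.Tendsto u (nhdsWithin τ I) (nhds (u τ)) := by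
  rw [tendsto_iff_norm_sub_tendsto_zero]
  refine squeeze_zero' (g := fun σ => K * |σ - τ|) (Filter.Eventually.of_forall fun _ =>
    norm_nonneg _) (by filter_upwards [self_mem_nhdsWithin] with σ hσ using h σ hσ) ?_
  have : Continuous fun σ => K * |σ - τ| := by fun_prop
  have h1 := this.tendsto τ
  rw [sub_self, abs_zero, mul_zero] at h1
  exact h1.mono_left nhdsWithin_le_nhds

theorem tendsto_apply_of_norm_sub_le {E : Type*} [NormedAddCommGroup E] {u : ℝ → ℝ → E}
    {I J : Set ℝ} {K τ r₀ : ℝ} {r : ℝ → ℝ} (hc : ContinuousAt (u τ) r₀)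
    (h : ∀ σ ∈ I, ∀ t ∈ J, ‖u σ t - u τ t‖ ≤ K * |σ - τ|)
    (hr : Filter.Tendsto r (nhdsWithin τ I) (nhds r₀))
    (hJ : ∀ᶠ σ in nhdsWithin τ I, r σ ∈ J) :
    Filter.Tendsto (fun σ => u σ (r σ)) (nhdsWithin τ I) (nhds (u τ r₀)) := by
  have h1 : Filter.Tendsto (fun σ => u σ (r σ) - u τ (r σ)) (nhdsWithin τ I) (nhds 0) := by
    refine squeeze_zero_norm' (a := fun σ => K * |σ - τ|) ?_ ?_
    · filter_upwards [self_mem_nhdsWithin, hJ] with σ h1 h2 using h σ h1 _ h2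
    · have : Continuous fun σ => K * |σ - τ| := by fun_prop
      have h1 := this.tendsto τ
      rw [sub_self, abs_zero, mul_zero] at h1
      exact h1.mono_left nhdsWithin_le_nhds
  simpa using h1.add (hc.tendsto.comp hr)

theorem Filter.Tendsto.continuousLinearMap_apply {ι E F : Type*} [NormedAddCommGroup E]
    [NormedSpace ℝ E] [NormedAddCommGroup F] [NormedSpace ℝ F] {l : Filter ι}
    {L : ι → E →L[ℝ] F} {L₀ : E →L[ℝ] F} {u : ι → E} {u₀ : E} (hL : Filter.Tendsto L l (nhds L₀))
    (hu : Filter.Tendsto u l (nhds u₀)) :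
    Filter.Tendsto (fun i => L i (u i)) l (nhds (L₀ u₀)) :=
  (isBoundedBilinearMap_apply.continuous.tendsto (L₀, u₀)).comp (hL.prodMk_nhds hu)

/-! ### Dependence on the delay for a bounded nonlinearity -/

/-- A delay equation `ẋ(t) + f(x(t)) = A x(t - σ) + g(t)` on `[0, T]` with delays in `[0, b]`,
history `P` with derivative `p`, and a nonlinearity `f`. The number `M` is a common bound of `f`,
its first two derivatives, `p` and `g`. All functions of time are defined on the whole line. -/
structure BoundedDelaySystem (E : Type*) [NormedAddCommGroup E] [NormedSpace ℝ E] where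
  b : ℝ
  T : ℝ
  A : E →L[ℝ] E
  f : E → E
  P : ℝ → E
  p : ℝ → E
  g : ℝ → E
  M : ℝ
  b_nonneg : 0 ≤ b
  T_nonneg : 0 ≤ T
  contDiff : ContDiff ℝ 2 f
  f_le : ∀ u, ‖f u‖ ≤ M
  fderiv_le : ∀ u, ‖fderiv ℝ f u‖ ≤ M
  fderiv_fderiv_le : ∀ u, ‖fderiv ℝ (fderiv ℝ f) u‖ ≤ M
  hasDerivAt : ∀ t, HasDerivAt P (p t) t
  continuous_p : Continuous p
  p_le : ∀ t, ‖p t‖ ≤ M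
  continuous_g : Continuous g
  g_le : ∀ t, ‖g t‖ ≤ M

namespace BoundedDelaySystem

variable {E : Type*} [NormedAddCommGroup E] [NormedSpace ℝ E] (S : BoundedDelaySystem E)

theorem M_nonneg : 0 ≤ S.M := (norm_nonneg _).trans (S.p_le 0)

theorem continuous_P : Continuous S.P :=
  continuous_iff_continuousAt.2 fun t => (S.hasDerivAt t).continuousAt

theorem differentiable_f : Differentiable ℝ S.f := S.contDiff.differentiable (by norm_num)

theorem contDiff_fderiv : ContDiff ℝ 1 (fderiv ℝ S.f) :=
  S.contDiff.fderiv_right (by norm_num)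

theorem differentiable_fderiv : Differentiable ℝ (fderiv ℝ S.f) :=
  S.contDiff_fderiv.differentiable (by norm_num)

theorem continuous_f : Continuous S.f := S.contDiff.continuous

theorem continuous_fderiv : Continuous (fderiv ℝ S.f) := S.contDiff_fderiv.continuous

theorem continuous_fderiv_fderiv : Continuous (fderiv ℝ (fderiv ℝ S.f)) :=
  S.contDiff_fderiv.continuous_fderiv (by norm_num)

theorem norm_f_sub_le (u v : E) : ‖S.f u - S.f v‖ ≤ S.M * ‖u - v‖ :=
  convex_univ.norm_image_sub_le_of_norm_fderiv_le (fun x _ => S.differentiable_f x)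
    (fun x _ => S.fderiv_le x) (mem_univ v) (mem_univ u)

theorem norm_fderiv_sub_le (u v : E) :
    ‖fderiv ℝ S.f u - fderiv ℝ S.f v‖ ≤ S.M * ‖u - v‖ :=
  convex_univ.norm_image_sub_le_of_norm_fderiv_le (fun x _ => S.differentiable_fderiv x)
    (fun x _ => S.fderiv_fderiv_le x) (mem_univ v) (mem_univ u)

theorem exists_P_le : ∃ K, ∀ t ∈ Icc (-S.b) 0, ‖S.P t‖ ≤ K :=
  isCompact_Icc.exists_bound_of_continuousOn S.continuous_P.continuousOn

theorem neg_mem_Icc {σ : ℝ} (hσ : σ ∈ Icc 0 S.b) : -σ ∈ Icc (-S.b) S.T :=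
  ⟨by linarith [hσ.2], by linarith [hσ.1, S.T_nonneg]⟩

theorem norm_fderiv_apply_le (u v : E) : ‖fderiv ℝ S.f u v‖ ≤ S.M * ‖v‖ :=
  (ContinuousLinearMap.le_opNorm _ _).trans (by gcongr; exact S.fderiv_le u)

theorem norm_fderiv_fderiv_apply_le (u v w : E) :
    ‖fderiv ℝ (fderiv ℝ S.f) u v w‖ ≤ S.M * ‖v‖ * ‖w‖ :=
  (ContinuousLinearMap.le_opNorm₂ _ _ _).trans (by gcongr; exact S.fderiv_fderiv_le u)

/-! ### The solution -/

variable [CompleteSpace E]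

theorem exists_x (σ : ℝ) : ∃ x : ℝ → E, Continuous x ∧ (∀ t ≤ 0, x t = S.P t) ∧
    (σ ∈ Icc 0 S.b → IsDelayVolterra S.b S.T S.A σ (fun _ => S.P 0)
      (fun s => -S.f (x s) + S.g s) x) := by
  have hP : Continuous fun t => S.P (min t 0) := by
    have := S.continuous_P
    fun_prop
  by_cases hσ : σ ∈ Icc 0 S.b
  · obtain ⟨K, hK⟩ := isCompact_Icc.exists_bound_of_continuousOn (s := Icc (-S.b) S.T)
      hP.continuousOn
    obtain ⟨w, hwc, hw0, hw⟩ := exists_isDelayVolterra (A := S.A) S.T_nonneg S.M_nonneg hσ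
      hP.stronglyMeasurable hK (N := fun s u => -S.f u + S.g s)
      (fun w hw => by
        have h1 := S.continuous_f
        have h2 := S.continuous_g
        exact Continuous.intervalIntegrable (by fun_prop) _ _)
      (fun s _ u v => by
        rw [add_sub_add_right_eq_sub, neg_sub_neg, norm_sub_rev]
        exact S.norm_f_sub_le u v)
    refine ⟨fun t => S.P (min t 0) + w t, hP.add hwc, fun t ht => by
      simp only [hw0 t ht, min_eq_left ht, add_zero], fun _ => ?_⟩
    refine ⟨hw.1, hw.2, hw.3, fun t ht => ?_⟩
    have := hw.4 t ht
    simp only [min_eq_right ht.1] at this ⊢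
    exact this
  · exact ⟨_, S.continuous_P, fun _ _ => rfl, fun h => absurd h hσ⟩

/-- The solution with delay `σ`. -/
noncomputable def x (σ : ℝ) : ℝ → E := (S.exists_x σ).choose

theorem continuous_x (σ : ℝ) : Continuous (S.x σ) := (S.exists_x σ).choose_spec.1

theorem x_of_nonpos (σ : ℝ) {t : ℝ} (ht : t ≤ 0) : S.x σ t = S.P t :=
  (S.exists_x σ).choose_spec.2.1 t ht

theorem isDelayVolterra_x {σ : ℝ} (hσ : σ ∈ Icc 0 S.b) :
    IsDelayVolterra S.b S.T S.A σ (fun _ => S.P 0) (fun s => -S.f (S.x σ s) + S.g s) (S.x σ) :=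
  (S.exists_x σ).choose_spec.2.2 hσ

/-- The time derivative of the solution. At `t = 0`, where the solution has a kink, the value is
the left derivative. -/
noncomputable def xdot (σ t : ℝ) : E :=
  if t ≤ 0 then S.p t else -S.f (S.x σ t) + S.g t + S.A (S.x σ (t - σ))

theorem continuous_rhs (σ : ℝ) : Continuous fun s => -S.f (S.x σ s) + S.g s := by
  have h1 := S.continuous_f
  have h2 := S.continuous_g
  have h3 := S.continuous_x σ
  fun_prop

theorem continuous_xdot_pos (σ : ℝ) :
    Continuous fun t => -S.f (S.x σ t) + S.g t + S.A (S.x σ (t - σ)) := by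
  have h1 := S.continuous_rhs σ
  have h3 := S.continuous_x σ
  fun_prop

theorem stronglyMeasurable_xdot (σ : ℝ) : StronglyMeasurable (S.xdot σ) :=
  StronglyMeasurable.ite measurableSet_Iic S.continuous_p.stronglyMeasurable
    (S.continuous_xdot_pos σ).stronglyMeasurable

theorem continuousAt_xdot (σ : ℝ) {t : ℝ} (ht : t ≠ 0) : ContinuousAt (S.xdot σ) t := by
  rcases lt_or_gt_of_ne ht with h | h
  · refine S.continuous_p.continuousAt.congr ?_
    filter_upwards [Iio_mem_nhds h] with s hs
    exact (if_pos (le_of_lt hs)).symm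
  · refine (S.continuous_xdot_pos σ).continuousAt.congr ?_
    filter_upwards [Ioi_mem_nhds h] with s hs
    exact (if_neg (not_le.2 hs)).symm

theorem exists_x_le : ∃ K, 0 ≤ K ∧ ∀ σ ∈ Icc 0 S.b, ∀ t ∈ Icc (-S.b) S.T, ‖S.x σ t‖ ≤ K := by
  obtain ⟨K, hK0, hK⟩ := IsDelayVolterra.exists_bound S.b S.T S.b_nonneg S.T_nonneg S.A le_rfl
  obtain ⟨K₁, hK₁⟩ := S.exists_P_le
  have hK₁0 : 0 ≤ K₁ := (norm_nonneg _).trans (hK₁ 0 ⟨by linarith [S.b_nonneg], le_rfl⟩)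
  have hM := S.M_nonneg
  refine ⟨K * (K₁ + 2 * S.M), by positivity, fun σ hσ t ht => ?_⟩
  refine hK σ _ _ _ _ hσ (by positivity) (S.isDelayVolterra_x hσ) ?_ ?_ ?_ t ht
  · intro s hs
    rw [S.x_of_nonpos σ hs.2]
    linarith [hK₁ s hs]
  · intro s _
    linarith [hK₁ 0 ⟨by linarith [S.b_nonneg], le_rfl⟩]
  · intro s _
    have h1 := norm_add_le (-S.f (S.x σ s)) (S.g s)
    rw [norm_neg] at h1
    linarith [S.f_le (S.x σ s), S.g_le s]

theorem exists_xdot_le : ∃ K, 0 ≤ K ∧ ∀ σ ∈ Icc 0 S.b, ∀ t ∈ Icc (-S.b) S.T,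
    ‖S.xdot σ t‖ ≤ K ∧ (0 ≤ t → ‖-S.f (S.x σ t) + S.g t + S.A (S.x σ (t - σ))‖ ≤ K) := by
  obtain ⟨K, hK0, hK⟩ := S.exists_x_le
  have hM := S.M_nonneg
  refine ⟨2 * S.M + ‖S.A‖ * K, by positivity, fun σ hσ t ht => ?_⟩
  have h0 : 0 ≤ t → ‖-S.f (S.x σ t) + S.g t + S.A (S.x σ (t - σ))‖ ≤
      2 * S.M + ‖S.A‖ * K := by
    intro h0
    have h1 : ‖S.A (S.x σ (t - σ))‖ ≤ ‖S.A‖ * K :=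
      (S.A.le_opNorm _).trans (by
        gcongr
        exact hK σ hσ _ (sub_mem_Icc_of_mem hσ ⟨h0, ht.2⟩))
    have h2 := norm_add₃_le (a := -S.f (S.x σ t)) (b := S.g t) (c := S.A (S.x σ (t - σ)))
    rw [norm_neg] at h2
    linarith [S.f_le (S.x σ t), S.g_le t]
  refine ⟨?_, h0⟩
  unfold xdot
  split_ifs with h
  · have : 0 ≤ ‖S.A‖ * K := by positivity
    linarith [S.p_le t]
  · exact h0 (not_le.1 h).le

theorem x_eq {σ : ℝ} (hσ : σ ∈ Icc 0 S.b) {t : ℝ} (ht : t ∈ Icc 0 S.T) :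
    S.x σ t = S.P 0 + ((∫ s in 0..t, (-S.f (S.x σ s) + S.g s)) +
      S.A (∫ s in 0..t, S.x σ (s - σ))) := by
  rw [← add_assoc]
  exact (S.isDelayVolterra_x hσ).eq t ht

theorem hasDerivAt_x {σ : ℝ} (hσ : σ ∈ Icc 0 S.b) {t : ℝ} (ht : t < S.T) (ht0 : t ≠ 0) :
    HasDerivAt (S.x σ) (S.xdot σ t) t := by
  rcases lt_or_gt_of_ne ht0 with h | h
  · rw [xdot, if_pos h.le]
    refine (S.hasDerivAt t).congr_of_eventuallyEq ?_
    filter_upwards [Iio_mem_nhds h] with s hs using S.x_of_nonpos σ (le_of_lt hs)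
  · rw [xdot, if_neg (not_le.2 h)]
    refine ((hasDerivAt_integral_add (S.continuous_rhs σ) (S.continuous_x σ) S.A σ t).const_add
      (S.P 0)).congr_of_eventuallyEq ?_
    filter_upwards [Ioo_mem_nhds h ht] with s hs using S.x_eq hσ ⟨hs.1.le, hs.2.le⟩

/-- The solutions are Lipschitz in time, uniformly in the delay. -/
theorem exists_x_sub_le_time : ∃ K, 0 ≤ K ∧ ∀ σ ∈ Icc 0 S.b, ∀ r ∈ Icc (-S.b) S.T,
    ∀ s ∈ Icc (-S.b) S.T, ‖S.x σ r - S.x σ s‖ ≤ K * |r - s| := by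
  obtain ⟨K, hK0, hK⟩ := S.exists_xdot_le
  refine ⟨K + S.M, add_nonneg hK0 S.M_nonneg, fun σ hσ => norm_sub_le_mul_abs_of_glue
    (fun r hr s hs => ?_) (fun r hr s hs => ?_)⟩
  · rw [S.x_of_nonpos σ hr.2, S.x_of_nonpos σ hs.2]
    have := convex_univ.norm_image_sub_le_of_norm_hasDerivWithin_le
      (fun t _ => (S.hasDerivAt t).hasDerivWithinAt) (fun t _ => S.p_le t) (mem_univ s)
      (mem_univ r)
    refine this.trans ?_
    rw [Real.norm_eq_abs]
    gcongr
    linarith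
  · rw [S.x_eq hσ hr, S.x_eq hσ hs, add_sub_add_left_eq_sub]
    have := (convex_Icc 0 S.T).norm_image_sub_le_of_norm_hasDerivWithin_le
      (fun t _ => (hasDerivAt_integral_add (S.continuous_rhs σ) (S.continuous_x σ) S.A σ
        t).hasDerivWithinAt)
      (fun t ht => (hK σ hσ t ⟨by linarith [ht.1, S.b_nonneg], ht.2⟩).2 ht.1) hs hr
    refine this.trans ?_
    rw [Real.norm_eq_abs]
    gcongr
    linarith [S.M_nonneg]

/-- The solutions are Lipschitz in the delay. -/
theorem exists_x_sub_le_delay : ∃ K, 0 ≤ K ∧ ∀ σ ∈ Icc 0 S.b, ∀ τ ∈ Icc 0 S.b,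
    ∀ t ∈ Icc (-S.b) S.T, ‖S.x σ t - S.x τ t‖ ≤ K * |σ - τ| := by
  obtain ⟨K, hK0, hK⟩ := IsDelayVolterra.exists_bound_sub S.b S.T S.b_nonneg S.T_nonneg S.A
    S.M_nonneg
  obtain ⟨K₁, hK₁0, hK₁⟩ := S.exists_x_sub_le_time
  refine ⟨K * K₁, by positivity, fun σ hσ τ hτ t ht => ?_⟩
  have := hK σ τ _ _ _ _ _ _ (K₁ * |σ - τ|) hσ hτ (by positivity) (S.isDelayVolterra_x hσ)
    (S.isDelayVolterra_x hτ) (fun s hs => by rw [S.x_of_nonpos σ hs.2, S.x_of_nonpos τ hs.2])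
    (fun s _ => by
      rw [sub_self, norm_zero]
      positivity)
    (fun s _ => by
      rw [add_sub_add_right_eq_sub, neg_sub_neg, norm_sub_rev]
      have := S.norm_f_sub_le (S.x σ s) (S.x τ s)
      have h2 : 0 ≤ K₁ * |σ - τ| := by positivity
      linarith)
    (fun s hs => by
      have := hK₁ τ hτ _ (sub_mem_Icc_of_mem hσ hs) _ (sub_mem_Icc_of_mem hτ hs)
      rwa [sub_sub_sub_cancel_left, abs_sub_comm] at this) t ht
  rw [mul_assoc]
  exact this

/-! ### The first derivative with respect to the delay -/

theorem continuous_fderiv_x (σ : ℝ) : Continuous fun s => fderiv ℝ S.f (S.x σ s) :=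
  S.continuous_fderiv.comp (S.continuous_x σ)

theorem exists_y (σ : ℝ) : ∃ y : ℝ → E, Continuous y ∧ (∀ t ≤ 0, y t = 0) ∧
    (σ ∈ Icc 0 S.b → IsDelayVolterra S.b S.T S.A σ
      (fun t => -S.A (S.x σ (t - σ) - S.P (-σ)))
      (fun s => -fderiv ℝ S.f (S.x σ s) (y s)) y) := by
  have hB : Continuous fun t => -S.A (S.x σ (max t 0 - σ) - S.P (-σ)) := by
    have := S.continuous_x σ
    fun_prop
  by_cases hσ : σ ∈ Icc 0 S.b
  · obtain ⟨K, hK⟩ := isCompact_Icc.exists_bound_of_continuousOn (s := Icc (-S.b) S.T)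
      hB.continuousOn
    obtain ⟨w, hwc, hw0, hw⟩ := exists_isDelayVolterra (A := S.A) S.T_nonneg S.M_nonneg hσ
      hB.stronglyMeasurable hK (N := fun s u => -fderiv ℝ S.f (S.x σ s) u)
      (fun w hw => by
        have h1 := S.continuous_fderiv_x σ
        exact ((h1.clm_apply (hB.add hw)).neg).intervalIntegrable _ _)
      (fun s _ u v => by
        rw [neg_sub_neg, norm_sub_rev, ← map_sub]
        exact S.norm_fderiv_apply_le _ _)
    refine ⟨fun t => -S.A (S.x σ (max t 0 - σ) - S.P (-σ)) + w t, hB.add hwc, fun t ht => ?_,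
      fun _ => ⟨hw.1, hw.2, hw.3, fun t ht => ?_⟩⟩
    · simp only [hw0 t ht, max_eq_right ht, zero_sub, add_zero]
      rw [S.x_of_nonpos σ (by linarith [hσ.1]), sub_self, map_zero, neg_zero]
    · have := hw.4 t ht
      simp only [max_eq_left ht.1] at this ⊢
      exact this
  · exact ⟨_, continuous_const, fun _ _ => rfl, fun h => absurd h hσ⟩

/-- The derivative of the solution with respect to the delay. It solves the linearized equation
`ẏ + Df(x) y = A y(t - σ) - A ẋ(t - σ)` with zero history, here in integrated form, in which the
time derivative of `x` does not occur. -/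
noncomputable def y (σ : ℝ) : ℝ → E := (S.exists_y σ).choose

theorem continuous_y (σ : ℝ) : Continuous (S.y σ) := (S.exists_y σ).choose_spec.1

theorem y_of_nonpos (σ : ℝ) {t : ℝ} (ht : t ≤ 0) : S.y σ t = 0 :=
  (S.exists_y σ).choose_spec.2.1 t ht

theorem isDelayVolterra_y {σ : ℝ} (hσ : σ ∈ Icc 0 S.b) :
    IsDelayVolterra S.b S.T S.A σ (fun t => -S.A (S.x σ (t - σ) - S.P (-σ)))
      (fun s => -fderiv ℝ S.f (S.x σ s) (S.y σ s)) (S.y σ) :=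
  (S.exists_y σ).choose_spec.2.2 hσ

theorem P_neg {σ τ : ℝ} (hσ : σ ∈ Icc 0 S.b) : S.P (-σ) = S.x τ (-σ) :=
  (S.x_of_nonpos τ (by linarith [hσ.1])).symm

theorem exists_y_le : ∃ K, 0 ≤ K ∧ ∀ σ ∈ Icc 0 S.b, ∀ t ∈ Icc (-S.b) S.T, ‖S.y σ t‖ ≤ K := by
  obtain ⟨K, hK0, hK⟩ := IsDelayVolterra.exists_bound S.b S.T S.b_nonneg S.T_nonneg S.A
    S.M_nonneg
  obtain ⟨K₁, hK₁0, hK₁⟩ := S.exists_x_le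
  refine ⟨K * (‖S.A‖ * (K₁ + K₁)), by positivity, fun σ hσ t ht => ?_⟩
  refine hK σ _ _ _ _ hσ (by positivity) (S.isDelayVolterra_y hσ) ?_ ?_ ?_ t ht
  · intro s hs
    rw [S.y_of_nonpos σ hs.2, norm_zero]
    positivity
  · intro s hs
    rw [norm_neg, S.P_neg (τ := σ) hσ]
    refine (S.A.le_opNorm _).trans ?_
    gcongr
    exact (norm_sub_le _ _).trans (add_le_add (hK₁ σ hσ _ (sub_mem_Icc_of_mem hσ hs))
      (hK₁ σ hσ _ (S.neg_mem_Icc hσ)))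
  · intro s _
    rw [norm_neg]
    have := S.norm_fderiv_apply_le (S.x σ s) (S.y σ s)
    have h2 : 0 ≤ ‖S.A‖ * (K₁ + K₁) := by positivity
    linarith

theorem exists_y_sub_le_time : ∃ K, 0 ≤ K ∧ ∀ σ ∈ Icc 0 S.b, ∀ r ∈ Icc (-S.b) S.T,
    ∀ s ∈ Icc (-S.b) S.T, ‖S.y σ r - S.y σ s‖ ≤ K * |r - s| := by
  obtain ⟨K, hK0, hK⟩ := S.exists_y_le
  obtain ⟨K₁, hK₁0, hK₁⟩ := S.exists_x_sub_le_time
  have hM := S.M_nonneg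
  refine ⟨‖S.A‖ * K₁ + (S.M * K + ‖S.A‖ * K), by positivity, fun σ hσ =>
    norm_sub_le_mul_abs_of_glue (fun r hr s hs => ?_) (fun r hr s hs => ?_)⟩
  · rw [S.y_of_nonpos σ hr.2, S.y_of_nonpos σ hs.2, sub_self, norm_zero]
    positivity
  · have hN : Continuous fun s => -fderiv ℝ S.f (S.x σ s) (S.y σ s) :=
      ((S.continuous_fderiv_x σ).clm_apply (S.continuous_y σ)).neg
    have h1 := (convex_Icc 0 S.T).norm_image_sub_le_of_norm_hasDerivWithin_le
      (C := S.M * K + ‖S.A‖ * K)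
      (fun t _ => (hasDerivAt_integral_add hN (S.continuous_y σ) S.A σ
        t).hasDerivWithinAt)
      (fun t ht => by
        refine (norm_add_le _ _).trans (add_le_add ?_ ?_)
        · rw [norm_neg]
          refine (S.norm_fderiv_apply_le _ _).trans ?_
          gcongr
          exact hK σ hσ t ⟨by linarith [ht.1, S.b_nonneg], ht.2⟩
        · refine (S.A.le_opNorm _).trans ?_
          gcongr
          exact hK σ hσ _ (sub_mem_Icc_of_mem hσ ht)) hs hr
    rw [Real.norm_eq_abs] at h1
    rw [(S.isDelayVolterra_y hσ).eq r hr, (S.isDelayVolterra_y hσ).eq s hs, add_assoc, add_assoc,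
      add_sub_add_comm]
    have h2 : ‖-S.A (S.x σ (r - σ) - S.P (-σ)) - -S.A (S.x σ (s - σ) - S.P (-σ))‖ ≤
        ‖S.A‖ * (K₁ * |r - s|) := by
      rw [neg_sub_neg, norm_sub_rev, ← map_sub, sub_sub_sub_cancel_right]
      refine (S.A.le_opNorm _).trans ?_
      gcongr
      have := hK₁ σ hσ _ (sub_mem_Icc_of_mem hσ hr) _ (sub_mem_Icc_of_mem hσ hs)
      rwa [sub_sub_sub_cancel_right] at this
    refine (norm_add_le _ _).trans ?_
    linarith

/-- How the forcing term of `y` changes with the delay. -/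
theorem exists_y_forcing_sub_le : ∃ K, 0 ≤ K ∧ ∀ σ ∈ Icc 0 S.b, ∀ τ ∈ Icc 0 S.b,
    ∀ t ∈ Icc 0 S.T, ‖-S.A (S.x σ (t - σ) - S.P (-σ)) - -S.A (S.x τ (t - τ) - S.P (-τ))‖ ≤
      K * |σ - τ| := by
  obtain ⟨K₁, hK₁0, hK₁⟩ := S.exists_x_sub_le_time
  obtain ⟨K₂, hK₂0, hK₂⟩ := S.exists_x_sub_le_delay
  refine ⟨‖S.A‖ * (K₂ + K₁ + K₁), by positivity, fun σ hσ τ hτ t ht => ?_⟩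
  have e : -S.A (S.x σ (t - σ) - S.P (-σ)) - -S.A (S.x τ (t - τ) - S.P (-τ)) =
      -S.A ((S.x σ (t - σ) - S.x τ (t - σ)) + (S.x τ (t - σ) - S.x τ (t - τ)) +
        (S.x τ (-τ) - S.x τ (-σ))) := by
    rw [S.P_neg (τ := τ) hσ, S.P_neg (τ := τ) hτ]
    simp only [map_add, map_sub]
    abel
  rw [e, norm_neg, mul_assoc]
  refine (S.A.le_opNorm _).trans ?_
  gcongr
  have h1 := hK₂ σ hσ τ hτ _ (sub_mem_Icc_of_mem hσ ht)
  have h2 := hK₁ τ hτ _ (sub_mem_Icc_of_mem hσ ht) _ (sub_mem_Icc_of_mem hτ ht)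
  have h3 := hK₁ τ hτ _ (S.neg_mem_Icc hτ) _ (S.neg_mem_Icc hσ)
  rw [sub_sub_sub_cancel_left, abs_sub_comm] at h2
  rw [neg_sub_neg] at h3
  refine norm_add₃_le.trans ?_
  linarith

theorem exists_y_sub_le_delay : ∃ K, 0 ≤ K ∧ ∀ σ ∈ Icc 0 S.b, ∀ τ ∈ Icc 0 S.b,
    ∀ t ∈ Icc (-S.b) S.T, ‖S.y σ t - S.y τ t‖ ≤ K * |σ - τ| := by
  obtain ⟨K, hK0, hK⟩ := IsDelayVolterra.exists_bound_sub S.b S.T S.b_nonneg S.T_nonneg S.A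
    S.M_nonneg
  obtain ⟨K₁, hK₁0, hK₁⟩ := S.exists_y_sub_le_time
  obtain ⟨K₂, hK₂0, hK₂⟩ := S.exists_y_forcing_sub_le
  obtain ⟨K₃, hK₃0, hK₃⟩ := S.exists_x_sub_le_delay
  obtain ⟨K₄, hK₄0, hK₄⟩ := S.exists_y_le
  have hM := S.M_nonneg
  refine ⟨K * (K₁ + K₂ + S.M * K₃ * K₄), by positivity, fun σ hσ τ hτ t ht => ?_⟩
  have h1 : 0 ≤ K₁ * |σ - τ| := by positivity
  have h2 : 0 ≤ K₂ * |σ - τ| := by positivity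
  have h3 : 0 ≤ S.M * K₃ * K₄ * |σ - τ| := by positivity
  have := hK σ τ _ _ _ _ _ _ ((K₁ + K₂ + S.M * K₃ * K₄) * |σ - τ|) hσ hτ (by positivity)
    (S.isDelayVolterra_y hσ) (S.isDelayVolterra_y hτ)
    (fun s hs => by rw [S.y_of_nonpos σ hs.2, S.y_of_nonpos τ hs.2])
    (fun s hs => by
      have := hK₂ σ hσ τ hτ s hs
      linarith)
    (fun s hs => by
      have hs' : s ∈ Icc (-S.b) S.T := ⟨by linarith [hs.1, S.b_nonneg], hs.2⟩
      have e : -fderiv ℝ S.f (S.x σ s) (S.y σ s) - -fderiv ℝ S.f (S.x τ s) (S.y τ s) =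
          -(fderiv ℝ S.f (S.x σ s) (S.y σ s - S.y τ s) +
            (fderiv ℝ S.f (S.x σ s) - fderiv ℝ S.f (S.x τ s)) (S.y τ s)) := by
        simp only [map_sub, sub_apply]
        abel
      rw [e, norm_neg]
      have e1 := S.norm_fderiv_apply_le (S.x σ s) (S.y σ s - S.y τ s)
      have e2 : ‖(fderiv ℝ S.f (S.x σ s) - fderiv ℝ S.f (S.x τ s)) (S.y τ s)‖ ≤
          S.M * (K₃ * |σ - τ|) * K₄ := by
        refine (ContinuousLinearMap.le_opNorm _ _).trans ?_
        gcongr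
        · refine (S.norm_fderiv_sub_le _ _).trans ?_
          gcongr
          exact hK₃ σ hσ τ hτ s hs'
        · exact hK₄ τ hτ s hs'
      refine (norm_add_le _ _).trans ?_
      linarith)
    (fun s hs => by
      have := hK₁ τ hτ _ (sub_mem_Icc_of_mem hσ hs) _ (sub_mem_Icc_of_mem hτ hs)
      rw [sub_sub_sub_cancel_left, abs_sub_comm] at this
      linarith) t ht
  rw [mul_assoc]
  exact this

theorem hasDerivWithinAt_x {τ : ℝ} (hτ : τ ∈ Icc 0 S.b) {t : ℝ} (ht : t ∈ Icc (-S.b) S.T) :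
    HasDerivWithinAt (fun σ => S.x σ t) (S.y τ t) (Icc 0 S.b) τ := by
  rcases le_total t 0 with ht0 | ht0
  · rw [S.y_of_nonpos τ ht0]
    simp only [S.x_of_nonpos _ ht0]
    exact hasDerivWithinAt_const _ _ _
  have ht' : t ∈ Icc 0 S.T := ⟨ht0, ht.2⟩
  obtain ⟨K₁, hK₁0, hK₁⟩ := S.exists_x_sub_le_time
  obtain ⟨K₂, hK₂0, hK₂⟩ := S.exists_x_sub_le_delay
  obtain ⟨K₃, hK₃0, hK₃⟩ := S.exists_x_le
  have hM := S.M_nonneg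
  have hT := S.T_nonneg
  have hne : nhdsWithin τ (Icc 0 S.b \ {τ}) ≤ nhdsWithin τ {τ}ᶜ :=
    nhdsWithin_mono _ fun s hs => hs.2
  have hI : ∀ᶠ σ in nhdsWithin τ (Icc 0 S.b \ {τ}), σ ∈ Icc 0 S.b :=
    nhdsWithin_mono τ sdiff_subset self_mem_nhdsWithin
  rw [hasDerivWithinAt_iff_tendsto_slope]
  simp only [slope_fun_def, vsub_eq_sub]
  have hzero : ∀ r, Filter.Tendsto (fun σ : ℝ => (σ - τ)⁻¹ • (S.P 0 - S.P 0))
      (nhdsWithin τ (Icc 0 S.b \ {τ})) (nhds (-S.A (S.x τ (r - τ) - S.P (-τ)) -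
        S.A (-(S.x τ (r - τ) - S.x τ (-τ))))) := by
    intro r
    rw [S.P_neg (τ := τ) hτ, map_neg, sub_self, sub_self]
    simp only [smul_zero]
    exact tendsto_const_nhds
  refine IsDelayVolterra.tendsto_smul_sub (A := S.A) S.b_nonneg hτ (nhdsWithin_mono τ sdiff_subset)
    S.M_nonneg (K := K₁ * S.T + ‖S.A‖ * (K₃ + K₃) + 2 * (S.M * K₂))
    (c := fun σ => (σ - τ)⁻¹)
    (W := fun t => -(S.x τ (t - τ) - S.x τ (-τ)))
    (ρ := fun σ s => ‖(σ - τ)⁻¹ • (S.f (S.x σ s) - S.f (S.x τ s)) -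
      fderiv ℝ S.f (S.x τ s) ((σ - τ)⁻¹ • (S.x σ s - S.x τ s))‖)
    (fun σ hσ => S.isDelayVolterra_x hσ)
    (fun σ hσ s hs => by rw [S.x_of_nonpos σ hs.2, S.x_of_nonpos τ hs.2])
    (S.isDelayVolterra_y hτ) (fun s hs => S.y_of_nonpos τ hs.2)
    countable_empty (fun r _ _ => (S.continuous_y τ).continuousAt)
    ?_ ?_ ?_ ?_ ?_ ?_ ?_ ?_ ?_ t ht' (hzero t)
  · refine Filter.Eventually.of_forall fun σ s _ => ?_
    rw [sub_self, smul_zero, norm_zero]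
    positivity
  · filter_upwards [hI] with σ hσ s hs
    have h1 := norm_smul_integral_comp_sub_le hK₁0 (hK₁ τ hτ) hσ hτ hs
    have h2 : 0 ≤ ‖S.A‖ * (K₃ + K₃) + 2 * (S.M * K₂) := by positivity
    linarith
  · intro s hs
    rw [norm_neg, S.P_neg (τ := τ) hτ]
    have h1 : ‖S.A (S.x τ (s - τ) - S.x τ (-τ))‖ ≤ ‖S.A‖ * (K₃ + K₃) := by
      refine (S.A.le_opNorm _).trans ?_
      gcongr
      exact (norm_sub_le _ _).trans (add_le_add (hK₃ τ hτ _ (sub_mem_Icc_of_mem hτ hs))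
        (hK₃ τ hτ _ (S.neg_mem_Icc hτ)))
    have h2 : 0 ≤ K₁ * S.T + 2 * (S.M * K₂) := by positivity
    linarith
  · intro s _
    exact (tendsto_slope_integral_comp_sub (S.continuous_x τ) τ s).mono_left hne
  · exact Filter.Eventually.of_forall fun s _ => hzero s
  · refine Filter.Eventually.of_forall fun σ => Continuous.aestronglyMeasurable ?_
    have h1 := S.continuous_x σ
    have h2 := S.continuous_x τ
    have h3 := S.continuous_f
    have h4 := (S.continuous_fderiv_x τ).clm_apply ((h1.sub h2).const_smul (σ - τ)⁻¹)
    exact (((h3.comp h1).sub (h3.comp h2)).const_smul (σ - τ)⁻¹ |>.sub h4).norm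
  · filter_upwards [hI] with σ hσ s hs
    refine ⟨norm_nonneg _, ?_⟩
    have hs' : s ∈ Icc (-S.b) S.T := ⟨by linarith [hs.1, S.b_nonneg], hs.2⟩
    have h0 := hK₂ σ hσ τ hτ s hs'
    have h1 : ‖(σ - τ)⁻¹ • (S.f (S.x σ s) - S.f (S.x τ s))‖ ≤ S.M * K₂ :=
      norm_inv_smul_le (by positivity) ((S.norm_f_sub_le _ _).trans (by
        rw [mul_assoc]
        gcongr))
    have h2 : ‖fderiv ℝ S.f (S.x τ s) ((σ - τ)⁻¹ • (S.x σ s - S.x τ s))‖ ≤ S.M * K₂ :=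
      (S.norm_fderiv_apply_le _ _).trans (by
        gcongr
        exact norm_inv_smul_le hK₂0 h0)
    have h3 : 0 ≤ K₁ * S.T + ‖S.A‖ * (K₃ + K₃) := by positivity
    refine (norm_sub_le _ _).trans ?_
    linarith
  · refine Filter.Eventually.of_forall fun σ s _ => ?_
    have e : (σ - τ)⁻¹ • (-S.f (S.x σ s) + S.g s - (-S.f (S.x τ s) + S.g s)) -
        -fderiv ℝ S.f (S.x τ s) (S.y τ s) =
        -(fderiv ℝ S.f (S.x τ s) ((σ - τ)⁻¹ • (S.x σ s - S.x τ s) - S.y τ s)) -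
        ((σ - τ)⁻¹ • (S.f (S.x σ s) - S.f (S.x τ s)) -
          fderiv ℝ S.f (S.x τ s) ((σ - τ)⁻¹ • (S.x σ s - S.x τ s))) := by
      rw [add_sub_add_right_eq_sub, map_sub]
      simp only [smul_sub, smul_neg]
      abel
    rw [e]
    refine (norm_sub_le _ _).trans ?_
    rw [norm_neg]
    gcongr
    exact S.norm_fderiv_apply_le _ _
  · refine Filter.Eventually.of_forall fun s hs => ?_
    have hs' : s ∈ Icc (-S.b) S.T := ⟨by linarith [hs.1, S.b_nonneg], hs.2⟩
    rw [← tendsto_zero_iff_norm_tendsto_zero]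
    -- `f (x σ) - f (x τ) - Df (x τ) (x σ - x τ)` is small compared to `x σ - x τ`, hence to `σ - τ`
    have hO : (fun σ => S.x σ s - S.x τ s) =O[nhdsWithin τ (Icc 0 S.b \ {τ})]
        fun σ => σ - τ := by
      refine Asymptotics.IsBigO.of_bound K₂ ?_
      filter_upwards [hI] with σ hσ
      rw [Real.norm_eq_abs]
      exact hK₂ σ hσ τ hτ s hs'
    have hc : Filter.Tendsto (fun σ => S.x σ s) (nhdsWithin τ (Icc 0 S.b \ {τ}))
        (nhds (S.x τ s)) :=
      (tendsto_of_norm_sub_le fun σ hσ => hK₂ σ hσ τ hτ s hs').mono_left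
        (nhdsWithin_mono τ sdiff_subset)
    have ho := ((S.differentiable_f (S.x τ s)).hasFDerivAt.isLittleO.comp_tendsto hc).trans_isBigO
      hO
    have h3 : Filter.Tendsto (fun σ => (σ - τ)⁻¹ • (S.f (S.x σ s) - S.f (S.x τ s) -
        fderiv ℝ S.f (S.x τ s) (S.x σ s - S.x τ s))) (nhdsWithin τ (Icc 0 S.b \ {τ}))
        (nhds 0) := by
      have := ho.tendsto_inv_smul_nhds_zero
      simpa [Function.comp_def] using this
    refine h3.congr fun σ => ?_
    rw [map_smul, smul_sub]

/-! ### The second derivative with respect to the delay -/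

/-- The forcing term in the integrated equation of the second derivative. The kink of `x` at time
`0` makes it jump at time `σ`. -/
noncomputable def zForcing (σ t : ℝ) : E :=
  if t ≤ 0 then 0
  else -((2 : ℝ) • S.A (S.y σ (t - σ))) + S.A (S.xdot σ (t - σ) - S.p (-σ))

theorem stronglyMeasurable_zForcing (σ : ℝ) : StronglyMeasurable (S.zForcing σ) := by
  have h1 : Continuous fun t => -((2 : ℝ) • S.A (S.y σ (t - σ))) := by
    have := S.continuous_y σ
    fun_prop
  have h2 : StronglyMeasurable fun t => S.xdot σ (t - σ) :=
    (S.stronglyMeasurable_xdot σ).comp_measurable (measurable_id.sub_const σ)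
  have h3 : StronglyMeasurable fun t => S.xdot σ (t - σ) - S.p (-σ) :=
    h2.sub stronglyMeasurable_const
  exact StronglyMeasurable.ite measurableSet_Iic stronglyMeasurable_const
    (h1.stronglyMeasurable.add (S.A.continuous.comp_stronglyMeasurable h3))

theorem continuousAt_zForcing (σ : ℝ) {t : ℝ} (h0 : t ≠ 0) (hσ : t ≠ σ) :
    ContinuousAt (S.zForcing σ) t := by
  rcases lt_or_gt_of_ne h0 with h | h
  · refine (continuousAt_const (y := (0 : E))).congr ?_
    filter_upwards [Iio_mem_nhds h] with s hs
    exact (if_pos (le_of_lt hs)).symm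
  · have h1 : ContinuousAt (fun t => -((2 : ℝ) • S.A (S.y σ (t - σ)))) t := by
      have := S.continuous_y σ
      fun_prop
    have h2 : ContinuousAt (fun t => S.xdot σ (t - σ)) t :=
      ContinuousAt.comp (f := fun t => t - σ) (S.continuousAt_xdot σ (sub_ne_zero.2 hσ))
        (by fun_prop)
    have h3 : ContinuousAt (fun t => S.A (S.xdot σ (t - σ) - S.p (-σ))) t :=
      S.A.continuous.continuousAt.comp (h2.sub continuousAt_const)
    refine (h1.add h3).congr ?_
    filter_upwards [Ioi_mem_nhds h] with s hs
    exact (if_neg (not_le.2 hs)).symm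

theorem exists_zForcing_le : ∃ K, 0 ≤ K ∧ ∀ σ ∈ Icc 0 S.b, ∀ t ∈ Icc (-S.b) S.T,
    ‖S.zForcing σ t‖ ≤ K := by
  obtain ⟨K₁, hK₁0, hK₁⟩ := S.exists_y_le
  obtain ⟨K₂, hK₂0, hK₂⟩ := S.exists_xdot_le
  have hM := S.M_nonneg
  refine ⟨2 * (‖S.A‖ * K₁) + ‖S.A‖ * (K₂ + S.M), by positivity, fun σ hσ t ht => ?_⟩
  unfold zForcing
  split_ifs with h
  · rw [norm_zero]
    positivity
  · have ht' := sub_mem_Icc_of_mem hσ (T := S.T) ⟨(not_le.1 h).le, ht.2⟩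
    refine (norm_add_le _ _).trans (add_le_add ?_ ?_)
    · rw [norm_neg, norm_smul, Real.norm_of_nonneg (by norm_num)]
      gcongr
      refine (S.A.le_opNorm _).trans ?_
      gcongr
      exact hK₁ σ hσ _ ht'
    · refine (S.A.le_opNorm _).trans ?_
      gcongr
      exact (norm_sub_le _ _).trans (add_le_add (hK₂ σ hσ _ ht').1 (S.p_le _))

theorem continuous_fderiv_fderiv_xyy (σ : ℝ) :
    Continuous fun s => fderiv ℝ (fderiv ℝ S.f) (S.x σ s) (S.y σ s) (S.y σ s) :=
  ((S.continuous_fderiv_fderiv.comp (S.continuous_x σ)).clm_apply (S.continuous_y σ)).clm_apply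
    (S.continuous_y σ)

theorem stronglyMeasurable_fderiv_x_apply (σ : ℝ) {u : ℝ → E} (hu : StronglyMeasurable u) :
    StronglyMeasurable fun s => fderiv ℝ S.f (S.x σ s) (u s) :=
  isBoundedBilinearMap_apply.continuous.comp_stronglyMeasurable
    ((S.continuous_fderiv_x σ).stronglyMeasurable.prodMk hu)

theorem exists_z (σ : ℝ) : ∃ z : ℝ → E, StronglyMeasurable z ∧
    (∀ t, t ≠ 0 → t ≠ σ → ContinuousAt z t) ∧ (∀ t ≤ 0, z t = 0) ∧
    (σ ∈ Icc 0 S.b → IsDelayVolterra S.b S.T S.A σ (S.zForcing σ)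
      (fun s => -fderiv ℝ S.f (S.x σ s) (z s) -
        fderiv ℝ (fderiv ℝ S.f) (S.x σ s) (S.y σ s) (S.y σ s)) z) := by
  by_cases hσ : σ ∈ Icc 0 S.b
  · obtain ⟨K, hK0, hK⟩ := S.exists_zForcing_le
    have hm := S.stronglyMeasurable_zForcing σ
    have hM := S.M_nonneg
    obtain ⟨w, hwc, hw0, hw⟩ := exists_isDelayVolterra (A := S.A) S.T_nonneg S.M_nonneg hσ
      hm (hK σ hσ) (N := fun s u => -fderiv ℝ S.f (S.x σ s) u -
        fderiv ℝ (fderiv ℝ S.f) (S.x σ s) (S.y σ s) (S.y σ s))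
      (fun w hw => by
        refine IntervalIntegrable.sub ?_
          ((S.continuous_fderiv_fderiv_xyy σ).intervalIntegrable _ _)
        obtain ⟨K₁, hK₁⟩ := isCompact_Icc.exists_bound_of_continuousOn (s := Icc (-S.b) S.T)
          hw.continuousOn
        refine intervalIntegrable_of_norm_le (K := S.M * (K + K₁))
          (S.stronglyMeasurable_fderiv_x_apply σ (hm.add hw.stronglyMeasurable)).neg S.T_nonneg
          fun t ht => ?_
        have ht' : t ∈ Icc (-S.b) S.T := ⟨by linarith [ht.1, S.b_nonneg], ht.2⟩
        simp only [Pi.neg_apply, norm_neg]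
        refine (S.norm_fderiv_apply_le _ _).trans ?_
        gcongr
        exact (norm_add_le _ _).trans (add_le_add (hK σ hσ t ht') (hK₁ t ht')))
      (fun s _ u v => by
        rw [sub_sub_sub_cancel_right, neg_sub_neg, norm_sub_rev, ← map_sub]
        exact S.norm_fderiv_apply_le _ _)
    refine ⟨fun t => S.zForcing σ t + w t, hm.add hwc.stronglyMeasurable,
      fun t h1 h2 => (S.continuousAt_zForcing σ h1 h2).add hwc.continuousAt, fun t ht => ?_,
      fun _ => hw⟩
    simp only [zForcing, if_pos ht, hw0 t ht, add_zero]
  · exact ⟨_, stronglyMeasurable_const, fun _ _ _ => continuousAt_const, fun _ _ => rfl,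
      fun h => absurd h hσ⟩

/-- The second derivative of the solution with respect to the delay. It is bounded, but it jumps
at the times `0` and `σ`. -/
noncomputable def z (σ : ℝ) : ℝ → E := (S.exists_z σ).choose

theorem stronglyMeasurable_z (σ : ℝ) : StronglyMeasurable (S.z σ) :=
  (S.exists_z σ).choose_spec.1

theorem continuousAt_z {σ t : ℝ} (h0 : t ≠ 0) (hσ : t ≠ σ) : ContinuousAt (S.z σ) t :=
  (S.exists_z σ).choose_spec.2.1 t h0 hσ

theorem z_of_nonpos (σ : ℝ) {t : ℝ} (ht : t ≤ 0) : S.z σ t = 0 :=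
  (S.exists_z σ).choose_spec.2.2.1 t ht

theorem isDelayVolterra_z {σ : ℝ} (hσ : σ ∈ Icc 0 S.b) :
    IsDelayVolterra S.b S.T S.A σ (S.zForcing σ)
      (fun s => -fderiv ℝ S.f (S.x σ s) (S.z σ s) -
        fderiv ℝ (fderiv ℝ S.f) (S.x σ s) (S.y σ s) (S.y σ s)) (S.z σ) :=
  (S.exists_z σ).choose_spec.2.2.2 hσ

theorem exists_z_le : ∃ K, 0 ≤ K ∧ ∀ σ ∈ Icc 0 S.b, ∀ t ∈ Icc (-S.b) S.T, ‖S.z σ t‖ ≤ K := by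
  obtain ⟨K, hK0, hK⟩ := IsDelayVolterra.exists_bound S.b S.T S.b_nonneg S.T_nonneg S.A
    S.M_nonneg
  obtain ⟨K₁, hK₁0, hK₁⟩ := S.exists_zForcing_le
  obtain ⟨K₂, hK₂0, hK₂⟩ := S.exists_y_le
  have hM := S.M_nonneg
  have h2 : 0 ≤ S.M * K₂ * K₂ := by positivity
  refine ⟨K * (K₁ + S.M * K₂ * K₂), by positivity, fun σ hσ t ht => ?_⟩
  have hmem : ∀ s ∈ Icc 0 S.T, s ∈ Icc (-S.b) S.T := fun s hs =>
    ⟨by linarith [hs.1, S.b_nonneg], hs.2⟩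
  refine hK σ _ _ _ _ hσ (by positivity) (S.isDelayVolterra_z hσ) ?_ ?_ ?_ t ht
  · intro s hs
    rw [S.z_of_nonpos σ hs.2, norm_zero]
    positivity
  · intro s hs
    linarith [hK₁ σ hσ s (hmem s hs)]
  · intro s hs
    refine (norm_sub_le _ _).trans ?_
    rw [norm_neg]
    have e1 := S.norm_fderiv_apply_le (S.x σ s) (S.z σ s)
    have e2 : ‖fderiv ℝ (fderiv ℝ S.f) (S.x σ s) (S.y σ s) (S.y σ s)‖ ≤ S.M * K₂ * K₂ := by
      refine (S.norm_fderiv_fderiv_apply_le _ _ _).trans ?_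
      gcongr <;> exact hK₂ σ hσ s (hmem s hs)
    linarith

/-- The difference of two solutions is Lipschitz in time with a constant of the order of the
difference of the delays: it has no kink at time `0`, since the histories agree. -/
theorem exists_x_sub_sub_le : ∃ K, 0 ≤ K ∧ ∀ σ ∈ Icc 0 S.b, ∀ τ ∈ Icc 0 S.b,
    ∀ r ∈ Icc (-S.b) S.T, ∀ s ∈ Icc (-S.b) S.T,
      ‖(S.x σ r - S.x τ r) - (S.x σ s - S.x τ s)‖ ≤ K * |σ - τ| * |r - s| := by
  obtain ⟨K₁, hK₁0, hK₁⟩ := S.exists_x_sub_le_time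
  obtain ⟨K₂, hK₂0, hK₂⟩ := S.exists_x_sub_le_delay
  have hM := S.M_nonneg
  refine ⟨S.M * K₂ + ‖S.A‖ * (K₂ + K₁), by positivity, fun σ hσ τ hτ =>
    norm_sub_le_mul_abs_of_glue (u := fun r => S.x σ r - S.x τ r)
      (fun r hr s hs => ?_) (fun r hr s hs => ?_)⟩
  · simp only [S.x_of_nonpos _ hr.2, S.x_of_nonpos _ hs.2, sub_self, norm_zero]
    positivity
  · simp only [S.x_eq hσ hr, S.x_eq hσ hs, S.x_eq hτ hr, S.x_eq hτ hs, add_sub_add_left_eq_sub]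
    have := (convex_Icc 0 S.T).norm_image_sub_le_of_norm_hasDerivWithin_le
      (C := (S.M * K₂ + ‖S.A‖ * (K₂ + K₁)) * |σ - τ|)
      (fun t _ => ((hasDerivAt_integral_add (S.continuous_rhs σ) (S.continuous_x σ) S.A σ
        t).sub (hasDerivAt_integral_add (S.continuous_rhs τ) (S.continuous_x τ) S.A τ
        t)).hasDerivWithinAt)
      (fun t ht => by
        have e : -S.f (S.x σ t) + S.g t + S.A (S.x σ (t - σ)) -
            (-S.f (S.x τ t) + S.g t + S.A (S.x τ (t - τ))) =
            -(S.f (S.x σ t) - S.f (S.x τ t)) + S.A ((S.x σ (t - σ) - S.x τ (t - σ)) +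
              (S.x τ (t - σ) - S.x τ (t - τ))) := by
          simp only [map_add, map_sub]
          abel
        rw [e, add_mul, mul_assoc, mul_assoc]
        refine (norm_add_le _ _).trans (add_le_add ?_ ?_)
        · rw [norm_neg]
          refine (S.norm_f_sub_le _ _).trans ?_
          gcongr
          exact hK₂ σ hσ τ hτ t ⟨by linarith [ht.1, S.b_nonneg], ht.2⟩
        · refine (S.A.le_opNorm _).trans ?_
          gcongr
          rw [add_mul]
          have h1 := hK₂ σ hσ τ hτ _ (sub_mem_Icc_of_mem hσ ht)
          have h2 := hK₁ τ hτ _ (sub_mem_Icc_of_mem hσ ht) _ (sub_mem_Icc_of_mem hτ ht)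
          rw [sub_sub_sub_cancel_left, abs_sub_comm] at h2
          exact (norm_add_le _ _).trans (add_le_add h1 h2)) hs hr
    simpa [Pi.sub_apply] using this

/-- Where the delayed solution is differentiable in time, the forcing term of `y` is differentiable
with respect to the delay. -/
theorem tendsto_slope_y_forcing {τ : ℝ} (hτ : τ ∈ Icc 0 S.b) {t : ℝ} (ht : t ∈ Ioo 0 S.T)
    (htτ : t ≠ τ) :
    Filter.Tendsto (fun σ => (σ - τ)⁻¹ • (-S.A (S.x σ (t - σ) - S.P (-σ)) -
      -S.A (S.x τ (t - τ) - S.P (-τ)))) (nhdsWithin τ (Icc 0 S.b \ {τ}))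
      (nhds (-S.A (S.y τ (t - τ)) + S.A (S.xdot τ (t - τ) - S.p (-τ)))) := by
  have ht' : t ∈ Icc 0 S.T := ⟨ht.1.le, ht.2.le⟩
  have hne : nhdsWithin τ (Icc 0 S.b \ {τ}) ≤ nhdsWithin τ {τ}ᶜ :=
    nhdsWithin_mono _ fun s hs => hs.2
  have hI : ∀ᶠ σ in nhdsWithin τ (Icc 0 S.b \ {τ}), σ ∈ Icc 0 S.b :=
    nhdsWithin_mono τ sdiff_subset self_mem_nhdsWithin
  have h1 : Filter.Tendsto (fun σ => (σ - τ)⁻¹ • (S.x σ (t - τ) - S.x τ (t - τ)))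
      (nhdsWithin τ (Icc 0 S.b \ {τ})) (nhds (S.y τ (t - τ))) := by
    have := S.hasDerivWithinAt_x hτ (sub_mem_Icc_of_mem hτ ht')
    rw [hasDerivWithinAt_iff_tendsto_slope] at this
    simpa only [slope_fun_def, vsub_eq_sub] using this
  have h2 : Filter.Tendsto (fun σ => (σ - τ)⁻¹ • ((S.x σ (t - σ) - S.x τ (t - σ)) -
      (S.x σ (t - τ) - S.x τ (t - τ)))) (nhdsWithin τ (Icc 0 S.b \ {τ})) (nhds 0) := by
    obtain ⟨K, hK0, hK⟩ := S.exists_x_sub_sub_le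
    refine squeeze_zero_norm' (a := fun σ => K * |σ - τ|) ?_ ?_
    · filter_upwards [hI] with σ hσ
      refine norm_inv_smul_le (by positivity) ?_
      have := hK σ hσ τ hτ _ (sub_mem_Icc_of_mem hσ ht') _ (sub_mem_Icc_of_mem hτ ht')
      rwa [sub_sub_sub_cancel_left, abs_sub_comm τ σ] at this
    · have : Continuous fun σ => K * |σ - τ| := by fun_prop
      have h1 := this.tendsto τ
      rw [sub_self, abs_zero, mul_zero] at h1
      exact h1.mono_left nhdsWithin_le_nhds
  have h3 : Filter.Tendsto (fun σ => (σ - τ)⁻¹ • (S.x τ (t - σ) - S.x τ (t - τ)))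
      (nhdsWithin τ (Icc 0 S.b \ {τ})) (nhds (-S.xdot τ (t - τ))) := by
    have hd : HasDerivAt (fun σ => S.x τ (t - σ)) (-S.xdot τ (t - τ)) τ := by
      have := (S.hasDerivAt_x hτ (t := t - τ) (by linarith [ht.2, hτ.1])
        (sub_ne_zero.2 htτ)).scomp τ ((hasDerivAt_id τ).const_sub t)
      simpa [Function.comp_def] using this
    exact hd.tendsto_slope.mono_left hne
  have h4 : Filter.Tendsto (fun σ => (σ - τ)⁻¹ • (S.P (-σ) - S.P (-τ)))
      (nhdsWithin τ (Icc 0 S.b \ {τ})) (nhds (-S.p (-τ))) := by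
    have hd : HasDerivAt (fun σ => S.P (-σ)) (-S.p (-τ)) τ := by
      have := (S.hasDerivAt (-τ)).scomp τ (hasDerivAt_id τ).neg
      simpa [Function.comp_def] using this
    exact hd.tendsto_slope.mono_left hne
  have h5 := ((S.A.continuous.tendsto _).comp (((h1.add h2).add h3).sub h4)).neg
  have e : -S.A (S.y τ (t - τ) + 0 + -S.xdot τ (t - τ) - -S.p (-τ)) =
      -S.A (S.y τ (t - τ)) + S.A (S.xdot τ (t - τ) - S.p (-τ)) := by
    simp only [map_add, map_sub, map_neg, map_zero]
    abel
  rw [e] at h5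
  refine h5.congr fun σ => ?_
  simp only [Function.comp_apply, map_add, map_sub, map_smul, smul_sub, smul_neg]
  abel

theorem hasDerivWithinAt_y {τ : ℝ} (hτ : τ ∈ Icc 0 S.b) {t : ℝ} (ht : t ∈ Ioo (-S.b) S.T)
    (htτ : t ≠ τ) : HasDerivWithinAt (fun σ => S.y σ t) (S.z τ t) (Icc 0 S.b) τ := by
  rcases le_or_gt t 0 with ht0 | ht0
  · rw [S.z_of_nonpos τ ht0]
    simp only [S.y_of_nonpos _ ht0]
    exact hasDerivWithinAt_const _ _ _
  obtain ⟨K₁, hK₁0, hK₁⟩ := S.exists_y_sub_le_time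
  obtain ⟨K₂, hK₂0, hK₂⟩ := S.exists_y_sub_le_delay
  obtain ⟨K₃, hK₃0, hK₃⟩ := S.exists_y_forcing_sub_le
  obtain ⟨K₄, hK₄0, hK₄⟩ := S.exists_zForcing_le
  obtain ⟨K₅, hK₅0, hK₅⟩ := S.exists_y_le
  obtain ⟨K₆, hK₆0, hK₆⟩ := S.exists_x_sub_le_delay
  have hM := S.M_nonneg
  have hT := S.T_nonneg
  have hmem : ∀ s ∈ Icc 0 S.T, s ∈ Icc (-S.b) S.T := fun s hs =>
    ⟨by linarith [hs.1, S.b_nonneg], hs.2⟩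
  have hne : nhdsWithin τ (Icc 0 S.b \ {τ}) ≤ nhdsWithin τ {τ}ᶜ :=
    nhdsWithin_mono _ fun s hs => hs.2
  have hI : ∀ᶠ σ in nhdsWithin τ (Icc 0 S.b \ {τ}), σ ∈ Icc 0 S.b :=
    nhdsWithin_mono τ sdiff_subset self_mem_nhdsWithin
  have hF : ∀ r, 0 < r → r < S.T → r ≠ τ →
      Filter.Tendsto (fun σ => (σ - τ)⁻¹ • (-S.A (S.x σ (r - σ) - S.P (-σ)) -
        -S.A (S.x τ (r - τ) - S.P (-τ)))) (nhdsWithin τ (Icc 0 S.b \ {τ}))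
        (nhds (S.zForcing τ r - S.A (-(S.y τ (r - τ) - S.y τ (-τ))))) := by
    intro r h0 h1 h2
    have h3 := S.tendsto_slope_y_forcing hτ ⟨h0, h1⟩ h2
    have e : S.zForcing τ r - S.A (-(S.y τ (r - τ) - S.y τ (-τ))) =
        -S.A (S.y τ (r - τ)) + S.A (S.xdot τ (r - τ) - S.p (-τ)) := by
      rw [zForcing, if_neg (not_le.2 h0), S.y_of_nonpos τ (t := -τ) (by linarith [hτ.1]), sub_zero,
        map_neg, two_smul]
      abel
    rwa [e]
  have hρlim : ∀ s ∈ Icc 0 S.T, Filter.Tendsto (fun σ =>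
      ((σ - τ)⁻¹ • (fderiv ℝ S.f (S.x σ s) - fderiv ℝ S.f (S.x τ s))) (S.y σ s) -
        fderiv ℝ (fderiv ℝ S.f) (S.x τ s) (S.y τ s) (S.y τ s))
      (nhdsWithin τ (Icc 0 S.b \ {τ})) (nhds 0) := by
    intro s hs
    have h1 : HasDerivWithinAt (fun σ => fderiv ℝ S.f (S.x σ s))
        (fderiv ℝ (fderiv ℝ S.f) (S.x τ s) (S.y τ s)) (Icc 0 S.b) τ :=
      (S.differentiable_fderiv (S.x τ s)).hasFDerivAt.comp_hasDerivWithinAt τ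
        (S.hasDerivWithinAt_x hτ (hmem s hs))
    rw [hasDerivWithinAt_iff_tendsto_slope] at h1
    simp only [slope_fun_def, vsub_eq_sub] at h1
    have h2 : Filter.Tendsto (fun σ => S.y σ s) (nhdsWithin τ (Icc 0 S.b \ {τ}))
        (nhds (S.y τ s)) :=
      (tendsto_of_norm_sub_le fun σ hσ => hK₂ σ hσ τ hτ s (hmem s hs)).mono_left
        (nhdsWithin_mono τ sdiff_subset)
    have h3 := (Filter.Tendsto.continuousLinearMap_apply h1 h2).sub_const
      (fderiv ℝ (fderiv ℝ S.f) (S.x τ s) (S.y τ s) (S.y τ s))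
    rwa [sub_self] at h3
  rw [hasDerivWithinAt_iff_tendsto_slope]
  simp only [slope_fun_def, vsub_eq_sub]
  refine IsDelayVolterra.tendsto_smul_sub (A := S.A) S.b_nonneg hτ
    (nhdsWithin_mono τ sdiff_subset)
    S.M_nonneg (K := K₁ * S.T + K₃ + K₄ + (S.M * K₆ * K₅ + S.M * K₅ * K₅))
    (c := fun σ => (σ - τ)⁻¹)
    (W := fun t => -(S.y τ (t - τ) - S.y τ (-τ)))
    (ρ := fun σ s => ‖((σ - τ)⁻¹ • (fderiv ℝ S.f (S.x σ s) - fderiv ℝ S.f (S.x τ s))) (S.y σ s) -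
        fderiv ℝ (fderiv ℝ S.f) (S.x τ s) (S.y τ s) (S.y τ s)‖)
    (fun σ hσ => S.isDelayVolterra_y hσ)
    (fun σ hσ s hs => by rw [S.y_of_nonpos σ hs.2, S.y_of_nonpos τ hs.2])
    (S.isDelayVolterra_z hτ) (fun s hs => S.z_of_nonpos τ hs.2)
    (D := {0, τ}) (toFinite _).countable (fun r _ hr => ?_)
    ?_ ?_ ?_ ?_ ?_ ?_ ?_ ?_ ?_ t ⟨ht0.le, ht.2.le⟩ (hF t ht0 ht.2 htτ)
  · simp only [mem_insert_iff, mem_singleton_iff, not_or] at hr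
    exact S.continuousAt_z hr.1 hr.2
  · filter_upwards [hI] with σ hσ s hs
    have h1 := norm_inv_smul_le hK₃0 (hK₃ σ hσ τ hτ s hs)
    have h2 : 0 ≤ K₁ * S.T + K₄ + (S.M * K₆ * K₅ + S.M * K₅ * K₅) := by positivity
    linarith
  · filter_upwards [hI] with σ hσ s hs
    have h1 := norm_smul_integral_comp_sub_le hK₁0 (hK₁ τ hτ) hσ hτ hs
    have h2 : 0 ≤ K₃ + K₄ + (S.M * K₆ * K₅ + S.M * K₅ * K₅) := by positivity
    linarith
  · intro s hs
    have h1 := hK₄ τ hτ s (hmem s hs)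
    have h2 : 0 ≤ K₁ * S.T + K₃ + (S.M * K₆ * K₅ + S.M * K₅ * K₅) := by positivity
    linarith
  · intro s _
    exact (tendsto_slope_integral_comp_sub (S.continuous_y τ) τ s).mono_left hne
  · have hn : ∀ᵐ r : ℝ, r ∉ ({τ, S.T} : Set ℝ) := (toFinite _).countable.ae_notMem volume
    filter_upwards [hn] with r hr hr'
    simp only [mem_insert_iff, mem_singleton_iff, not_or] at hr
    exact hF r hr'.1 (lt_of_le_of_ne hr'.2 hr.2) hr.1
  · refine Filter.Eventually.of_forall fun σ => Continuous.aestronglyMeasurable ?_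
    exact ((((S.continuous_fderiv_x σ).sub (S.continuous_fderiv_x τ)).const_smul
      (σ - τ)⁻¹).clm_apply (S.continuous_y σ) |>.sub (S.continuous_fderiv_fderiv_xyy τ)).norm
  · filter_upwards [hI] with σ hσ s hs
    refine ⟨norm_nonneg _, ?_⟩
    have h1 : ‖((σ - τ)⁻¹ • (fderiv ℝ S.f (S.x σ s) - fderiv ℝ S.f (S.x τ s))) (S.y σ s)‖ ≤
        S.M * K₆ * K₅ := by
      refine (ContinuousLinearMap.le_opNorm _ _).trans ?_
      gcongr
      · refine norm_inv_smul_le (by positivity) ((S.norm_fderiv_sub_le _ _).trans ?_)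
        rw [mul_assoc]
        gcongr
        exact hK₆ σ hσ τ hτ s (hmem s hs)
      · exact hK₅ σ hσ s (hmem s hs)
    have h2 : ‖fderiv ℝ (fderiv ℝ S.f) (S.x τ s) (S.y τ s) (S.y τ s)‖ ≤ S.M * K₅ * K₅ := by
      refine (S.norm_fderiv_fderiv_apply_le _ _ _).trans ?_
      gcongr <;> exact hK₅ τ hτ s (hmem s hs)
    have h3 : 0 ≤ K₁ * S.T + K₃ + K₄ := by positivity
    refine (norm_sub_le _ _).trans ?_
    linarith
  · refine Filter.Eventually.of_forall fun σ s _ => ?_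
    have e : (σ - τ)⁻¹ • (-fderiv ℝ S.f (S.x σ s) (S.y σ s) -
        -fderiv ℝ S.f (S.x τ s) (S.y τ s)) -
        (-fderiv ℝ S.f (S.x τ s) (S.z τ s) -
          fderiv ℝ (fderiv ℝ S.f) (S.x τ s) (S.y τ s) (S.y τ s)) =
        -(fderiv ℝ S.f (S.x τ s) ((σ - τ)⁻¹ • (S.y σ s - S.y τ s) - S.z τ s)) -
        (((σ - τ)⁻¹ • (fderiv ℝ S.f (S.x σ s) - fderiv ℝ S.f (S.x τ s))) (S.y σ s) -
        fderiv ℝ (fderiv ℝ S.f) (S.x τ s) (S.y τ s) (S.y τ s)) := by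
      simp only [map_sub, map_smul, smul_sub, smul_neg, sub_apply, smul_apply]
      abel
    rw [e]
    refine (norm_sub_le _ _).trans ?_
    rw [norm_neg]
    gcongr
    exact S.norm_fderiv_apply_le _ _
  · refine Filter.Eventually.of_forall fun s hs => ?_
    rw [← tendsto_zero_iff_norm_tendsto_zero]
    exact hρlim s ⟨hs.1.le, hs.2⟩

theorem tendsto_xdot {τ : ℝ} (hτ : τ ∈ Icc 0 S.b) {t : ℝ} (ht : t ∈ Icc 0 S.T) (htτ : t ≠ τ) :
    Filter.Tendsto (fun σ => S.xdot σ (t - σ)) (nhdsWithin τ (Icc 0 S.b))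
      (nhds (S.xdot τ (t - τ))) := by
  have hlin : Filter.Tendsto (fun σ => t - σ) (nhdsWithin τ (Icc 0 S.b)) (nhds (t - τ)) :=
    ((continuous_const.sub continuous_id).tendsto τ).mono_left nhdsWithin_le_nhds
  rcases lt_or_gt_of_ne (sub_ne_zero.2 htτ) with h | h
  · rw [xdot, if_pos h.le]
    refine ((S.continuous_p.tendsto _).comp hlin).congr' ?_
    filter_upwards [hlin.eventually (Iio_mem_nhds h)] with σ hσ
    exact (if_pos (le_of_lt hσ)).symm
  · obtain ⟨K, hK0, hK⟩ := S.exists_x_sub_le_delay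
    have hI : ∀ᶠ σ in nhdsWithin τ (Icc 0 S.b), σ ∈ Icc 0 S.b := self_mem_nhdsWithin
    have hpos := hlin.eventually (Ioi_mem_nhds h)
    have hx1 := tendsto_apply_of_norm_sub_le (u := S.x) (S.continuous_x τ).continuousAt
      (fun σ hσ => hK σ hσ τ hτ) hlin (hI.mono fun σ hσ => sub_mem_Icc_of_mem hσ ht)
    have hlin2 : Filter.Tendsto (fun σ => t - σ - σ) (nhdsWithin τ (Icc 0 S.b))
        (nhds (t - τ - τ)) :=
      (((continuous_const.sub continuous_id).sub continuous_id).tendsto τ).mono_left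
        nhdsWithin_le_nhds
    have hx2 := tendsto_apply_of_norm_sub_le (u := S.x) (S.continuous_x τ).continuousAt
      (fun σ hσ => hK σ hσ τ hτ) hlin2 (by
        filter_upwards [hI, hpos] with σ hσ hp
        exact sub_mem_Icc_of_mem hσ ⟨le_of_lt hp, by linarith [ht.2, hσ.1]⟩)
    rw [xdot, if_neg (not_le.2 h)]
    refine (((((S.continuous_f.tendsto _).comp hx1).neg).add
      ((S.continuous_g.tendsto _).comp hlin)).add ((S.A.continuous.tendsto _).comp hx2)).congr' ?_
    filter_upwards [hpos] with σ hσ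
    exact (if_neg (not_le.2 hσ)).symm

theorem tendsto_zForcing {τ : ℝ} (hτ : τ ∈ Icc 0 S.b) {t : ℝ} (ht : t ∈ Icc 0 S.T)
    (htτ : t ≠ τ) :
    Filter.Tendsto (fun σ => S.zForcing σ t) (nhdsWithin τ (Icc 0 S.b))
      (nhds (S.zForcing τ t)) := by
  unfold zForcing
  split_ifs with h
  · exact tendsto_const_nhds
  · obtain ⟨K, hK0, hK⟩ := S.exists_y_sub_le_delay
    have hlin : Filter.Tendsto (fun σ => t - σ) (nhdsWithin τ (Icc 0 S.b)) (nhds (t - τ)) :=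
      ((continuous_const.sub continuous_id).tendsto τ).mono_left nhdsWithin_le_nhds
    have hy := tendsto_apply_of_norm_sub_le (u := S.y) (S.continuous_y τ).continuousAt
      (fun σ hσ => hK σ hσ τ hτ) hlin (by
        filter_upwards [self_mem_nhdsWithin] with σ hσ using sub_mem_Icc_of_mem hσ ht)
    have hp : Filter.Tendsto (fun σ => S.p (-σ)) (nhdsWithin τ (Icc 0 S.b)) (nhds (S.p (-τ))) :=
      ((S.continuous_p.comp continuous_neg).tendsto τ).mono_left nhdsWithin_le_nhds
    exact ((((S.A.continuous.tendsto _).comp hy).const_smul (2 : ℝ)).neg).add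
      ((S.A.continuous.tendsto _).comp ((S.tendsto_xdot hτ ht htτ).sub hp))

theorem continuousWithinAt_z {τ : ℝ} (hτ : τ ∈ Icc 0 S.b) {t : ℝ} (ht : t ∈ Icc (-S.b) S.T)
    (htτ : t ≠ τ) : ContinuousWithinAt (fun σ => S.z σ t) (Icc 0 S.b) τ := by
  rcases le_total t 0 with ht0 | ht0
  · simp only [S.z_of_nonpos _ ht0]
    exact continuousWithinAt_const
  obtain ⟨K₁, hK₁0, hK₁⟩ := S.exists_zForcing_le
  obtain ⟨K₂, hK₂0, hK₂⟩ := S.exists_z_le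
  obtain ⟨K₃, hK₃0, hK₃⟩ := S.exists_y_le
  obtain ⟨K₄, hK₄0, hK₄⟩ := S.exists_x_sub_le_delay
  obtain ⟨K₅, hK₅0, hK₅⟩ := S.exists_y_sub_le_delay
  have hM := S.M_nonneg
  have hT := S.T_nonneg
  have hmem : ∀ s ∈ Icc 0 S.T, s ∈ Icc (-S.b) S.T := fun s hs =>
    ⟨by linarith [hs.1, S.b_nonneg], hs.2⟩
  have hI : ∀ᶠ σ in nhdsWithin τ (Icc 0 S.b), σ ∈ Icc 0 S.b := self_mem_nhdsWithin
  have hF : ∀ r ∈ Icc 0 S.T, r ≠ τ →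
      Filter.Tendsto (fun σ => (1 : ℝ) • (S.zForcing σ r - S.zForcing τ r))
        (nhdsWithin τ (Icc 0 S.b)) (nhds (0 - S.A 0)) := by
    intro r hr h
    simpa using (S.tendsto_zForcing hτ hr h).sub_const (S.zForcing τ r)
  have hx : ∀ s ∈ Icc 0 S.T, Filter.Tendsto (fun σ => S.x σ s) (nhdsWithin τ (Icc 0 S.b))
      (nhds (S.x τ s)) := fun s hs =>
    tendsto_of_norm_sub_le fun σ hσ => hK₄ σ hσ τ hτ s (hmem s hs)
  have hy : ∀ s ∈ Icc 0 S.T, Filter.Tendsto (fun σ => S.y σ s) (nhdsWithin τ (Icc 0 S.b))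
      (nhds (S.y τ s)) := fun s hs =>
    tendsto_of_norm_sub_le fun σ hσ => hK₅ σ hσ τ hτ s (hmem s hs)
  have key := IsDelayVolterra.tendsto_smul_sub (A := S.A) S.b_nonneg hτ
    (l := nhdsWithin τ (Icc 0 S.b)) le_rfl S.M_nonneg (K := (K₁ + K₁) + (K₂ + K₂) * S.T +
      ((S.M + S.M) * K₂ + (S.M * K₃ * K₃ + S.M * K₃ * K₃)))
    (c := fun _ => 1) (W := fun _ => 0)
    (ρ := fun σ s => ‖(fderiv ℝ S.f (S.x σ s) - fderiv ℝ S.f (S.x τ s)) (S.z τ s)‖ +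
      ‖fderiv ℝ (fderiv ℝ S.f) (S.x σ s) (S.y σ s) (S.y σ s) -
        fderiv ℝ (fderiv ℝ S.f) (S.x τ s) (S.y τ s) (S.y τ s)‖)
    (fun σ hσ => S.isDelayVolterra_z hσ)
    (fun σ hσ s hs => by rw [S.z_of_nonpos σ hs.2, S.z_of_nonpos τ hs.2])
    (IsDelayVolterra.zero τ) (fun _ _ => rfl)
    countable_empty (fun _ _ _ => continuousAt_const)
    ?_ ?_ ?_ ?_ ?_ ?_ ?_ ?_ ?_ t ⟨ht0, ht.2⟩ (hF t ⟨ht0, ht.2⟩ htτ)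
  · have := key.add_const (S.z τ t)
    simpa [ContinuousWithinAt] using this
  · filter_upwards [hI] with σ hσ s hs
    rw [one_smul]
    have h1 := norm_sub_le (S.zForcing σ s) (S.zForcing τ s)
    have h2 : 0 ≤ (K₂ + K₂) * S.T +
      ((S.M + S.M) * K₂ + (S.M * K₃ * K₃ + S.M * K₃ * K₃)) := by positivity
    linarith [hK₁ σ hσ s (hmem s hs), hK₁ τ hτ s (hmem s hs)]
  · filter_upwards [hI] with σ hσ s hs
    have h1 : ‖∫ r in 0..s, (S.z τ (r - σ) - S.z τ (r - τ))‖ ≤ (K₂ + K₂) * |s - 0| :=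
      intervalIntegral.norm_integral_le_of_norm_le_const fun r hr => by
        rw [uIoc_of_le hs.1] at hr
        have hr' : r ∈ Icc 0 S.T := ⟨hr.1.le, hr.2.trans hs.2⟩
        exact (norm_sub_le _ _).trans (add_le_add (hK₂ τ hτ _ (sub_mem_Icc_of_mem hσ hr'))
          (hK₂ τ hτ _ (sub_mem_Icc_of_mem hτ hr')))
    rw [sub_zero, abs_of_nonneg hs.1] at h1
    have h2 : (K₂ + K₂) * s ≤ (K₂ + K₂) * S.T := by
      gcongr
      exact hs.2
    have h3 : 0 ≤ (K₁ + K₁) +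
      ((S.M + S.M) * K₂ + (S.M * K₃ * K₃ + S.M * K₃ * K₃)) := by positivity
    rw [one_smul]
    linarith
  · intro s _
    rw [norm_zero]
    positivity
  · intro s hs
    simp only [one_smul]
    refine tendsto_integral_comp_sub (S.stronglyMeasurable_z τ) (hK₂ τ hτ) (D := {0, τ})
      (toFinite _).countable (fun r _ hr => ?_) hτ hs
    simp only [mem_insert_iff, mem_singleton_iff, not_or] at hr
    exact S.continuousAt_z hr.1 hr.2
  · have hn : ∀ᵐ r : ℝ, r ∉ ({τ} : Set ℝ) := (toFinite _).countable.ae_notMem volume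
    filter_upwards [hn] with r hr hr' using hF r ⟨hr'.1.le, hr'.2⟩ hr
  · refine Filter.Eventually.of_forall fun σ => StronglyMeasurable.aestronglyMeasurable ?_
    have h1 := (S.stronglyMeasurable_fderiv_x_apply σ (S.stronglyMeasurable_z τ)).sub
      (S.stronglyMeasurable_fderiv_x_apply τ (S.stronglyMeasurable_z τ))
    have h2 := (S.continuous_fderiv_fderiv_xyy σ).sub (S.continuous_fderiv_fderiv_xyy τ)
    exact h1.norm.add h2.norm.stronglyMeasurable
  · filter_upwards [hI] with σ hσ s hs
    refine ⟨by positivity, ?_⟩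
    have h1 : ‖(fderiv ℝ S.f (S.x σ s) - fderiv ℝ S.f (S.x τ s)) (S.z τ s)‖ ≤
        (S.M + S.M) * K₂ := by
      refine (ContinuousLinearMap.le_opNorm _ _).trans ?_
      gcongr
      · exact (norm_sub_le _ _).trans (add_le_add (S.fderiv_le _) (S.fderiv_le _))
      · exact hK₂ τ hτ s (hmem s hs)
    have h2 : ∀ σ ∈ Icc 0 S.b, ‖fderiv ℝ (fderiv ℝ S.f) (S.x σ s) (S.y σ s) (S.y σ s)‖ ≤
        S.M * K₃ * K₃ := by
      intro σ hσ
      refine (S.norm_fderiv_fderiv_apply_le _ _ _).trans ?_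
      gcongr <;> exact hK₃ σ hσ s (hmem s hs)
    have h3 := (norm_sub_le (fderiv ℝ (fderiv ℝ S.f) (S.x σ s) (S.y σ s) (S.y σ s))
      (fderiv ℝ (fderiv ℝ S.f) (S.x τ s) (S.y τ s) (S.y τ s))).trans
        (add_le_add (h2 σ hσ) (h2 τ hτ))
    have h4 : 0 ≤ (K₁ + K₁) + (K₂ + K₂) * S.T := by positivity
    linarith
  · refine Filter.Eventually.of_forall fun σ s _ => ?_
    have e : (1 : ℝ) • (-fderiv ℝ S.f (S.x σ s) (S.z σ s) -
        fderiv ℝ (fderiv ℝ S.f) (S.x σ s) (S.y σ s) (S.y σ s) -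
        (-fderiv ℝ S.f (S.x τ s) (S.z τ s) -
        fderiv ℝ (fderiv ℝ S.f) (S.x τ s) (S.y τ s) (S.y τ s))) - 0 =
        -(fderiv ℝ S.f (S.x σ s) ((1 : ℝ) • (S.z σ s - S.z τ s) - 0)) -
        (fderiv ℝ S.f (S.x σ s) - fderiv ℝ S.f (S.x τ s)) (S.z τ s) -
        (fderiv ℝ (fderiv ℝ S.f) (S.x σ s) (S.y σ s) (S.y σ s) -
        fderiv ℝ (fderiv ℝ S.f) (S.x τ s) (S.y τ s) (S.y τ s)) := by
      simp only [one_smul, sub_zero, map_sub, sub_apply]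
      abel
    rw [e, ← add_assoc]
    refine (norm_sub_le _ _).trans (add_le_add ((norm_sub_le _ _).trans (add_le_add ?_ le_rfl))
      le_rfl)
    rw [norm_neg]
    exact S.norm_fderiv_apply_le _ _
  · refine Filter.Eventually.of_forall fun s hs => ?_
    have hs' : s ∈ Icc 0 S.T := ⟨hs.1.le, hs.2⟩
    have h1 := Filter.Tendsto.continuousLinearMap_apply
      (((S.continuous_fderiv.tendsto _).comp (hx s hs')).sub_const (fderiv ℝ S.f (S.x τ s)))
      (tendsto_const_nhds (x := S.z τ s))
    have h2 := (Filter.Tendsto.continuousLinearMap_apply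
      (Filter.Tendsto.continuousLinearMap_apply
        ((S.continuous_fderiv_fderiv.tendsto _).comp (hx s hs')) (hy s hs')) (hy s hs')).sub_const
      (fderiv ℝ (fderiv ℝ S.f) (S.x τ s) (S.y τ s) (S.y τ s))
    rw [sub_self] at h1 h2
    simpa using h1.norm.add h2.norm

end BoundedDelaySystem

/-! ### From pointwise to mean square derivatives -/

/-- Dominated convergence in `L²` of a finite measure, along a countably generated filter. -/
theorem tendsto_Lp_two_of_tendsto_ae {α ι E : Type*} [MeasurableSpace α] {μ : Measure α}
    [IsFiniteMeasure μ] [NormedAddCommGroup E] {l : Filter ι} [l.IsCountablyGenerated]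
    {W : ι → Lp E 2 μ} {W₀ : Lp E 2 μ} {w : ι → α → E} {w₀ : α → E} {K : ℝ}
    (hW : ∀ᶠ i in l, W i =ᵐ[μ] w i) (hW₀ : W₀ =ᵐ[μ] w₀)
    (hK : ∀ᶠ i in l, ∀ᵐ t ∂μ, ‖w i t - w₀ t‖ ≤ K)
    (hlim : ∀ᵐ t ∂μ, Filter.Tendsto (fun i => w i t) l (nhds (w₀ t))) :
    Filter.Tendsto W l (nhds W₀) := by
  rw [Lp.tendsto_Lp_iff_tendsto_eLpNorm']
  have h1 : Filter.Tendsto (fun i => ∫⁻ t, ‖(w i - w₀) t‖ₑ ^ (2 : ℝ) ∂μ) l (nhds 0) := by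
    have := tendsto_lintegral_filter_of_dominated_convergence' (μ := μ) (l := l)
      (F := fun i t => ‖(w i - w₀) t‖ₑ ^ (2 : ℝ)) (f := fun _ => 0)
      (fun _ => ENNReal.ofReal K ^ (2 : ℝ))
      (by
        filter_upwards [hW] with i hi
        have h2 : AEStronglyMeasurable (w i - w₀) μ :=
          ((Lp.aestronglyMeasurable (W i)).congr hi).sub
            ((Lp.aestronglyMeasurable W₀).congr hW₀)
        exact h2.enorm.pow_const _)
      (by
        filter_upwards [hK] with i hi
        filter_upwards [hi] with t ht
        gcongr
        rw [← ofReal_norm]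
        exact ENNReal.ofReal_le_ofReal ht)
      (by
        rw [lintegral_const]
        exact ENNReal.mul_ne_top (by simp) (measure_ne_top _ _))
      (by
        filter_upwards [hlim] with t ht
        have h3 : Filter.Tendsto (fun i => ‖(w i - w₀) t‖ₑ) l (nhds 0) := by
          have := (ht.sub_const (w₀ t)).enorm
          simpa using this
        have h4 := (ENNReal.continuous_rpow_const (y := 2)).tendsto 0 |>.comp h3
        simpa [Function.comp_def] using h4)
    simpa using this
  have h2 : Filter.Tendsto (fun i => (∫⁻ t, ‖(w i - w₀) t‖ₑ ^ (2 : ℝ) ∂μ) ^ (1 / 2 : ℝ)) l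
      (nhds 0) := by
    have := (ENNReal.continuous_rpow_const (y := 1 / 2)).tendsto 0 |>.comp h1
    simpa [Function.comp_def] using this
  refine h2.congr' ?_
  filter_upwards [hW] with i hi
  rw [eLpNorm_congr_ae (hi.sub hW₀), eLpNorm_eq_lintegral_rpow_enorm_toReal (by norm_num)
    (by norm_num)]
  simp

/-- A family that is Lipschitz in the parameter and differentiable at almost every point is
differentiable in `L²`. -/
theorem hasDerivWithinAt_Lp_two {α E : Type*} [MeasurableSpace α] {μ : Measure α}
    [IsFiniteMeasure μ] [NormedAddCommGroup E] [NormedSpace ℝ E] {I : Set ℝ} {τ : ℝ}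
    {X : ℝ → Lp E 2 μ} {Y : Lp E 2 μ} {x : ℝ → α → E} {y : α → E} {K K' : ℝ} (hK0 : 0 ≤ K)
    (hτ : τ ∈ I) (hX : ∀ σ ∈ I, X σ =ᵐ[μ] x σ) (hY : Y =ᵐ[μ] y)
    (hK : ∀ σ ∈ I, ∀ᵐ t ∂μ, ‖x σ t - x τ t‖ ≤ K * |σ - τ|) (hy : ∀ᵐ t ∂μ, ‖y t‖ ≤ K')
    (hd : ∀ᵐ t ∂μ, HasDerivWithinAt (fun σ => x σ t) (y t) I τ) :
    HasDerivWithinAt X Y I τ := by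
  have hI : ∀ᶠ σ in nhdsWithin τ (I \ {τ}), σ ∈ I :=
    nhdsWithin_mono τ sdiff_subset self_mem_nhdsWithin
  rw [hasDerivWithinAt_iff_tendsto_slope]
  refine tendsto_Lp_two_of_tendsto_ae (w := fun σ t => (σ - τ)⁻¹ • (x σ t - x τ t))
    (K := K + K') ?_ hY ?_ ?_
  · filter_upwards [hI] with σ hσ
    rw [slope_def_module]
    filter_upwards [Lp.coeFn_smul (σ - τ)⁻¹ (X σ - X τ), Lp.coeFn_sub (X σ) (X τ), hX σ hσ,
      hX τ hτ] with t h1 h2 h3 h4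
    rw [h1, Pi.smul_apply, h2, Pi.sub_apply, h3, h4]
  · filter_upwards [hI] with σ hσ
    filter_upwards [hK σ hσ, hy] with t h1 h2
    exact (norm_sub_le _ _).trans (add_le_add (norm_inv_smul_le hK0 h1) h2)
  · filter_upwards [hd] with t ht
    rw [hasDerivWithinAt_iff_tendsto_slope] at ht
    simpa only [slope_fun_def, vsub_eq_sub] using ht

theorem hasDerivWithinAt_subtype_iff {F : Type*} [NormedAddCommGroup F] [NormedSpace ℝ F]
    {V : Submodule ℝ F} {u : ℝ → V} {u' : V} {I : Set ℝ} {τ : ℝ} :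
    HasDerivWithinAt u u' I τ ↔ HasDerivWithinAt (fun σ => (u σ : F)) (u' : F) I τ := by
  rw [hasDerivWithinAt_iff_tendsto_slope, hasDerivWithinAt_iff_tendsto_slope,
    Topology.IsInducing.subtypeVal.tendsto_nhds_iff]
  refine Filter.tendsto_congr fun σ => ?_
  simp [slope_def_module]

/-- A function with a continuous second derivative in the one-sided sense is `C²` on an interval. -/
theorem contDiffOn_two_of_hasDerivWithinAt {F : Type*} [NormedAddCommGroup F] [NormedSpace ℝ F]
    {X X' X'' : ℝ → F} {α β : ℝ} (hαβ : α < β)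
    (h₁ : ∀ τ ∈ Icc α β, HasDerivWithinAt X (X' τ) (Icc α β) τ)
    (h₂ : ∀ τ ∈ Icc α β, HasDerivWithinAt X' (X'' τ) (Icc α β) τ)
    (h₃ : ContinuousOn X'' (Icc α β)) : ContDiffOn ℝ 2 X (Icc α β) := by
  have hu := uniqueDiffOn_Icc hαβ
  have key : ∀ {n : ℕ} {Z Z' : ℝ → F},
      (∀ τ ∈ Icc α β, HasDerivWithinAt Z (Z' τ) (Icc α β) τ) → ContDiffOn ℝ n Z' (Icc α β) →
      ContDiffOn ℝ (n + 1) Z (Icc α β) := by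
    intro n Z Z' hZ hZ'
    rw [contDiffOn_succ_iff_derivWithin hu]
    refine ⟨fun τ hτ => (hZ τ hτ).differentiableWithinAt, by simp, ?_⟩
    exact hZ'.congr fun τ hτ => (hZ τ hτ).derivWithin (hu τ hτ)
  have h0 : ContDiffOn ℝ (0 : ℕ) X'' (Icc α β) := by
    simpa using (contDiffOn_zero (𝕜 := ℝ)).2 h₃
  have h1 : ContDiffOn ℝ (1 : ℕ) X' (Icc α β) := by
    have := key h₂ h0
    simpa using this
  have := key h₁ h1
  have e : ((1 : ℕ) : WithTop ℕ∞) + 1 = 2 := by norm_num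
  rwa [e] at this

theorem memLp_two_of_norm_le {E : Type*} [NormedAddCommGroup E] {u : ℝ → E}
    (hu : StronglyMeasurable u) {α β K : ℝ} (hK : ∀ t ∈ Icc α β, ‖u t‖ ≤ K) :
    MemLp u 2 (volume.restrict (Ioo α β)) :=
  MemLp.of_bound hu.aestronglyMeasurable K ((ae_restrict_iff' measurableSet_Ioo).2
    (Filter.Eventually.of_forall fun t ht => hK t ⟨ht.1.le, ht.2.le⟩))

namespace BoundedDelaySystem

variable {E : Type*} [NormedAddCommGroup E] [NormedSpace ℝ E] [CompleteSpace E]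
  (S : BoundedDelaySystem E)

/-- The solution, as a function of the delay with values in `L²(-b, T)`, has two continuous
derivatives, and these vanish on the history interval. -/
theorem exists_Lp_two : ∃ X Y Z : ℝ → Lp E 2 (volume.restrict (Ioo (-S.b) S.T)),
    (∀ σ ∈ Icc 0 S.b, X σ =ᵐ[volume.restrict (Ioo (-S.b) S.T)] S.x σ) ∧
    (∀ σ, ∀ᵐ t ∂volume.restrict (Ioo (-S.b) S.T), t < 0 → Y σ t = 0) ∧
    (∀ σ, ∀ᵐ t ∂volume.restrict (Ioo (-S.b) S.T), t < 0 → Z σ t = 0) ∧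
    (∀ σ ∈ Icc 0 S.b, HasDerivWithinAt X (Y σ) (Icc 0 S.b) σ) ∧
    (∀ σ ∈ Icc 0 S.b, HasDerivWithinAt Y (Z σ) (Icc 0 S.b) σ) ∧
    ContinuousOn Z (Icc 0 S.b) := by
  set μ := volume.restrict (Ioo (-S.b) S.T) with hμ
  obtain ⟨K₁, hK₁0, hK₁⟩ := S.exists_x_le
  obtain ⟨K₂, hK₂0, hK₂⟩ := S.exists_y_le
  obtain ⟨K₃, hK₃0, hK₃⟩ := S.exists_z_le
  obtain ⟨L₁, hL₁0, hL₁⟩ := S.exists_x_sub_le_delay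
  obtain ⟨L₂, hL₂0, hL₂⟩ := S.exists_y_sub_le_delay
  -- outside `[0, b]` the families are continued by zero
  have hrep : ∀ (u : ℝ → ℝ → E) (K : ℝ), (∀ σ, StronglyMeasurable (u σ)) →
      (∀ σ ∈ Icc 0 S.b, ∀ t ∈ Icc (-S.b) S.T, ‖u σ t‖ ≤ K) →
      ∀ σ, ∃ U : Lp E 2 μ, (σ ∈ Icc 0 S.b → U =ᵐ[μ] u σ) ∧ (σ ∉ Icc 0 S.b → U = 0) := by
    intro u K hu hK σ
    by_cases hσ : σ ∈ Icc 0 S.b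
    · exact ⟨(memLp_two_of_norm_le (hu σ) (hK σ hσ)).toLp, fun _ => MemLp.coeFn_toLp _,
        fun h => absurd hσ h⟩
    · exact ⟨0, fun h => absurd h hσ, fun _ => rfl⟩
  have hnull : ∀ (u : ℝ → ℝ → E) (U : ℝ → Lp E 2 μ), (∀ σ, ∀ t ≤ 0, u σ t = 0) →
      (∀ σ, (σ ∈ Icc 0 S.b → U σ =ᵐ[μ] u σ) ∧ (σ ∉ Icc 0 S.b → U σ = 0)) →
      ∀ σ, ∀ᵐ t ∂μ, t < 0 → U σ t = 0 := by
    intro u U hu hU σ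
    by_cases hσ : σ ∈ Icc 0 S.b
    · filter_upwards [(hU σ).1 hσ] with t ht h0
      rw [ht, hu σ t h0.le]
    · rw [(hU σ).2 hσ]
      filter_upwards [Lp.coeFn_zero E 2 μ] with t ht _
      rw [ht, Pi.zero_apply]
  choose X hX using hrep S.x K₁ (fun σ => (S.continuous_x σ).stronglyMeasurable) hK₁
  choose Y hY using hrep S.y K₂ (fun σ => (S.continuous_y σ).stronglyMeasurable) hK₂
  choose Z hZ using hrep S.z K₃ S.stronglyMeasurable_z hK₃
  have hmem : ∀ᵐ t ∂μ, t ∈ Ioo (-S.b) S.T := ae_restrict_mem measurableSet_Ioo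
  have hne : ∀ τ : ℝ, ∀ᵐ t ∂μ, t ≠ τ := fun τ =>
    ae_restrict_of_ae ((countable_singleton τ).ae_notMem volume)
  refine ⟨X, Y, Z, fun σ hσ => (hX σ).1 hσ, hnull S.y Y (fun σ t ht => S.y_of_nonpos σ ht) hY,
    hnull S.z Z (fun σ t ht => S.z_of_nonpos σ ht) hZ, fun τ hτ => ?_, fun τ hτ => ?_,
    fun τ hτ => ?_⟩
  · refine hasDerivWithinAt_Lp_two (K' := K₂) hL₁0 hτ (fun σ hσ => (hX σ).1 hσ) ((hY τ).1 hτ)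
      (fun σ hσ => ?_) ?_ ?_
    · filter_upwards [hmem] with t ht using hL₁ σ hσ τ hτ t ⟨ht.1.le, ht.2.le⟩
    · filter_upwards [hmem] with t ht using hK₂ τ hτ t ⟨ht.1.le, ht.2.le⟩
    · filter_upwards [hmem] with t ht using S.hasDerivWithinAt_x hτ ⟨ht.1.le, ht.2.le⟩
  · refine hasDerivWithinAt_Lp_two (K' := K₃) hL₂0 hτ (fun σ hσ => (hY σ).1 hσ) ((hZ τ).1 hτ)
      (fun σ hσ => ?_) ?_ ?_
    · filter_upwards [hmem] with t ht using hL₂ σ hσ τ hτ t ⟨ht.1.le, ht.2.le⟩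
    · filter_upwards [hmem] with t ht using hK₃ τ hτ t ⟨ht.1.le, ht.2.le⟩
    · filter_upwards [hmem, hne τ] with t ht h using S.hasDerivWithinAt_y hτ ht h
  · refine tendsto_Lp_two_of_tendsto_ae (w := S.z) (K := K₃ + K₃) ?_ ((hZ τ).1 hτ) ?_ ?_
    · filter_upwards [self_mem_nhdsWithin] with σ hσ using (hZ σ).1 hσ
    · filter_upwards [self_mem_nhdsWithin] with σ hσ
      filter_upwards [hmem] with t ht
      exact (norm_sub_le _ _).trans (add_le_add (hK₃ σ hσ t ⟨ht.1.le, ht.2.le⟩)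
        (hK₃ τ hτ t ⟨ht.1.le, ht.2.le⟩))
    · filter_upwards [hmem, hne τ] with t ht h
      exact S.continuousWithinAt_z hτ ⟨ht.1.le, ht.2.le⟩ h

end BoundedDelaySystem

/-! ### Weak derivatives on an interval -/

section

variable {E : Type*} [NormedAddCommGroup E] [NormedSpace ℝ E] {α β : ℝ}

theorem integral_Ioo_smul_eq_integral {η : ℝ → ℝ} (hη : tsupport η ⊆ Ioo α β) (w : ℝ → E) :
    ∫ t in Ioo α β, η t • w t = ∫ t, η t • w t :=
  setIntegral_eq_integral_of_forall_compl_eq_zero fun t ht => by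
    rw [image_eq_zero_of_notMem_tsupport fun h => ht (hη h), zero_smul]

theorem integrable_smul_of_tsupport_subset {η : ℝ → ℝ} (hc : Continuous η)
    (hs : HasCompactSupport η) (hη : tsupport η ⊆ Ioo α β) {w : ℝ → E}
    (hw : LocallyIntegrableOn w (Ioo α β)) : Integrable fun t => η t • w t := by
  have h1 : IntegrableOn (fun t => η t • w t) (tsupport η) :=
    (hw.integrableOn_compact_subset hη hs).continuousOn_smul hc.continuousOn hs
  have hsub : Function.support (fun t => η t • w t) ⊆ tsupport η :=
    (Function.support_smul_subset_left η w).trans subset_closure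
  rwa [integrableOn_iff_integrable_of_support_subset hsub] at h1

/-- A test function with zero mean is the derivative of a test function. -/
theorem exists_deriv_eq_of_integral_eq_zero (hαβ : α < β) {ζ : ℝ → ℝ} (hd : ContDiff ℝ ∞ ζ)
    (hs : HasCompactSupport ζ) (hζ : tsupport ζ ⊆ Ioo α β) (h0 : ∫ t, ζ t = 0) :
    ∃ ψ : ℝ → ℝ, ContDiff ℝ ∞ ψ ∧ HasCompactSupport ψ ∧ tsupport ψ ⊆ Ioo α β ∧ deriv ψ = ζ := by
  have hmid : (α + β) / 2 ∈ Ioo α β := ⟨by linarith, by linarith⟩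
  -- the midpoint is added to the support only to make it nonempty
  have hKc : IsCompact (insert ((α + β) / 2) (tsupport ζ)) :=
    IsCompact.insert hs _
  have hK : insert ((α + β) / 2) (tsupport ζ) ⊆ Ioo α β := insert_subset hmid hζ
  obtain ⟨a, ha, ha'⟩ := hKc.exists_isLeast ⟨_, mem_insert _ _⟩
  obtain ⟨c, hc, hc'⟩ := hKc.exists_isGreatest ⟨_, mem_insert _ _⟩
  have hlt : ∀ t, t < a → ζ t = 0 := fun t ht =>
    image_eq_zero_of_notMem_tsupport fun h => absurd (ha' (mem_insert_of_mem _ h)) (not_le.2 ht)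
  have hgt : ∀ t, c < t → ζ t = 0 := fun t ht =>
    image_eq_zero_of_notMem_tsupport fun h => absurd (hc' (mem_insert_of_mem _ h)) (not_le.2 ht)
  have hint : ∀ r s, IntervalIntegrable ζ volume r s := fun r s =>
    hd.continuous.intervalIntegrable r s
  have hder : ∀ t, HasDerivAt (fun t => ∫ s in a..t, ζ s) (ζ t) t := fun t =>
    intervalIntegral.integral_hasDerivAt_right (hint _ _)
      hd.continuous.stronglyMeasurable.stronglyMeasurableAtFilter hd.continuous.continuousAt
  have hderiv : deriv (fun t => ∫ s in a..t, ζ s) = ζ := funext fun t => (hder t).deriv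
  have hsupp : Function.support (fun t => ∫ s in a..t, ζ s) ⊆ Icc a c := by
    intro t ht
    by_contra hmem
    refine ht ?_
    rcases lt_or_ge t a with h | h
    · refine intervalIntegral.integral_zero_ae ?_
      filter_upwards [(countable_singleton a).ae_notMem volume] with s hs hs'
      rw [uIoc_of_ge h.le] at hs'
      exact hlt s (lt_of_le_of_ne hs'.2 hs)
    · have hct : c < t := not_le.1 fun h' => hmem ⟨h, h'⟩
      change ∫ s in a..t, ζ s = 0
      rw [intervalIntegral.integral_of_le h, ← h0]
      rw [← integral_Icc_eq_integral_Ioc]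
      refine setIntegral_eq_integral_of_forall_compl_eq_zero fun s hs => ?_
      rcases lt_or_ge s a with h1 | h1
      · exact hlt s h1
      · exact hgt s (hct.trans (not_le.1 fun h2 => hs ⟨h1, h2⟩))
  have hts : tsupport (fun t => ∫ s in a..t, ζ s) ⊆ Icc a c :=
    closure_minimal hsupp isClosed_Icc
  refine ⟨fun t => ∫ s in a..t, ζ s, ?_, HasCompactSupport.of_support_subset_isCompact
    isCompact_Icc hsupp, hts.trans (Icc_subset_Ioo (hK ha).1 (hK hc).2), hderiv⟩
  rw [contDiff_infty_iff_deriv, hderiv]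
  exact ⟨fun t => (hder t).differentiableAt, hd⟩

/-- The du Bois-Reymond lemma: a function with zero weak derivative is constant. -/
theorem exists_ae_eq_const_of_integral_deriv_smul_eq_zero [CompleteSpace E] (hαβ : α < β)
    {w : ℝ → E} (hw : LocallyIntegrableOn w (Ioo α β))
    (h : ∀ ψ : ℝ → ℝ, ContDiff ℝ ∞ ψ → HasCompactSupport ψ → tsupport ψ ⊆ Ioo α β →
      ∫ t in Ioo α β, deriv ψ t • w t = 0) :
    ∃ c, ∀ᵐ t ∂volume.restrict (Ioo α β), w t = c := by
  let φ : ContDiffBump ((α + β) / 2) := ⟨(β - α) / 8, (β - α) / 4, by linarith, by linarith⟩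
  set θ : ℝ → ℝ := φ.normed volume with hθ
  have hθd : ContDiff ℝ ∞ θ := φ.contDiff_normed
  have hθs : HasCompactSupport θ := φ.hasCompactSupport_normed
  have hθt : tsupport θ ⊆ Ioo α β := by
    rw [hθ, φ.tsupport_normed_eq, Real.closedBall_eq_Icc]
    exact Icc_subset_Ioo (by simp only [φ]; linarith) (by simp only [φ]; linarith)
  have hθ1 : ∫ t, θ t = 1 := φ.integral_normed
  refine ⟨∫ t, θ t • w t, ?_⟩
  set c := ∫ t, θ t • w t with hc
  rw [ae_restrict_iff' measurableSet_Ioo]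
  have hloc : LocallyIntegrableOn (fun t => w t - c) (Ioo α β) :=
    hw.sub (locallyIntegrableOn_const c)
  have := isOpen_Ioo.ae_eq_zero_of_integral_contDiff_smul_eq_zero hloc fun η hηd hηs hηt => ?_
  · filter_upwards [this] with t ht hmem using sub_eq_zero.1 (ht hmem)
  have hηi : Integrable η := hηd.continuous.integrable_of_hasCompactSupport hηs
  have hθi : Integrable θ := hθd.continuous.integrable_of_hasCompactSupport hθs
  -- subtract a multiple of `θ` from `η` to obtain a test function with zero mean
  have hts : tsupport (fun t => η t - (∫ s, η s) * θ t) ⊆ tsupport η ∪ tsupport θ := by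
    refine closure_minimal (fun t ht => ?_) ((isClosed_tsupport _).union (isClosed_tsupport _))
    by_contra hn
    rw [mem_union, not_or] at hn
    refine ht ?_
    simp only [image_eq_zero_of_notMem_tsupport hn.1, image_eq_zero_of_notMem_tsupport hn.2,
      mul_zero, sub_zero]
  obtain ⟨ψ, hψd, hψs, hψt, hψ⟩ := exists_deriv_eq_of_integral_eq_zero hαβ
    (ζ := fun t => η t - (∫ s, η s) * θ t) (hηd.sub (contDiff_const.mul hθd))
    (IsCompact.of_isClosed_subset (IsCompact.union hηs hθs) (isClosed_tsupport _) hts)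
    (hts.trans (union_subset hηt hθt))
    (by
      rw [integral_sub hηi (hθi.const_mul _), integral_const_mul, hθ1, mul_one, sub_self])
  have h1 := h ψ hψd hψs hψt
  rw [hψ, integral_Ioo_smul_eq_integral (hts.trans (union_subset hηt hθt))] at h1
  have hi1 := integrable_smul_of_tsupport_subset hηd.continuous hηs hηt hw
  have hi2 := integrable_smul_of_tsupport_subset hθd.continuous hθs hθt hw
  have e1 : ∀ t, (η t - (∫ s, η s) * θ t) • w t = η t • w t - (∫ s, η s) • (θ t • w t) := by
    intro t
    rw [sub_smul, mul_smul]
  simp only [e1] at h1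
  have hi3 : Integrable fun t => (∫ s, η s) • (θ t • w t) := hi2.smul _
  rw [integral_sub hi1 hi3, integral_smul, ← hc] at h1
  simp only [smul_sub]
  rw [integral_sub hi1 (hηi.smul_const c), integral_smul_const]
  exact h1

/-- Integration by parts of a primitive of an integrable function against a test function. -/
theorem integral_deriv_smul_primitive [CompleteSpace E] {v : ℝ → E}
    (hv : IntegrableOn v (Ioo α β)) {ψ : ℝ → ℝ} (hd : ContDiff ℝ ∞ ψ)
    (hψ : tsupport ψ ⊆ Ioo α β) :
    ∫ t in Ioo α β, deriv ψ t • (∫ s in α..t, v s) = -∫ t in Ioo α β, ψ t • v t := by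
  have hd1 : ContDiff ℝ 1 ψ := hd.of_le (by exact_mod_cast le_top)
  have hdc : Continuous (deriv ψ) := hd1.continuous_deriv le_rfl
  have hψ' : IntegrableOn (deriv ψ) (Ioo α β) :=
    (hdc.integrableOn_Icc (a := α) (b := β)).mono_set Ioo_subset_Icc_self
  have hβ : ψ β = 0 := image_eq_zero_of_notMem_tsupport fun h => lt_irrefl _ (hψ h).2
  have h1 : ∀ t ∈ Ioo α β, deriv ψ t • (∫ s in α..t, v s) =
      ∫ s in Ioo α β, {p : ℝ × ℝ | p.2 ≤ p.1}.indicator (fun p => deriv ψ p.1 • v p.2) (t, s) := by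
    intro t ht
    have e : ∀ s, {p : ℝ × ℝ | p.2 ≤ p.1}.indicator (fun p => deriv ψ p.1 • v p.2) (t, s) =
        deriv ψ t • (Iic t).indicator v s := by
      intro s
      by_cases hs : s ≤ t
      · rw [indicator_of_mem (show (t, s) ∈ {p : ℝ × ℝ | p.2 ≤ p.1} from hs),
          indicator_of_mem (mem_Iic.2 hs)]
      · rw [indicator_of_notMem (show (t, s) ∉ {p : ℝ × ℝ | p.2 ≤ p.1} from hs),
          indicator_of_notMem (fun h => hs (mem_Iic.1 h)), smul_zero]
    have e2 : Ioo α β ∩ Iic t = Ioc α t := by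
      ext s
      simp only [mem_inter_iff, mem_Ioo, mem_Iic, mem_Ioc]
      exact ⟨fun h => ⟨h.1.1, h.2⟩, fun h => ⟨⟨h.1, h.2.trans_lt ht.2⟩, h.2⟩⟩
    simp only [e]
    rw [integral_smul, setIntegral_indicator measurableSet_Iic, e2,
      intervalIntegral.integral_of_le ht.1.le]
  have h2 : ∀ s ∈ Ioo α β, -(ψ s • v s) =
      ∫ t in Ioo α β, {p : ℝ × ℝ | p.2 ≤ p.1}.indicator (fun p => deriv ψ p.1 • v p.2) (t, s) := by
    intro s hs
    have e : ∀ t, {p : ℝ × ℝ | p.2 ≤ p.1}.indicator (fun p => deriv ψ p.1 • v p.2) (t, s) =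
        (Ici s).indicator (deriv ψ) t • v s := by
      intro t
      by_cases ht : s ≤ t
      · rw [indicator_of_mem (show (t, s) ∈ {p : ℝ × ℝ | p.2 ≤ p.1} from ht),
          indicator_of_mem (mem_Ici.2 ht)]
      · rw [indicator_of_notMem (show (t, s) ∉ {p : ℝ × ℝ | p.2 ≤ p.1} from ht),
          indicator_of_notMem (fun h => ht (mem_Ici.1 h)), zero_smul]
    have e2 : Ioo α β ∩ Ici s = Ico s β := by
      ext t
      simp only [mem_inter_iff, mem_Ioo, mem_Ici, mem_Ico]
      exact ⟨fun h => ⟨h.2, h.1.2⟩, fun h => ⟨⟨hs.1.trans_le h.1, h.2⟩, h.1⟩⟩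
    simp only [e]
    rw [integral_smul_const, setIntegral_indicator measurableSet_Ici, e2,
      integral_Ico_eq_integral_Ioo, ← integral_Ioc_eq_integral_Ioo,
      ← intervalIntegral.integral_of_le hs.2.le,
      intervalIntegral.integral_deriv_eq_sub (fun t _ => (hd1.differentiable one_ne_zero) t)
        (hdc.intervalIntegrable _ _), hβ, zero_sub, neg_smul]
  rw [setIntegral_congr_fun measurableSet_Ioo h1, ← integral_neg,
    setIntegral_congr_fun measurableSet_Ioo h2]
  refine integral_integral_swap ?_
  have hm : MeasurableSet {p : ℝ × ℝ | p.2 ≤ p.1} := measurableSet_le measurable_snd measurable_fst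
  exact (Integrable.smul_prod hψ' hv).indicator hm

end

section

variable {n : ℕ} {α β : ℝ}

theorem continuousOn_primitive_Ioo (hαβ : α < β) {v : ℝ → StateSpace n}
    (hv : IntegrableOn v (Ioo α β)) : ContinuousOn (fun t => ∫ s in α..t, v s) (Icc α β) := by
  have := intervalIntegral.continuousOn_primitive_interval (μ := volume) (a := α) (b := β) (f := v)
    (by rwa [uIcc_of_le hαβ.le, integrableOn_Icc_iff_integrableOn_Ioo])
  rwa [uIcc_of_le hαβ.le] at this

/-- A primitive has the function as its weak derivative. -/
theorem hasWeakDeriv_primitive (hαβ : α < β) {v : ℝ → StateSpace n}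
    (hv : IntegrableOn v (Ioo α β)) (c : StateSpace n) :
    HasWeakDeriv α β (fun t => c + ∫ s in α..t, v s) v := by
  have hcont := continuousOn_primitive_Ioo hαβ hv
  refine ⟨?_, hv.locallyIntegrableOn, fun ψ hd hs hψ => ?_⟩
  · exact ((continuousOn_const.add hcont).mono Ioo_subset_Icc_self).locallyIntegrableOn
      measurableSet_Ioo
  · have hd1 : ContDiff ℝ 1 ψ := hd.of_le (by exact_mod_cast le_top)
    have hdc : Continuous (deriv ψ) := hd1.continuous_deriv le_rfl
    have hα : ψ α = 0 := image_eq_zero_of_notMem_tsupport fun h => lt_irrefl _ (hψ h).1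
    have hβ : ψ β = 0 := image_eq_zero_of_notMem_tsupport fun h => lt_irrefl _ (hψ h).2
    have hi1 : IntegrableOn (fun t => deriv ψ t • c) (Ioo α β) :=
      ((hdc.smul continuous_const).integrableOn_Icc (a := α) (b := β)).mono_set
        Ioo_subset_Icc_self
    have hi2 : IntegrableOn (fun t => deriv ψ t • ∫ s in α..t, v s) (Ioo α β) :=
      (ContinuousOn.integrableOn_Icc (hdc.continuousOn.smul hcont)).mono_set Ioo_subset_Icc_self
    simp only [smul_add]
    rw [integral_add hi1 hi2, integral_deriv_smul_primitive hv hd hψ, integral_smul_const,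
      ← integral_Ioc_eq_integral_Ioo, ← intervalIntegral.integral_of_le hαβ.le,
      intervalIntegral.integral_deriv_eq_sub (fun t _ => (hd1.differentiable one_ne_zero) t)
        (hdc.intervalIntegrable _ _), hα, hβ, sub_zero, zero_smul, zero_add]

/-- A function with an integrable weak derivative is a primitive of it. -/
theorem HasWeakDeriv.exists_ae_eq (hαβ : α < β) {u v : ℝ → StateSpace n}
    (h : HasWeakDeriv α β u v) (hv : IntegrableOn v (Ioo α β)) :
    ∃ c, ∀ᵐ t ∂volume.restrict (Ioo α β), u t = c + ∫ s in α..t, v s := by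
  have h0 := hasWeakDeriv_primitive hαβ hv 0
  obtain ⟨c, hc⟩ := exists_ae_eq_const_of_integral_deriv_smul_eq_zero hαβ (h.1.sub h0.1)
    fun ψ hd hs hψ => by
      have hd1 : ContDiff ℝ 1 ψ := hd.of_le (by exact_mod_cast le_top)
      have hdc : Continuous (deriv ψ) := hd1.continuous_deriv le_rfl
      have hts : tsupport (deriv ψ) ⊆ Ioo α β := tsupport_deriv_subset.trans hψ
      simp only [Pi.sub_apply, smul_sub]
      rw [integral_sub
        (integrable_smul_of_tsupport_subset hdc hs.deriv hts h.1).integrableOn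
        (integrable_smul_of_tsupport_subset hdc hs.deriv hts h0.1).integrableOn,
        h.2.2 ψ hd hs hψ, h0.2.2 ψ hd hs hψ, sub_self]
  refine ⟨c, ?_⟩
  filter_upwards [hc] with t ht
  rw [Pi.sub_apply, zero_add, sub_eq_iff_eq_add] at ht
  exact ht

theorem MemL2.integrableOn {u : ℝ → StateSpace n} (h : MemL2 α β u) :
    IntegrableOn u (Ioo α β) :=
  MemLp.integrable (by norm_num) h

theorem ContinuousOn.memL2 {u : ℝ → StateSpace n} (h : ContinuousOn u (Icc α β)) :
    MemL2 α β u := by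
  obtain ⟨K, hK⟩ := isCompact_Icc.exists_bound_of_continuousOn h
  exact MemLp.of_bound ((h.mono Ioo_subset_Icc_self).aestronglyMeasurable measurableSet_Ioo) K
    ((ae_restrict_iff' measurableSet_Ioo).2
      (Filter.Eventually.of_forall fun t ht => hK t ⟨ht.1.le, ht.2.le⟩))

/-- Continuous functions on an interval that agree almost everywhere agree everywhere. -/
theorem eqOn_Icc_of_ae_eq {E : Type*} [NormedAddCommGroup E] (hαβ : α < β) {u v : ℝ → E}
    (hu : ContinuousOn u (Icc α β)) (hv : ContinuousOn v (Icc α β))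
    (h : ∀ᵐ t ∂volume.restrict (Ioo α β), u t = v t) : EqOn u v (Icc α β) :=
  Measure.eqOn_Icc_of_ae_eq volume hαβ.ne
    (by rw [Filter.EventuallyEq, Measure.restrict_congr_set Ioo_ae_eq_Icc.symm]; exact h) hu hv

end

/-! ### Continuous representatives of Sobolev functions -/

section

variable {n : ℕ} {α β : ℝ}

theorem MemH1.exists_continuous (hαβ : α < β) {u : ℝ → StateSpace n} (h : MemH1 α β u) :
    ∃ G : ℝ → StateSpace n, Continuous G ∧ (∃ M, ∀ t, ‖G t‖ ≤ M) ∧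
      ∀ᵐ t ∂volume.restrict (Ioo α β), u t = G t := by
  obtain ⟨-, v, hv, hv2⟩ := h
  obtain ⟨c, hc⟩ := hv.exists_ae_eq hαβ hv2.integrableOn
  have hcont : ContinuousOn (fun t => c + ∫ s in α..t, v s) (Icc α β) :=
    continuousOn_const.add (continuousOn_primitive_Ioo hαβ hv2.integrableOn)
  obtain ⟨M, hM⟩ := isCompact_Icc.exists_bound_of_continuousOn hcont
  refine ⟨fun t => c + ∫ s in α..(projIcc α β hαβ.le t), v s, ?_, ⟨M, fun t => ?_⟩, ?_⟩
  · exact hcont.comp_continuous (continuous_subtype_val.comp continuous_projIcc)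
      fun t => (projIcc α β hαβ.le t).2
  · exact hM _ (projIcc α β hαβ.le t).2
  · filter_upwards [hc, ae_restrict_mem measurableSet_Ioo] with t ht hmem
    rw [ht, projIcc_of_mem hαβ.le ⟨hmem.1.le, hmem.2.le⟩]

theorem MemH2.exists_hasDerivAt (hαβ : α < β) {u : ℝ → StateSpace n} (h : MemH2 α β u) :
    ∃ P p : ℝ → StateSpace n, (∀ t, HasDerivAt P (p t) t) ∧ Continuous p ∧
      (∃ M, ∀ t, ‖p t‖ ≤ M) ∧ ∀ᵐ t ∂volume.restrict (Ioo α β), u t = P t := by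
  obtain ⟨-, v, hv, hv1⟩ := h
  obtain ⟨p, hp, hpM, hvp⟩ := hv1.exists_continuous hαβ
  obtain ⟨c, hc⟩ := hv.exists_ae_eq hαβ hv1.1.integrableOn
  refine ⟨fun t => c + ∫ s in α..t, p s, p, fun t => ?_, hp, hpM, ?_⟩
  · exact (intervalIntegral.integral_hasDerivAt_right (hp.intervalIntegrable _ _)
      hp.stronglyMeasurable.stronglyMeasurableAtFilter hp.continuousAt).const_add c
  · filter_upwards [hc, ae_restrict_mem measurableSet_Ioo] with t ht hmem
    rw [ht, intervalIntegral.integral_congr_ae]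
    have := (ae_restrict_iff' measurableSet_Ioo).1 hvp
    filter_upwards [this] with s hs hs'
    rw [uIoc_of_le hmem.1.le] at hs'
    exact hs ⟨hs'.1, hs'.2.trans_lt hmem.2⟩

theorem HasWeakDeriv.congr_left {u u' v : ℝ → StateSpace n} (h : HasWeakDeriv α β u v)
    (hu : EqOn u u' (Ioo α β)) : HasWeakDeriv α β u' v := by
  refine ⟨?_, h.2.1, fun ψ hd hs hψ => ?_⟩
  · refine (locallyIntegrableOn_iff isOpen_Ioo.isLocallyClosed).2 fun k hk hkc => ?_
    exact (h.1.integrableOn_compact_subset hk hkc).congr_fun (hu.mono hk) hkc.measurableSet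
  · rw [← h.2.2 ψ hd hs hψ]
    refine setIntegral_congr_fun measurableSet_Ioo fun t ht => ?_
    simp only [hu ht]

end

/-! ### Solutions of the delay equation as solutions of a Volterra equation -/

section

variable {n : ℕ} {b T : ℝ} {A : Matrix (Fin n) (Fin n) ℝ} {f : StateSpace n → StateSpace n}
  {φ g P G : ℝ → StateSpace n} {τ : ℝ}

/-- A weak solution, continued by constants, solves the integrated equation. -/
theorem IsDelaySolution.exists_isDelayVolterra (hb : 0 < b) (hT : 0 < T) (hf : Continuous f)
    (hP : Continuous P) (hG : Continuous G)
    (hφP : ∀ᵐ t ∂volume.restrict (Ioo (-b) 0), φ t = P t)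
    (hgG : ∀ᵐ t ∂volume.restrict (Ioo 0 T), g t = G t) (hτ : τ ∈ Icc 0 b)
    {y : ℝ → StateSpace n} (hy : IsDelaySolution b T A f φ g τ y) :
    ∃ u : ℝ → StateSpace n, Continuous u ∧ EqOn u y (Icc (-b) T) ∧
      (∀ t ∈ Icc (-b) 0, u t = P t) ∧
      IsDelayVolterra b T (Matrix.toEuclideanLin A).toContinuousLinearMap τ (fun _ => P 0)
        (fun s => -f (u s) + G s) u := by
  set L := (Matrix.toEuclideanLin A).toContinuousLinearMap with hL
  have hbT : -b ≤ T := by linarith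
  set u : ℝ → StateSpace n := fun t => y (projIcc (-b) T hbT t) with hu
  have huc : Continuous u :=
    hy.continuousOn.comp_continuous (continuous_subtype_val.comp continuous_projIcc)
      fun t => (projIcc (-b) T hbT t).2
  have huy : EqOn u y (Icc (-b) T) := fun t ht => by
    simp only [hu, projIcc_of_mem hbT ht]
  have hhist : EqOn u P (Icc (-b) 0) := by
    refine eqOn_Icc_of_ae_eq (by linarith) huc.continuousOn hP.continuousOn ?_
    filter_upwards [hφP, hy.history, ae_restrict_mem measurableSet_Ioo] with t h1 h2 h3
    rw [huy ⟨h3.1.le, h3.2.le.trans hT.le⟩, h2, h1]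
  refine ⟨u, huc, huy, hhist, huc.stronglyMeasurable, ?_, ?_, ?_⟩
  · exact Continuous.intervalIntegrable (by fun_prop) _ _
  · exact isCompact_Icc.exists_bound_of_continuousOn huc.continuousOn
  obtain ⟨v, hv, hveq⟩ := hy.equation
  set w : ℝ → StateSpace n := fun s => -f (u s) + G s + L (u (s - τ)) with hw
  have hwc : Continuous w := by fun_prop
  have hvw : ∀ᵐ t ∂volume.restrict (Ioo 0 T), v t = w t := by
    filter_upwards [hveq, hgG, ae_restrict_mem measurableSet_Ioo] with t h1 h2 h3
    have h4 : u t = y t := huy ⟨by linarith [h3.1], h3.2.le⟩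
    have h5 : u (t - τ) = y (t - τ) := huy (sub_mem_Icc_of_mem hτ ⟨h3.1.le, h3.2.le⟩)
    simp only [hw, h4, h5, ← h2]
    change v t = -f (y t) + g t + Matrix.toEuclideanLin A (y (t - τ))
    rw [eq_sub_of_add_eq h1]
    abel
  have hwi : IntegrableOn w (Ioo 0 T) :=
    (hwc.integrableOn_Icc (a := 0) (b := T)).mono_set Ioo_subset_Icc_self
  have hvi : IntegrableOn v (Ioo 0 T) :=
    hwi.congr (hvw.mono fun t ht => ht.symm)
  obtain ⟨c, hc⟩ := hv.exists_ae_eq hT hvi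
  have hcw : EqOn u (fun t => c + ∫ s in 0..t, w s) (Icc 0 T) := by
    refine eqOn_Icc_of_ae_eq hT huc.continuousOn
      (continuousOn_const.add (continuousOn_primitive_Ioo hT hwi)) ?_
    filter_upwards [hc, ae_restrict_mem measurableSet_Ioo] with t h1 h3
    rw [huy ⟨by linarith [h3.1], h3.2.le⟩, h1, intervalIntegral.integral_congr_ae]
    filter_upwards [(ae_restrict_iff' measurableSet_Ioo).1 hvw] with s hs hs'
    rw [uIoc_of_le h3.1.le] at hs'
    exact hs ⟨hs'.1, hs'.2.trans_lt h3.2⟩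
  have hc0 : c = P 0 := by
    have h1 := hcw ⟨le_rfl, hT.le⟩
    simp only [intervalIntegral.integral_same, add_zero] at h1
    rw [← h1, hhist ⟨by linarith, le_rfl⟩]
  intro t ht
  have h1 := hcw ht
  simp only [hw] at h1
  rw [h1, hc0, intervalIntegral.integral_add (Continuous.intervalIntegrable (by fun_prop) _ _)
    (Continuous.intervalIntegrable (by fun_prop) _ _),
    L.intervalIntegral_comp_comm (Continuous.intervalIntegrable (by fun_prop) _ _), add_assoc]

/-- A continuous solution of the integrated equation is a weak solution. -/
theorem IsDelayVolterra.isDelaySolution (hT : 0 < T) (hf : Continuous f)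
    (hG : Continuous G) (hφP : ∀ᵐ t ∂volume.restrict (Ioo (-b) 0), φ t = P t)
    (hgG : ∀ᵐ t ∂volume.restrict (Ioo 0 T), g t = G t)
    {u : ℝ → StateSpace n} (huc : Continuous u) (hhist : ∀ t ∈ Icc (-b) 0, u t = P t)
    (hu : IsDelayVolterra b T (Matrix.toEuclideanLin A).toContinuousLinearMap τ (fun _ => P 0)
        (fun s => -f (u s) + G s) u) :
    IsDelaySolution b T A f φ g τ u := by
  set L := (Matrix.toEuclideanLin A).toContinuousLinearMap with hL
  set w : ℝ → StateSpace n := fun s => -f (u s) + G s + L (u (s - τ)) with hw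
  have hwc : Continuous w := by fun_prop
  have hwi : IntegrableOn w (Ioo 0 T) :=
    (hwc.integrableOn_Icc (a := 0) (b := T)).mono_set Ioo_subset_Icc_self
  have hweak : HasWeakDeriv 0 T u w := by
    refine (hasWeakDeriv_primitive hT hwi (P 0)).congr_left fun t ht => ?_
    simp only [hw]
    rw [hu.eq t ⟨ht.1.le, ht.2.le⟩,
      intervalIntegral.integral_add (Continuous.intervalIntegrable (by fun_prop) _ _)
      (Continuous.intervalIntegrable (by fun_prop) _ _),
      L.intervalIntegral_comp_comm (Continuous.intervalIntegrable (by fun_prop) _ _), add_assoc]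
  refine ⟨huc.continuousOn, ⟨huc.continuousOn.memL2, w, hweak, hwc.continuousOn.memL2⟩, ?_,
    w, hweak, ?_⟩
  · filter_upwards [hφP, ae_restrict_mem measurableSet_Ioo] with t h1 h2
    rw [h1, hhist t ⟨h2.1.le, h2.2.le⟩]
  · filter_upwards [hgG] with t h1
    simp only [hw, h1]
    change -f (u t) + G t + Matrix.toEuclideanLin A (u (t - τ)) + f (u t) = _
    abel

end

/-! ### The a priori bound and the truncation -/

section

variable {E : Type*} [NormedAddCommGroup E] [InnerProductSpace ℝ E]

/-- A one-sided Lipschitz condition on the derivative bounds `⟪f u, u⟫` from below. -/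
theorem le_inner_of_fderiv {f : E → E} (hf : Differentiable ℝ f) {lam : ℝ}
    (h : ∀ y v : E, 0 ≤ inner ℝ (fderiv ℝ f y v + lam • v) v) (u : E) :
    -(lam * ‖u‖ ^ 2) - ‖f 0‖ * ‖u‖ ≤ inner ℝ (f u) u := by
  have hd : ∀ s : ℝ, HasDerivAt (fun s : ℝ => inner ℝ (f (s • u)) u + s * (lam * ‖u‖ ^ 2))
      (inner ℝ (fderiv ℝ f (s • u) u + lam • u) u) s := by
    intro s
    have h1 : HasDerivAt (fun s : ℝ => s • u) u s := by
      simpa using (hasDerivAt_id s).smul_const u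
    have h2 : HasDerivAt (fun s : ℝ => f (s • u)) (fderiv ℝ f (s • u) u) s :=
      (hf (s • u)).hasFDerivAt.comp_hasDerivAt s h1
    have h3 := (h2.inner ℝ (hasDerivAt_const s u)).add
      ((hasDerivAt_id s).mul_const (lam * ‖u‖ ^ 2))
    refine h3.congr_deriv ?_
    rw [inner_add_left, real_inner_smul_left, real_inner_self_eq_norm_sq]
    simp
  have hmono : Monotone fun s : ℝ => inner ℝ (f (s • u)) u + s * (lam * ‖u‖ ^ 2) :=
    monotone_of_deriv_nonneg (fun s => (hd s).differentiableAt) fun s => by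
      rw [(hd s).deriv]
      exact h _ _
  have h01 := hmono zero_le_one
  simp only [zero_smul, one_smul, zero_mul, one_mul, add_zero] at h01
  have h2 : -(‖f 0‖ * ‖u‖) ≤ inner ℝ (f 0) u :=
    (abs_le.1 (abs_real_inner_le_norm (f 0) u)).1
  linarith

/-- The a priori bound. It only uses a lower bound of `⟪f u, u⟫`, hence it holds for `f` and for the
product of `f` with a cut-off function alike. -/
theorem IsDelayVolterra.exists_bound_of_inner [CompleteSpace E] {b T : ℝ} (hb : 0 ≤ b)
    (hT : 0 ≤ T) (A : E →L[ℝ] E) {P G : ℝ → E} (hP : Continuous P) (hG : Continuous G)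
    {lam k : ℝ} (hlam : 0 ≤ lam) :
    ∃ R, ∀ (τ : ℝ) (f : E → E) (u : ℝ → E), τ ∈ Icc 0 b → Continuous f →
      (∀ v, -(lam * ‖v‖ ^ 2) - k * ‖v‖ ≤ inner ℝ (f v) v) → Continuous u →
      (∀ t ∈ Icc (-b) 0, u t = P t) →
      IsDelayVolterra b T A τ (fun _ => P 0) (fun s => -f (u s) + G s) u →
      ∀ t ∈ Icc (-b) T, ‖u t‖ ≤ R := by
  obtain ⟨K, hK⟩ := isCompact_Icc.exists_bound_of_continuousOn (s := Icc (-b) 0) hP.continuousOn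
  obtain ⟨γ, hγ⟩ := isCompact_Icc.exists_bound_of_continuousOn (s := Icc 0 T) hG.continuousOn
  have h0b : (0 : ℝ) ∈ Icc (-b) 0 := ⟨by linarith, le_rfl⟩
  have hK0 : 0 ≤ K := (norm_nonneg _).trans (hK 0 h0b)
  -- the constants come from Young's inequality for the three products in `2 ⟪u, u'⟫`
  set C := 2 * lam + 2 + 2 * ‖A‖ with hC
  set a := K ^ 2 + (k ^ 2 + γ ^ 2) * T + ‖A‖ * (b * K ^ 2) with ha
  have hC0 : 0 ≤ C := by positivity
  have ha0 : 0 ≤ a := by positivity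
  set B := a * (1 + C * Real.exp (C * T) * T) with hB
  have hB0 : 0 ≤ B := by positivity
  refine ⟨max K (Real.sqrt B), fun τ f u hτ hf hdiss hu hhist heq t ht => ?_⟩
  rcases le_total t 0 with ht0 | ht0
  · rw [hhist t ⟨ht.1, ht0⟩]
    exact (hK t ⟨ht.1, ht0⟩).trans (le_max_left _ _)
  refine le_trans ?_ (le_max_right _ _)
  refine Real.le_sqrt_of_sq_le ?_
  have hN : Continuous fun s => -f (u s) + G s := by fun_prop
  set w : ℝ → E := fun s => -f (u s) + G s + A (u (s - τ)) with hw
  have hwc : Continuous w := by fun_prop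
  set Ψ : ℝ → E := fun t => P 0 + ((∫ s in 0..t, (-f (u s) + G s)) +
    A (∫ s in 0..t, u (s - τ))) with hΨ
  have hΨd : ∀ s, HasDerivAt Ψ (w s) s := fun s =>
    (hasDerivAt_integral_add hN hu A τ s).const_add (P 0)
  have hΨc : Continuous Ψ := continuous_iff_continuousAt.2 fun s => (hΨd s).continuousAt
  have hΨu : ∀ s ∈ Icc 0 T, u s = Ψ s := fun s hs => by
    rw [heq.eq s hs, add_assoc]
  have hsq : ∀ s, HasDerivAt (fun s => ‖Ψ s‖ ^ 2) (2 * inner ℝ (Ψ s) (w s)) s := fun s =>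
    (hΨd s).norm_sq
  have hm : Continuous fun s => ‖u s‖ ^ 2 := by fun_prop
  have hmτ : Continuous fun s => ‖u (s - τ)‖ ^ 2 := by fun_prop
  obtain ⟨K', hK'⟩ := isCompact_Icc.exists_bound_of_continuousOn (s := Icc (-b) T) hm.continuousOn
  have key : ∀ r ∈ Icc 0 T, ‖u r‖ ^ 2 ≤ a + C * ∫ s in 0..r, ‖u s‖ ^ 2 := by
    intro r hr
    have h1 : (∫ s in 0..r, 2 * inner ℝ (Ψ s) (w s)) = ‖Ψ r‖ ^ 2 - ‖Ψ 0‖ ^ 2 :=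
      intervalIntegral.integral_eq_sub_of_hasDerivAt (fun s _ => hsq s)
        (Continuous.intervalIntegrable (by fun_prop) _ _)
    have h2 : (∫ s in 0..r, 2 * inner ℝ (Ψ s) (w s)) ≤
        ∫ s in 0..r, ((2 * lam + 2 + ‖A‖) * ‖u s‖ ^ 2 + ‖A‖ * ‖u (s - τ)‖ ^ 2 +
          (k ^ 2 + γ ^ 2)) := by
      refine intervalIntegral.integral_mono_on hr.1
        (Continuous.intervalIntegrable (by fun_prop) _ _)
        (Continuous.intervalIntegrable (by fun_prop) _ _) fun s hs => ?_
      have hs' : s ∈ Icc 0 T := ⟨hs.1, hs.2.trans hr.2⟩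
      rw [← hΨu s hs']
      simp only [hw]
      rw [inner_add_right, inner_add_right, inner_neg_right, real_inner_comm]
      have e1 := hdiss (u s)
      have e2 : inner ℝ (u s) (G s) ≤ ‖u s‖ * γ :=
        (real_inner_le_norm _ _).trans (by gcongr; exact hγ s hs')
      have e3 : inner ℝ (u s) (A (u (s - τ))) ≤ ‖u s‖ * (‖A‖ * ‖u (s - τ)‖) :=
        (real_inner_le_norm _ _).trans (by gcongr; exact A.le_opNorm _)
      have e4 : 2 * (k * ‖u s‖) ≤ k ^ 2 + ‖u s‖ ^ 2 := by
        linarith [two_mul_le_add_sq k ‖u s‖]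
      have e5 : 2 * (‖u s‖ * γ) ≤ ‖u s‖ ^ 2 + γ ^ 2 := by
        linarith [two_mul_le_add_sq ‖u s‖ γ]
      have e6 : 2 * (‖u s‖ * (‖A‖ * ‖u (s - τ)‖)) ≤
          ‖A‖ * (‖u s‖ ^ 2 + ‖u (s - τ)‖ ^ 2) := by
        have := mul_le_mul_of_nonneg_left (two_mul_le_add_sq ‖u s‖ ‖u (s - τ)‖) (norm_nonneg A)
        linarith
      linarith
    have h3 : ∫ s in 0..r, ‖u (s - τ)‖ ^ 2 ≤ b * K ^ 2 + ∫ s in 0..r, ‖u s‖ ^ 2 := by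
      have := integral_norm_comp_sub_le (u := fun s => ‖u s‖ ^ 2) hτ hm.stronglyMeasurable hK'
        (sq_nonneg K) (fun s hs => by
          rw [norm_pow, norm_norm, hhist s hs]
          gcongr
          exact hK s hs) hr
      simpa only [norm_pow, norm_norm] using this
    have h4 : (k ^ 2 + γ ^ 2) * r ≤ (k ^ 2 + γ ^ 2) * T := by
      gcongr
      exact hr.2
    have h5 : ‖Ψ 0‖ ^ 2 ≤ K ^ 2 := by
      rw [← hΨu 0 ⟨le_rfl, hT⟩, hhist 0 h0b]
      gcongr
      exact hK 0 h0b
    have h6 := mul_le_mul_of_nonneg_left h3 (norm_nonneg A)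
    rw [h1, intervalIntegral.integral_add (Continuous.intervalIntegrable (by fun_prop) _ _)
      intervalIntegrable_const, intervalIntegral.integral_add
      (Continuous.intervalIntegrable (by fun_prop) _ _)
      (Continuous.intervalIntegrable (by fun_prop) _ _), intervalIntegral.integral_const_mul,
      intervalIntegral.integral_const_mul, intervalIntegral.integral_const, sub_zero,
      smul_eq_mul] at h2
    rw [hΨu r hr, ha, hC]
    linarith
  exact le_mul_of_le_add_integral hC0 ha0 (hm.intervalIntegrable _ _) (fun s _ => sq_nonneg _) key
    t ⟨ht0, ht.2⟩

theorem HasCompactSupport.exists_bound_fderiv_fderiv {E : Type*} [NormedAddCommGroup E]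
    [NormedSpace ℝ E] {F : E → E} (hs : HasCompactSupport F) (hF : ContDiff ℝ 2 F) :
    ∃ M, ∀ v, ‖F v‖ ≤ M ∧ ‖fderiv ℝ F v‖ ≤ M ∧ ‖fderiv ℝ (fderiv ℝ F) v‖ ≤ M := by
  have hF1 : ContDiff ℝ 1 (fderiv ℝ F) := hF.fderiv_right (by norm_num)
  have hs1 : HasCompactSupport (fderiv ℝ F) := hs.fderiv ℝ
  have hs2 : HasCompactSupport (fderiv ℝ (fderiv ℝ F)) := hs1.fderiv ℝ
  obtain ⟨M₀, hM₀⟩ := hs.exists_bound_of_continuous hF.continuous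
  obtain ⟨M₁, hM₁⟩ := hs1.exists_bound_of_continuous hF1.continuous
  obtain ⟨M₂, hM₂⟩ := hs2.exists_bound_of_continuous (hF1.continuous_fderiv one_ne_zero)
  exact ⟨max M₀ (max M₁ M₂), fun v => ⟨(hM₀ v).trans (le_max_left _ _),
    (hM₁ v).trans ((le_max_left _ _).trans (le_max_right _ _)),
    (hM₂ v).trans ((le_max_right _ _).trans (le_max_right _ _))⟩⟩

/-- A `C²` map can be changed outside a ball to a map with bounded derivatives, such that lower
bounds of `⟪f u, u⟫` are kept. -/
theorem exists_truncation [FiniteDimensional ℝ E] {f : E → E} (hf : ContDiff ℝ 2 f) {lam k : ℝ}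
    (hlam : 0 ≤ lam) (hk : 0 ≤ k)
    (h : ∀ v, -(lam * ‖v‖ ^ 2) - k * ‖v‖ ≤ inner ℝ (f v) v) (R : ℝ) :
    ∃ F : E → E, ContDiff ℝ 2 F ∧ (∀ v, ‖v‖ ≤ R → F v = f v) ∧
      (∀ v, -(lam * ‖v‖ ^ 2) - k * ‖v‖ ≤ inner ℝ (F v) v) ∧
      ∃ M, ∀ v, ‖F v‖ ≤ M ∧ ‖fderiv ℝ F v‖ ≤ M ∧ ‖fderiv ℝ (fderiv ℝ F) v‖ ≤ M := by
  let χ : ContDiffBump (0 : E) := ⟨|R| + 1, |R| + 2, by positivity, by linarith⟩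
  have hχ : ContDiff ℝ 2 fun v => χ v := χ.contDiff (n := 2)
  have hF : ContDiff ℝ 2 fun v => χ v • f v := hχ.smul hf
  have hs : HasCompactSupport fun v => χ v • f v := χ.hasCompactSupport.smul_right
  refine ⟨_, hF, fun v hv => ?_, fun v => ?_, ?_⟩
  · have : χ v = 1 := χ.one_of_mem_closedBall (by
      rw [mem_closedBall_zero_iff]
      exact hv.trans ((le_abs_self R).trans (by simp only [χ]; linarith)))
    simp only [this, one_smul]
  · rw [real_inner_smul_left]
    have h0 : 0 ≤ χ v := χ.nonneg
    have h1 : χ v ≤ 1 := χ.le_one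
    have h2 := mul_le_mul_of_nonneg_left (h v) h0
    have h3 : 0 ≤ lam * ‖v‖ ^ 2 + k * ‖v‖ := by positivity
    nlinarith
  · exact hs.exists_bound_fderiv_fderiv hF

end

theorem theorem5p1 (n : ℕ) (b T : ℝ) (hb : 0 < b) (hT : 0 < T)
    (A : Matrix (Fin n) (Fin n) ℝ) (f : StateSpace n → StateSpace n) (φ g : ℝ → StateSpace n)
    (hf : ContDiff ℝ 2 f)
    (lam : ℝ) (hlam : 0 < lam)
    (hfmono : ∀ y v : StateSpace n, 0 ≤ inner ℝ (fderiv ℝ f y v + lam • v) v)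
    (hφ : MemH2 (-b) 0 φ) (hg : MemH1 0 T g) :
    ∃ x : ℝ → ℝ → StateSpace n,
      -- for every delay, `x τ` is the unique solution
      (∀ τ ∈ Icc 0 b, IsDelaySolution b T A f φ g τ (x τ) ∧
        ∀ y, IsDelaySolution b T A f φ g τ y → EqOn y (x τ) (Icc (-b) T)) ∧
      -- `X τ` is `x τ` as an element of `L²(-b, T; ℝⁿ)`
      ∃ X : ℝ → L2Space n b T,
        (∀ τ ∈ Icc 0 b, X τ =ᵐ[volume.restrict (Ioo (-b) T)] x τ) ∧
        ContDiffOn ℝ 2 X (Icc 0 b) ∧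
        -- the derivatives exist and are continuous with values in the subspace
        ∃ X' X'' : ℝ → L2Null n b T,
          (∀ τ ∈ Icc 0 b, HasDerivWithinAt X (X' τ : L2Space n b T) (Icc 0 b) τ) ∧
          (∀ τ ∈ Icc 0 b, HasDerivWithinAt X' (X'' τ) (Icc 0 b) τ) ∧
          ContinuousOn X'' (Icc 0 b) := by
  obtain ⟨P, p, hPp, hp, ⟨M₁, hM₁⟩, hφP⟩ := hφ.exists_hasDerivAt (by linarith)
  obtain ⟨G, hG, ⟨M₂, hM₂⟩, hgG⟩ := hg.exists_continuous hT
  have hP : Continuous P := continuous_iff_continuousAt.2 fun t => (hPp t).continuousAt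
  have hdiss := le_inner_of_fderiv (hf.differentiable (by norm_num)) hfmono
  obtain ⟨R, hR⟩ := IsDelayVolterra.exists_bound_of_inner hb.le hT.le
    (Matrix.toEuclideanLin A).toContinuousLinearMap hP hG (k := ‖f 0‖) hlam.le
  obtain ⟨F, hF, hFf, hFdiss, M₃, hM₃⟩ :=
    exists_truncation hf hlam.le (norm_nonneg (f 0)) hdiss R
  let S : BoundedDelaySystem (StateSpace n) :=
    { b := b
      T := T
      A := (Matrix.toEuclideanLin A).toContinuousLinearMap
      f := F
      P := P
      p := p
      g := G
      M := max M₁ (max M₂ M₃)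
      b_nonneg := hb.le
      T_nonneg := hT.le
      contDiff := hF
      f_le := fun u => (hM₃ u).1.trans ((le_max_right _ _).trans (le_max_right _ _))
      fderiv_le := fun u => (hM₃ u).2.1.trans ((le_max_right _ _).trans (le_max_right _ _))
      fderiv_fderiv_le := fun u =>
        (hM₃ u).2.2.trans ((le_max_right _ _).trans (le_max_right _ _))
      hasDerivAt := hPp
      continuous_p := hp
      p_le := fun t => (hM₁ t).trans (le_max_left _ _)
      continuous_g := hG
      g_le := fun t => (hM₂ t).trans ((le_max_left _ _).trans (le_max_right _ _)) }
  have hmem : ∀ s ∈ Icc 0 T, s ∈ Icc (-b) T := fun s hs => ⟨by linarith [hs.1], hs.2⟩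
  -- on bounded functions the truncation is not seen
  have hcongr : ∀ (τ : ℝ) (u : ℝ → StateSpace n) (f₁ f₂ : StateSpace n → StateSpace n),
      Continuous f₂ → Continuous u → (∀ t ∈ Icc (-b) T, f₁ (u t) = f₂ (u t)) →
      IsDelayVolterra b T S.A τ (fun _ => P 0) (fun s => -f₁ (u s) + G s) u →
      IsDelayVolterra b T S.A τ (fun _ => P 0) (fun s => -f₂ (u s) + G s) u := by
    intro τ u f₁ f₂ hf₂ huc h12 hu
    refine ⟨hu.1, Continuous.intervalIntegrable (by fun_prop) _ _, hu.3, fun t ht => ?_⟩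
    rw [hu.eq t ht]
    congr 2
    refine intervalIntegral.integral_congr fun s hs => ?_
    rw [uIcc_of_le ht.1] at hs
    simp only [h12 s (hmem s ⟨hs.1, hs.2.trans ht.2⟩)]
  have hxP : ∀ τ, ∀ t ∈ Icc (-b) 0, S.x τ t = P t := fun τ t ht => S.x_of_nonpos τ ht.2
  have hxR : ∀ τ ∈ Icc 0 b, ∀ t ∈ Icc (-b) T, ‖S.x τ t‖ ≤ R := fun τ hτ =>
    hR τ F (S.x τ) hτ hF.continuous hFdiss (S.continuous_x τ) (hxP τ) (S.isDelayVolterra_x hτ)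
  obtain ⟨X, Y, Z, hX, hY, hZ, hXY, hYZ, hZc⟩ := S.exists_Lp_two
  refine ⟨S.x, fun τ hτ => ⟨?_, fun y hy => ?_⟩, X, hX,
    contDiffOn_two_of_hasDerivWithinAt hb hXY hYZ hZc, fun τ => ⟨Y τ, hY τ⟩, fun τ => ⟨Z τ, hZ τ⟩,
    hXY, fun τ hτ => hasDerivWithinAt_subtype_iff.2 (hYZ τ hτ),
    Topology.IsInducing.subtypeVal.continuousOn_iff.2 hZc⟩
  · exact IsDelayVolterra.isDelaySolution hT hf.continuous hG hφP hgG (S.continuous_x τ)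
      (hxP τ) (hcongr τ (S.x τ) F f hf.continuous (S.continuous_x τ)
        (fun t ht => hFf _ (hxR τ hτ t ht)) (S.isDelayVolterra_x hτ))
  · obtain ⟨u, huc, huy, hhist, hu⟩ :=
      hy.exists_isDelayVolterra hb hT hf.continuous hP hG hφP hgG hτ
    have huR := hR τ f u hτ hf.continuous hdiss huc hhist hu
    have huF := hcongr τ u f F hF.continuous huc (fun t ht => (hFf _ (huR t ht)).symm) hu
    obtain ⟨K, -, hK⟩ := IsDelayVolterra.exists_bound_sub b T hb.le hT.le S.A S.M_nonneg
    intro t ht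
    have := hK τ τ _ _ _ _ _ _ 0 hτ hτ le_rfl huF (S.isDelayVolterra_x hτ)
      (fun s hs => by rw [hhist s hs, hxP τ s hs]) (fun s _ => by simp [S])
      (fun s _ => by
        rw [add_zero, add_sub_add_right_eq_sub, neg_sub_neg, norm_sub_rev]
        exact S.norm_f_sub_le _ _)
      (fun s _ => by simp) t ht
    rw [mul_zero] at this
    rw [← huy ht]
    exact sub_eq_zero.1 (norm_le_zero_iff.1 this)
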